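/- Let $K$ be a field, $R=K[X]$, $R'=K[X,Y]/(YX-Y^2)$, and let $n\ge 2$. Let $P^*$ be a once-punctured $n$-gon: a polygon with vertices $P_r$ ($r\in\mathbb Z/n$, numbered counter-clockwise) and a puncture in its interior. Curves are considered up to isotopy. For $r\neq s$, let $(P_r,P_s)$ be the curve from $P_r$ to $P_s$ turning counter-clockwise around the puncture; the curves $(P_r,P_{r+1})$ are the sides. A *tagged arc* is either a curve $(P_r,P_s)$ with $s\ne r,r+1$, or a curve from some $P_r$ to the puncture tagged *plain* or *notched*. Two tagged arcs are *compatible* if they can be realised with disjoint relative interiors and, when both end at the puncture and are not isotopic, they have the same tag. A *tagged triangulation* $\sigma$ is the set of all sides together with a maximal set of pairwise compatible tagged arcs; its elements are called edges. *The ice quiver $(Q_\sigma,F)$.* The vertices of $Q_\sigma$ are the edges of $\sigma$; the set $F$ of frozen vertices is the set of sides. A *true triangle* is a triangle formed by edges of $\sigma$ without the puncture in its interior (the puncture may be one of its vertices). The arrows are the following. - For each corner of each true triangle, with sides $a,b$ meeting there, there is one internal arrow $a\to b$ if $b$ follows $a$ anticlockwise inside the triangle around this corner. - If both the plain and the notched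 arc, $i$ and $j$, from some $P_k$ to the puncture belong to $\sigma$, they lie in a digon of $\sigma$ with edges $b=(P_k,P_s)$ and $a=(P_s,P_k)$, and there are internal arrows $\eta:a\to b$ (around $P_s$) and $\alpha:b\to j$, $\beta:j\to a$, $\gamma:b\to i$, $\delta:i\to a$ (around $P_k$). - For each vertex $P_k$ of the polygon incident to at least one tagged arc of $\sigma$, there is one external arrow $(P_{k-1},P_k)\to(P_k,P_{k+1})$. *The potential $W_\sigma$.* It is the sum of the clockwise $3$-cycles given by the true triangles (and of $\eta\alpha\beta$ and $\eta\gamma\delta$ in the digon case), minus the sum of the anticlockwise external cycles, minus the anticlockwise punctured cycle formed by the internal arrows around the puncture (there is none in the digon case). There is one anticlockwise external cycle for each external arrow: that arrow followed by the internal arrows around $P_k$ from $(P_k,P_{k+1})$ to $(P_{k-1},P_k)$; in the digon case, the one at the vertex $P_k$ of $i$ and $j$ is taken through $\gamma\delta$. *The algebra.* Compose paths from left to right, and let $KQ_\sigma$ be the path algebra. For an arrow $\alpha$ let $\partial_\alpha$ be the cyclic derivative, $\partial_\alpha(\alpha_1\cdots\alpha_d)=\sum_{\alpha_i=\alpha}\alpha_{i+1}\cdots\alpha_d\alpha_1\cdots\alpha_{i-1}$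 on cycles. The frozen Jacobian algebra $\Gamma_\sigma=\mathcal P(Q_\sigma,W_\sigma,F)$ is the quotient of $KQ_\sigma$ by the two-sided ideal generated by the elements $\partial_\alpha W_\sigma$ for all arrows $\alpha$ whose starting and ending vertices are not both in $F$. **Theorem.** For every tagged triangulation $\sigma$ of $P^*$, there is an isomorphism of $K$-algebras from $R'$ to the centre of $\Gamma_\sigma$ such that, for the $R$-algebra structure on $\Gamma_\sigma$ induced by $R=K[X]\to R'\cong Z(\Gamma_\sigma)$, the algebra $\Gamma_\sigma$ is an $R$-order: it is finitely generated as an $R$-module and its socle over $R$ is zero. Moreover, $\Gamma_\sigma$ is free as an $R$-module. -/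

import Mathlib

noncomputable section

namespace PuncturedPolygon

/-! ## Path algebras, potentials and frozen Jacobian algebras -/

/-- The paths of a quiver, with arbitrary endpoints. -/
abbrev TotalPath (V : Type*) [Quiver V] := Σ a b : V, Quiver.Path a b

/-- The path algebra `KQ`: the vector space with basis the paths of `Q`. The product of two paths
is their concatenation, the left factor coming first, and is `0` if they cannot be concatenated. -/
def PathAlgebra (K V : Type*) [Field K] [Quiver V] := TotalPath V →₀ K

namespace PathAlgebra

variable {K V : Type*} [Field K] [Quiver V]

instance : AddCommGroup (PathAlgebra K V) := inferInstanceAs (AddCommGroup (TotalPath V →₀ K))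

instance : Module K (PathAlgebra K V) := inferInstanceAs (Module K (TotalPath V →₀ K))

/-- A path, as an element of the path algebra. -/
def ofPath {a b : V} (p : Quiver.Path a b) : PathAlgebra K V :=
  (Finsupp.single (⟨a, b, p⟩ : TotalPath V) (1 : K) : TotalPath V →₀ K)

open Classical in
/-- The product of two paths. -/
def pathMul (p q : TotalPath V) : PathAlgebra K V :=
  if h : p.2.1 = q.1 then ofPath (p.2.2.comp (q.2.2.cast h.symm rfl)) else 0

/-- The product of the path algebra, as a bilinear map. -/
def mulLin : PathAlgebra K V →ₗ[K] PathAlgebra K V →ₗ[K] PathAlgebra K V :=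
  Finsupp.lift (PathAlgebra K V →ₗ[K] PathAlgebra K V) K (TotalPath V)
    (fun p => Finsupp.lift (PathAlgebra K V) K (TotalPath V) (fun q => pathMul p q))

instance : Mul (PathAlgebra K V) := ⟨fun x y => mulLin x y⟩

instance [Fintype V] : One (PathAlgebra K V) := ⟨∑ a : V, ofPath (Quiver.Path.nil : Quiver.Path a a)⟩

theorem mul_def (x y : PathAlgebra K V) : x * y = mulLin x y := rfl

theorem one_def [Fintype V] :
    (1 : PathAlgebra K V) = ∑ a : V, ofPath (Quiver.Path.nil : Quiver.Path a a) := rfl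

theorem mulLin_ofPath {a b c d : V} (p : Quiver.Path a b) (q : Quiver.Path c d) :
    mulLin (ofPath p) (ofPath q : PathAlgebra K V) = pathMul ⟨a, b, p⟩ ⟨c, d, q⟩ := by
  have h1 : mulLin (ofPath p : PathAlgebra K V) =
      Finsupp.lift (PathAlgebra K V) K (TotalPath V) (fun q => pathMul ⟨a, b, p⟩ q) := by
    refine (Finsupp.sum_single_index ?_).trans (one_smul K _)
    exact zero_smul K _
  rw [h1]
  refine (Finsupp.sum_single_index ?_).trans (one_smul K _)
  exact zero_smul K _

theorem ofPath_mul_ofPath {a b c : V} (p : Quiver.Path a b) (q : Quiver.Path b c) :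
    (ofPath p * ofPath q : PathAlgebra K V) = ofPath (p.comp q) := by
  rw [mul_def, mulLin_ofPath]
  simp [pathMul]

theorem ofPath_mul_ofPath_of_ne {a b c d : V} (p : Quiver.Path a b) (q : Quiver.Path c d)
    (h : b ≠ c) : (ofPath p * ofPath q : PathAlgebra K V) = 0 := by
  rw [mul_def, mulLin_ofPath]
  simp [pathMul, h]

/-- To prove an additive property of all elements, it suffices to treat multiples of paths. -/
theorem induction_on {P : PathAlgebra K V → Prop} (x : PathAlgebra K V) (h0 : P 0)
    (hadd : ∀ x y, P x → P y → P (x + y))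
    (hpath : ∀ (c : K) (a b : V) (p : Quiver.Path a b), P (c • ofPath p)) : P x := by
  refine Finsupp.induction_linear (motive := P) x h0 hadd ?_
  rintro ⟨a, b, p⟩ c
  have h := hpath c a b p
  have e : (c • ofPath p : PathAlgebra K V)
      = (Finsupp.single (⟨a, b, p⟩ : TotalPath V) c : TotalPath V →₀ K) := by
    have := Finsupp.smul_single c (⟨a, b, p⟩ : TotalPath V) (1 : K)
    rw [smul_eq_mul, mul_one] at this
    exact this
  rwa [e] at h

theorem smul_mul' (c : K) (x y : PathAlgebra K V) : (c • x) * y = c • (x * y) := by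
  simp [mul_def]

theorem mul_smul' (c : K) (x y : PathAlgebra K V) : x * (c • y) = c • (x * y) := by
  simp [mul_def]

theorem add_mul' (x y z : PathAlgebra K V) : (x + y) * z = x * z + y * z := by
  simp [mul_def]

theorem mul_add' (x y z : PathAlgebra K V) : x * (y + z) = x * y + x * z := by
  simp [mul_def]

theorem zero_mul' (x : PathAlgebra K V) : 0 * x = 0 := by
  simp [mul_def]

theorem mul_zero' (x : PathAlgebra K V) : x * 0 = 0 := by
  simp [mul_def]

theorem mul_assoc' (x y z : PathAlgebra K V) : x * y * z = x * (y * z) := by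
  induction x using induction_on with
  | h0 => simp [zero_mul']
  | hadd x x' h h' => simp [add_mul', h, h']
  | hpath c a b p =>
    induction y using induction_on with
    | h0 => simp [zero_mul', mul_zero']
    | hadd y y' h h' => simp [add_mul', mul_add', h, h']
    | hpath d a' b' q =>
      induction z using induction_on with
      | h0 => simp [mul_zero']
      | hadd z z' h h' => simp [mul_add', h, h']
      | hpath e a'' b'' r =>
        simp only [smul_mul', mul_smul']
        congr 3
        by_cases h1 : b = a'
        · subst h1
          by_cases h2 : b' = a''
          · subst h2
            simp [ofPath_mul_ofPath]
          · rw [ofPath_mul_ofPath, ofPath_mul_ofPath_of_ne _ _ h2, ofPath_mul_ofPath_of_ne _ _ h2,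
              mul_zero']
        · rw [ofPath_mul_ofPath_of_ne _ _ h1, zero_mul']
          by_cases h2 : b' = a''
          · subst h2
            rw [ofPath_mul_ofPath, ofPath_mul_ofPath_of_ne _ _ h1]
          · rw [ofPath_mul_ofPath_of_ne _ _ h2, mul_zero']

theorem one_mul' [Fintype V] (x : PathAlgebra K V) : 1 * x = x := by
  classical
  induction x using induction_on with
  | h0 => exact mul_zero' _
  | hadd x x' h h' => rw [mul_add', h, h']
  | hpath c a b p =>
    rw [mul_smul', one_def, mul_def, map_sum, LinearMap.sum_apply,
      Finset.sum_eq_single a, ← mul_def, ofPath_mul_ofPath, Quiver.Path.nil_comp]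
    · intro b _ hb
      rw [← mul_def, ofPath_mul_ofPath_of_ne _ _ hb]
    · simp

theorem mul_one' [Fintype V] (x : PathAlgebra K V) : x * 1 = x := by
  classical
  induction x using induction_on with
  | h0 => exact zero_mul' _
  | hadd x x' h h' => rw [add_mul', h, h']
  | hpath c a b p =>
    rw [smul_mul', one_def, mul_def, map_sum,
      Finset.sum_eq_single b, ← mul_def, ofPath_mul_ofPath, Quiver.Path.comp_nil]
    · intro b _ hb
      rw [← mul_def, ofPath_mul_ofPath_of_ne _ _ hb.symm]
    · simp

instance [Fintype V] : Ring (PathAlgebra K V) where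
  __ := (inferInstance : AddCommGroup (PathAlgebra K V))
  left_distrib := mul_add'
  right_distrib := add_mul'
  zero_mul := zero_mul'
  mul_zero := mul_zero'
  mul_assoc := mul_assoc'
  one_mul := one_mul'
  mul_one := mul_one'

instance [Fintype V] : Algebra K (PathAlgebra K V) :=
  Algebra.ofModule smul_mul' (fun c x y => mul_smul' c x y)

end PathAlgebra

/-- Linear combinations of cycles (closed paths, each with a chosen starting vertex). -/
abbrev Potential (K V : Type*) [Field K] [Quiver V] := (Σ a : V, Quiver.Path a a) →₀ K

open Classical in
/-- For a path `p` from `a` to `b` and a path `q` from `b` to `a`, the sum of the paths `v q u` over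
all factorizations `p = u α v` of `p`. -/
def cyclicDerivativeAux (K : Type*) {V : Type*} [Field K] [Quiver V] (α : Quiver.Total V) {a : V} :
    ∀ {b : V}, Quiver.Path a b → Quiver.Path b a → PathAlgebra K V
  | _, .nil, _ => 0
  | _, .cons p f, q =>
      cyclicDerivativeAux K α p (f.toPath.comp q) +
        if (⟨_, _, f⟩ : Quiver.Total V) = α then PathAlgebra.ofPath (q.comp p) else 0

/-- The cyclic derivative `∂_α`, the linear map sending a cycle `α₁ ⋯ α_d` to the sum of
`α_{i+1} ⋯ α_d α₁ ⋯ α_{i-1}` over all `i` with `α_i = α`. -/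
def cyclicDerivative {K V : Type*} [Field K] [Quiver V] {x y : V} (α : x ⟶ y) :
    Potential K V →ₗ[K] PathAlgebra K V :=
  Finsupp.lift (PathAlgebra K V) K (Σ a : V, Quiver.Path a a)
    (fun c => cyclicDerivativeAux K ⟨x, y, α⟩ c.2 Quiver.Path.nil)

/-- The two-sided ideal generated by the cyclic derivatives of `W` with respect to the arrows
whose endpoints are not both frozen. -/
def jacobianIdeal {K V : Type*} [Field K] [Quiver V] [Fintype V] (W : Potential K V) (F : Set V) :
    TwoSidedIdeal (PathAlgebra K V) :=
  TwoSidedIdeal.span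
    {z | ∃ (x y : V) (α : x ⟶ y), (x ∉ F ∨ y ∉ F) ∧ z = cyclicDerivative α W}

/-- The frozen Jacobian algebra of an ice quiver with potential. -/
abbrev FrozenJacobianAlgebra {K V : Type*} [Field K] [Quiver V] [Fintype V]
    (W : Potential K V) (F : Set V) :=
  (jacobianIdeal W F).ringCon.Quotient

/-- The arrows of a path, the last one first. -/
def pathArrows {V : Type*} [Quiver V] {a : V} : ∀ {b : V}, Quiver.Path a b → List (Quiver.Total V)
  | _, .nil => []
  | _, .cons p f => ⟨_, _, f⟩ :: pathArrows p

/-! ## Tagged triangulations of a once-punctured polygon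

The vertices `P_r` of the polygon are indexed counter-clockwise by `r : ZMod n`. -/

/-- The two possible tags of an arc at the puncture. -/
inductive Tag
  | plain
  | notched

/-- Isotopy classes of curves: `chord r s` goes from `P_r` to `P_s`, turning counter-clockwise
around the puncture (it is meant for `r ≠ s` only); `spoke r t` goes from `P_r` to the puncture
and is tagged by `t`. -/
inductive Edge (n : ℕ)
  | chord (r s : ZMod n)
  | spoke (r : ZMod n) (t : Tag)

/-- The number of steps from `P_r` to `P_s` in the counter-clockwise direction. -/
def ccwDist {n : ℕ} (r s : ZMod n) : ℕ := (s - r).val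

/-- The sides of the polygon. -/
def Edge.IsSide {n : ℕ} : Edge n → Prop
  | .chord r s => s = r + 1
  | .spoke _ _ => False

/-- Tagged arcs: the endpoints are distinct, and the curve is not isotopic to a side. -/
def Edge.IsTaggedArc {n : ℕ} : Edge n → Prop
  | .chord r s => s ≠ r ∧ s ≠ r + 1
  | .spoke _ _ => True

/-- Being incident to the vertex `P_k` of the polygon. -/
def Edge.IncidentTo {n : ℕ} : Edge n → ZMod n → Prop
  | .chord r s, k => k = r ∨ k = s
  | .spoke r _, k => k = r

/-- In the universal cover of the punctured polygon (a half-plane whose boundary line carries the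
lifts of the vertices as its integer points, `x` lying over `P_x`), the lifts of `chord r s` join
`x` to `x + ccwDist r s`, for the integers `x` over `r`. The chords `chord r s` and `chord r' s'`
satisfy the condition below if some of their lifts have interleaved endpoints, in this order. -/
def Interleave {n : ℕ} (r s r' s' : ZMod n) : Prop :=
  ∃ x x' : ℤ, (x : ZMod n) = r ∧ (x' : ZMod n) = r' ∧
    x < x' ∧ x' < x + ccwDist r s ∧ x + ccwDist r s < x' + ccwDist r' s'

/-- Two curves cross if the relative interiors of any two curves in their isotopy classes
intersect, which means that some of their lifts to the universal cover of the punctured polygon are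
forced to cross. The lifts of `spoke k t` are the vertical half-lines starting at the integers
over `k`. -/
def Edge.Crosses {n : ℕ} : Edge n → Edge n → Prop
  | .chord r s, .chord r' s' => Interleave r s r' s' ∨ Interleave r' s' r s
  | .chord r s, .spoke k _ =>
      ∃ x z : ℤ, (x : ZMod n) = r ∧ (z : ZMod n) = k ∧ x < z ∧ z < x + ccwDist r s
  | .spoke k _, .chord r s =>
      ∃ x z : ℤ, (x : ZMod n) = r ∧ (z : ZMod n) = k ∧ x < z ∧ z < x + ccwDist r s
  | .spoke _ _, .spoke _ _ => False

/-- Compatibility of tagged arcs: they do not cross, and, if both are incident to the puncture and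
are not isotopic, then they have the same tag. -/
def Edge.Compatible {n : ℕ} (a b : Edge n) : Prop :=
  ¬ a.Crosses b ∧
    ∀ (r r' : ZMod n) (t t' : Tag), a = .spoke r t → b = .spoke r' t' → r ≠ r' → t = t'

/-- A tagged triangulation of the once-punctured `n`-gon is given by a maximal set of pairwise
compatible tagged arcs; the sides of the polygon are added in `TaggedTriangulation.edges`. -/
structure TaggedTriangulation (n : ℕ) where
  /-- The tagged arcs of the triangulation. -/
  arcs : Set (Edge n)
  maximal : Maximal
    (fun T : Set (Edge n) => (∀ a ∈ T, a.IsTaggedArc) ∧ T.Pairwise Edge.Compatible) arcs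

namespace TaggedTriangulation

variable {n : ℕ}

/-- The edges of a triangulation: the sides of the polygon and the tagged arcs. -/
def edges (σ : TaggedTriangulation n) : Set (Edge n) := {e | e.IsSide} ∪ σ.arcs

/-- The vertices of the quiver of `σ`. -/
def Vertex (σ : TaggedTriangulation n) : Type := {e : Edge n // e ∈ σ.edges}

/-- The frozen vertices: the sides of the polygon. -/
def frozen (σ : TaggedTriangulation n) : Set σ.Vertex := {v | v.1.IsSide}

/-- The side from `P_k` to `P_{k+1}`. -/
def sideFrom (σ : TaggedTriangulation n) (k : ZMod n) : σ.Vertex :=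
  ⟨.chord k (k + 1), Or.inl rfl⟩

/-- The side from `P_{k-1}` to `P_k`. -/
def sideTo (σ : TaggedTriangulation n) (k : ZMod n) : σ.Vertex :=
  ⟨.chord (k - 1) k, Or.inl (sub_add_cancel k 1).symm⟩

/-- A true triangle of `σ` that is not incident to the puncture: the triangle `P_i P_j P_k` with
`i`, `j`, `k` in counter-clockwise order and the puncture on the other side of
`chord i k`. -/
structure OuterTriangle (σ : TaggedTriangulation n) where
  i : ZMod n
  j : ZMod n
  k : ZMod n
  mem_ij : .chord i j ∈ σ.edges
  mem_jk : .chord j k ∈ σ.edges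
  mem_ik : .chord i k ∈ σ.edges
  add_eq : ccwDist i j + ccwDist j k = ccwDist i k

/-- A true triangle of `σ` that is incident to the puncture, bounded by `chord r s` and by two arcs
from `P_r` and `P_s` to the puncture. -/
structure PuncturedTriangle (σ : TaggedTriangulation n) where
  r : ZMod n
  s : ZMod n
  t : Tag
  ne : r ≠ s
  mem_chord : .chord r s ∈ σ.edges
  mem_fst : .spoke r t ∈ σ.edges
  mem_snd : .spoke s t ∈ σ.edges

/-- A once-punctured digon with vertices `P_k` and `P_s` in `σ`, whose inside contains the plain
and the notched arc from `P_k` to the puncture. -/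
structure Digon (σ : TaggedTriangulation n) where
  k : ZMod n
  s : ZMod n
  ne : k ≠ s
  mem_from : .chord k s ∈ σ.edges
  mem_to : .chord s k ∈ σ.edges
  mem_spoke : ∀ t : Tag, .spoke k t ∈ σ.edges

variable {σ : TaggedTriangulation n}

namespace OuterTriangle

def ij (T : σ.OuterTriangle) : σ.Vertex := ⟨.chord T.i T.j, T.mem_ij⟩
def jk (T : σ.OuterTriangle) : σ.Vertex := ⟨.chord T.j T.k, T.mem_jk⟩
def ik (T : σ.OuterTriangle) : σ.Vertex := ⟨.chord T.i T.k, T.mem_ik⟩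

end OuterTriangle

namespace PuncturedTriangle

def base (T : σ.PuncturedTriangle) : σ.Vertex := ⟨.chord T.r T.s, T.mem_chord⟩
def fst (T : σ.PuncturedTriangle) : σ.Vertex := ⟨.spoke T.r T.t, T.mem_fst⟩
def snd (T : σ.PuncturedTriangle) : σ.Vertex := ⟨.spoke T.s T.t, T.mem_snd⟩

end PuncturedTriangle

namespace Digon

def sideFrom (D : σ.Digon) : σ.Vertex := ⟨.chord D.k D.s, D.mem_from⟩
def sideTo (D : σ.Digon) : σ.Vertex := ⟨.chord D.s D.k, D.mem_to⟩
def spoke (D : σ.Digon) (t : Tag) : σ.Vertex := ⟨.spoke D.k t, D.mem_spoke t⟩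

end Digon

/-- The arrows of the quiver `Q_σ`: one internal arrow for each corner of each true triangle,
turning anticlockwise around the corner; the arrows of the configuration attached to a digon
containing a plain and a notched arc; and one external arrow, turning anticlockwise outside the
polygon, for each vertex of the polygon to which a tagged arc of `σ` is incident. -/
inductive Arrow (σ : TaggedTriangulation n) : σ.Vertex → σ.Vertex → Type
  | outerI (T : σ.OuterTriangle) : Arrow σ T.ij T.ik
  | outerK (T : σ.OuterTriangle) : Arrow σ T.ik T.jk
  | outerJ (T : σ.OuterTriangle) : Arrow σ T.jk T.ij
  | punctR (T : σ.PuncturedTriangle) : Arrow σ T.base T.fst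
  | punctO (T : σ.PuncturedTriangle) : Arrow σ T.fst T.snd
  | punctS (T : σ.PuncturedTriangle) : Arrow σ T.snd T.base
  | digonBase (D : σ.Digon) : Arrow σ D.sideTo D.sideFrom
  | digonIn (D : σ.Digon) (t : Tag) : Arrow σ D.sideFrom (D.spoke t)
  | digonOut (D : σ.Digon) (t : Tag) : Arrow σ (D.spoke t) D.sideTo
  | external (k : ZMod n) (h : ∃ a ∈ σ.arcs, a.IncidentTo k) : Arrow σ (σ.sideTo k) (σ.sideFrom k)

/-- The quiver `Q_σ`. -/
instance (σ : TaggedTriangulation n) : Quiver σ.Vertex := ⟨Arrow σ⟩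

/-- The marked points: the vertices of the polygon and the puncture. -/
inductive MarkedPoint (n : ℕ)
  | polygon (k : ZMod n)
  | puncture

/-- The marked point around which an arrow turns. -/
def Arrow.centre {a b : σ.Vertex} : Arrow σ a b → MarkedPoint n
  | .outerI T => .polygon T.i
  | .outerK T => .polygon T.k
  | .outerJ T => .polygon T.j
  | .punctR T => .polygon T.r
  | .punctO _ => .puncture
  | .punctS T => .polygon T.s
  | .digonBase D => .polygon D.s
  | .digonIn D _ => .polygon D.k
  | .digonOut D _ => .polygon D.k
  | .external k _ => .polygon k

/-- The external arrows. -/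
def Arrow.IsExternal {a b : σ.Vertex} : Arrow σ a b → Prop
  | .external _ _ => True
  | _ => False

/-- The clockwise triangle of an outer triangle. -/
def OuterTriangle.cycle (T : σ.OuterTriangle) : Σ a : σ.Vertex, Quiver.Path a a :=
  ⟨T.ij, ((Quiver.Path.nil.cons (Arrow.outerI T)).cons (Arrow.outerK T)).cons (Arrow.outerJ T)⟩

/-- The clockwise triangle of a triangle incident to the puncture. -/
def PuncturedTriangle.cycle (T : σ.PuncturedTriangle) : Σ a : σ.Vertex, Quiver.Path a a :=
  ⟨T.base, ((Quiver.Path.nil.cons (Arrow.punctR T)).cons (Arrow.punctO T)).cons (Arrow.punctS T)⟩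

/-- The clockwise triangles of a digon, one for each tag. -/
def Digon.cycle (D : σ.Digon) (t : Tag) : Σ a : σ.Vertex, Quiver.Path a a :=
  ⟨D.sideTo, ((Quiver.Path.nil.cons (Arrow.digonBase D)).cons (Arrow.digonIn D t)).cons
    (Arrow.digonOut D t)⟩

/-- The anticlockwise external cycles of `Q_σ`: the external arrow at `P_k`, followed by internal
arrows turning around `P_k`. If the plain and the notched arc from `P_k` to the puncture both belong
to `σ`, then only the cycle through the plain one is considered. -/
def IsExternalCycle (c : Σ a : σ.Vertex, Quiver.Path a a) : Prop :=
  ∃ (k : ZMod n) (h : ∃ a ∈ σ.arcs, a.IncidentTo k)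
    (p : Quiver.Path (σ.sideFrom k) (σ.sideTo k)),
    (∀ f ∈ pathArrows p, ¬ Arrow.IsExternal f.hom ∧ Arrow.centre f.hom = .polygon k ∧
      ∀ D : σ.Digon, f.left ≠ D.spoke .notched) ∧
    c = ⟨σ.sideTo k, (Quiver.Hom.toPath (Arrow.external k h)).comp p⟩

/-- The anticlockwise punctured cycle of `Q_σ` (if there is one): the arrows around the puncture,
each of them being used at most once. In order to have only one representative of it, the cycle is
required to start at the arc whose endpoint on the polygon has the smallest index. -/
def IsPuncturedCycle (c : Σ a : σ.Vertex, Quiver.Path a a) : Prop :=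
  ∃ (r : ZMod n) (t : Tag), c.1.1 = .spoke r t ∧
    (∀ (r' : ZMod n) (t' : Tag), .spoke r' t' ∈ σ.edges → r.val ≤ r'.val) ∧
    c.2.length ≠ 0 ∧ (pathArrows c.2).Nodup ∧
    ∀ f ∈ pathArrows c.2, Arrow.centre f.hom = .puncture

/-- The potential `W_σ`: the sum of the clockwise triangles, minus the sum of the anticlockwise
external cycles, minus the anticlockwise punctured cycle. -/
def potential (K : Type*) [Field K] (σ : TaggedTriangulation n) : Potential K σ.Vertex :=
  ((∑ᶠ T : σ.OuterTriangle, Finsupp.single T.cycle 1) +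
    (∑ᶠ T : σ.PuncturedTriangle, Finsupp.single T.cycle 1) +
    (∑ᶠ (D : σ.Digon) (t : Tag), Finsupp.single (D.cycle t) 1)) -
  (∑ᶠ (c : Σ a : σ.Vertex, Quiver.Path a a) (_ : IsExternalCycle c), Finsupp.single c 1) -
  (∑ᶠ (c : Σ a : σ.Vertex, Quiver.Path a a) (_ : IsPuncturedCycle c), Finsupp.single c 1)

instance : Finite Tag :=
  Finite.of_injective (fun t : Tag => (match t with | .plain => true | .notched => false))
    (by rintro (_ | _) (_ | _) h <;> simp_all)

instance [NeZero n] : Finite (Edge n) :=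
  Finite.of_injective
    (fun e : Edge n => (match e with
      | .chord r s => Sum.inl (r, s)
      | .spoke r t => Sum.inr (r, t) : (ZMod n × ZMod n) ⊕ (ZMod n × Tag)))
    (by rintro (_ | _) (_ | _) h <;> simp_all)

instance [NeZero n] (σ : TaggedTriangulation n) : Fintype σ.Vertex :=
  @Fintype.ofFinite _ (inferInstanceAs (Finite {e : Edge n // e ∈ σ.edges}))

/-- The frozen Jacobian algebra `Γ_σ`. -/
abbrev Gamma (K : Type*) [Field K] [NeZero n] (σ : TaggedTriangulation n) :=
  FrozenJacobianAlgebra (potential K σ) σ.frozen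

end TaggedTriangulation

/-! ## Orders -/

/-- The socle of a module: the sum of its simple submodules. -/
def socle (S M : Type*) [Ring S] [AddCommGroup M] [Module S M] : Submodule S M :=
  sSup {N : Submodule S M | IsSimpleModule S N}

/-- An `S`-algebra is an `S`-order (for `S` commutative Noetherian of Krull dimension `1`) if it is
finitely generated as an `S`-module and its `S`-socle is zero. -/
def IsOrder (S A : Type*) [CommRing S] [Ring A] [Algebra S A] : Prop :=
  Module.Finite S A ∧ socle S A = ⊥

/-- The `K[X]`-algebra `R' = K[X, Y] / (Y X - Y ^ 2)`. -/
abbrev RPrime (K : Type*) [Field K] :=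
  Polynomial (Polynomial K) ⧸
    (Ideal.span {Polynomial.X * Polynomial.C Polynomial.X - Polynomial.X ^ 2} :
      Ideal (Polynomial (Polynomial K)))

end PuncturedPolygon

end

/-!
The centre and the module structure of `Γ_σ` are read off from a faithful representation. Let `S` be
the double cover of the punctured polygon branched at the puncture, a centrally symmetric `2n`-gon.
An arc to the puncture becomes a diameter of `S`, and a chord becomes a pair of opposite chords.
An arrow of the quiver moves the edge where it starts counter-clockwise: an internal arrow around a
vertex of the polygon moves one endpoint, whereas external arrows and those around the puncture move
both. The degree of an arrow is the total number of steps by which the endpoints move in `S`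
(`AnyArrow.deg`). All terms of the potential have the same degree `2n`, as half a turn has. Over the
ring `K[t] × K[t]`, an arrow of degree `d` acts by `(t ^ d, t ^ d)`; by `(t ^ d, 0)` if the edge
reaches, leaves or crosses the puncture or remains there; and by `(0, t ^ d)` if it starts or ends
at the notched arc of a digon (`weights`). This respects the
relations (`rep_cyclicDerivative_eq_zero`), so that `Γ_σ` acts by matrices over `K[t] × K[t]`, by
means of `gammaRep`.

The main point is that `gammaRep` is injective. In the universal cover, an edge has *positions*
(`Position`): two integers, namely the endpoints of a lift, and a level telling whether the
puncture has been crossed. Elementary rotations move from one position to a larger one. They are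
the arrows, together with one rotation `IsEps` at each vertex of the polygon, from the side ending
there to the side starting there; with its help, the relations for the arrows around a vertex of the
polygon take the same shape even at the vertices without an external arrow (`Turn.compl_eq`). Since edges of
`σ` do not cross, a rotation can be continued to any larger position (`IsPosition.exists_steps`),
and the relations make any two elementary rotations towards the same position confluent
(`Step.joinable`). Hence there is, between two comparable positions, exactly one element of `Γ_σ`
that is a product of elementary rotations (`Steps.eq`). These products are closed under
multiplication by arrows: a rotation that would cross the puncture for the second time equals one
that has crossed it once (`Far.mul`). Up to the arrows at the notched arc of a digon, they therefore
span `Γ_σ` (`pathElt_mem_span_keys`, `Digon.Lifts.pathElt_mem_span`), and as they act by different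
monomials, `gammaRep` is injective (`gammaRep_injective`).

The half turns of all edges add up to an element acting by `(t ^ 2n, t ^ 2n)`, and the half turns
across the puncture to one acting by `(t ^ 2n, 0)`. By faithfulness, both are central. Conversely,
a central element commutes with the rotations from one side to all other edges, and hence acts by a
scalar (`gammaRep_eq_of_mem_center`), which lies in the algebra generated by these two, since the
rotations of a side are half turns. This algebra is `R'`, with `X` and `Y` corresponding to the two
elements (`rPrimeMap_injective`, `range_centreMap`). Finally, `Γ_σ` is embedded, over `K[X]`, in the
matrices over `K[t] × K[t]`, where `X` acts by `t ^ 2n`. These form a finitely generated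
torsion-free `K[X]`-module, so `Γ_σ` is finitely generated, torsion-free and thus free over the
principal ideal domain `K[X]`; and a torsion-free module over `K[X]` has no simple submodule.
-/

noncomputable section

set_option linter.unusedSectionVars false

namespace PuncturedPolygon

/-! ### Cyclic derivatives of cycles -/

theorem pathArrows_comp {V : Type*} [Quiver V] {a b : V} (p : Quiver.Path a b) :
    ∀ {c : V} (q : Quiver.Path b c), pathArrows (p.comp q) = pathArrows q ++ pathArrows p
  | _, .nil => rfl
  | _, .cons q f => by
    rw [Quiver.Path.comp_cons, pathArrows, pathArrows_comp p q, pathArrows, List.cons_append]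

theorem pathArrows_toPath {V : Type*} [Quiver V] {a b : V} (f : a ⟶ b) :
    pathArrows f.toPath = [⟨a, b, f⟩] := rfl

section CyclicDerivative

variable (K : Type*) [Field K] {V : Type*} [Quiver V]

theorem cyclicDerivativeAux_of_notMem (α : Quiver.Total V) {a : V} :
    ∀ {b : V} (p : Quiver.Path a b) (q : Quiver.Path b a), α ∉ pathArrows p →
      cyclicDerivativeAux K α p q = 0
  | _, .nil, _, _ => rfl
  | _, .cons p f, q, h => by
    rw [pathArrows, List.mem_cons, not_or] at h
    rw [cyclicDerivativeAux, cyclicDerivativeAux_of_notMem α p _ h.2, if_neg (Ne.symm h.1), zero_add]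

theorem cyclicDerivativeAux_comp (α : Quiver.Total V) {a b : V} (p : Quiver.Path a b) :
    ∀ {c : V} (p' : Quiver.Path b c) (q : Quiver.Path c a),
      cyclicDerivativeAux K α (p.comp p') q =
        cyclicDerivativeAux K α p (p'.comp q) + cyclicDerivativeAux K α p' (q.comp p)
  | _, .nil, q => by simp [cyclicDerivativeAux]
  | _, .cons p' f, q => by
    rw [Quiver.Path.comp_cons, cyclicDerivativeAux, cyclicDerivativeAux,
      cyclicDerivativeAux_comp α p p', add_assoc]
    rw [show p'.cons f = p'.comp f.toPath from rfl]
    simp only [Quiver.Path.comp_assoc]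

/-- The cyclic derivative of a cycle with respect to an arrow that it passes through once. -/
theorem cyclicDerivativeAux_single {a x y : V} (f : x ⟶ y) (u : Quiver.Path a x)
    (v : Quiver.Path y a) (hu : (⟨x, y, f⟩ : Quiver.Total V) ∉ pathArrows u)
    (hv : (⟨x, y, f⟩ : Quiver.Total V) ∉ pathArrows v) :
    cyclicDerivativeAux K ⟨x, y, f⟩ (u.comp (f.toPath.comp v)) Quiver.Path.nil =
      PathAlgebra.ofPath (v.comp u) := by
  rw [cyclicDerivativeAux_comp, cyclicDerivativeAux_of_notMem K _ u _ hu, zero_add,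
    cyclicDerivativeAux_comp, cyclicDerivativeAux_of_notMem K _ v _ hv, add_zero]
  change cyclicDerivativeAux K _ (Quiver.Path.nil.cons f) _ = _
  rw [cyclicDerivativeAux, cyclicDerivativeAux, if_pos rfl, zero_add]
  simp

theorem cyclicDerivative_single {x y : V} (α : x ⟶ y) (c : Σ a : V, Quiver.Path a a) :
    cyclicDerivative α (Finsupp.single c (1 : K)) =
      cyclicDerivativeAux K ⟨x, y, α⟩ c.2 Quiver.Path.nil := by
  refine (Finsupp.sum_single_index ?_).trans (one_smul K _)
  exact zero_smul K _

end CyclicDerivative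

/-! ### Matrix representations of path algebras -/

section Representation

variable {K : Type*} [Field K] {V : Type*} [Quiver V] {R : Type*} [CommRing R] [Algebra K R]

/-- Idempotent weights at the vertices of a quiver and compatible weights at its arrows. -/
structure Weights (V : Type*) [Quiver V] (R : Type*) [CommRing R] where
  /-- the weight of a vertex -/
  vertex : V → R
  /-- the weight of an arrow -/
  arrow : ∀ {a b : V}, (a ⟶ b) → R
  vertex_mul_vertex : ∀ a, vertex a * vertex a = vertex a
  vertex_mul_arrow : ∀ {a b : V} (f : a ⟶ b), vertex a * arrow f = arrow f
  arrow_mul_vertex : ∀ {a b : V} (f : a ⟶ b), arrow f * vertex b = arrow f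

/-- The weight of a path. -/
def Weights.path (w : Weights V R) {a : V} : ∀ {b : V}, Quiver.Path a b → R
  | _, .nil => w.vertex a
  | _, .cons p f => w.path p * w.arrow f

theorem Weights.path_mul_vertex (w : Weights V R) {a : V} :
    ∀ {b : V} (p : Quiver.Path a b), w.path p * w.vertex b = w.path p
  | _, .nil => w.vertex_mul_vertex a
  | _, .cons p f => by rw [path, mul_assoc, w.arrow_mul_vertex]

theorem Weights.path_comp (w : Weights V R) {a b : V} (p : Quiver.Path a b) :
    ∀ {c : V} (q : Quiver.Path b c), w.path (p.comp q) = w.path p * w.path q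
  | _, .nil => (w.path_mul_vertex p).symm
  | _, .cons q f => by rw [Quiver.Path.comp_cons, path, path, w.path_comp p q, mul_assoc]

theorem Weights.path_toPath (w : Weights V R) {a b : V} (f : a ⟶ b) :
    w.path f.toPath = w.arrow f := w.vertex_mul_arrow f

open Classical in
variable (K) in
/-- The matrix representation with given weights: a path from `a` to `b` is sent to the matrix
whose only nonzero entry, at `(a, b)`, is the weight of the path. It is multiplicative, but it
sends `1` to the diagonal matrix of the weights of the vertices. -/
def Weights.rep (w : Weights V R) : PathAlgebra K V →ₗ[K] Matrix V V R :=
  Finsupp.lift (Matrix V V R) K (TotalPath V) (fun p => Matrix.single p.1 p.2.1 (w.path p.2.2))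

open Classical in
theorem Weights.rep_ofPath (w : Weights V R) {a b : V} (p : Quiver.Path a b) :
    w.rep K (PathAlgebra.ofPath p) = Matrix.single a b (w.path p) := by
  refine (Finsupp.sum_single_index ?_).trans (one_smul K _)
  exact zero_smul K _

theorem Weights.rep_mul [Fintype V] (w : Weights V R) (x y : PathAlgebra K V) :
    w.rep K (x * y) = w.rep K x * w.rep K y := by
  classical
  induction x using PathAlgebra.induction_on with
  | h0 => simp
  | hadd x x' h h' => rw [add_mul, map_add, map_add, add_mul, h, h']
  | hpath c a b p =>
    induction y using PathAlgebra.induction_on with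
    | h0 => simp
    | hadd x x' h h' => rw [mul_add, map_add, map_add, mul_add, h, h']
    | hpath d a' b' q =>
      rw [smul_mul_assoc, mul_smul_comm, map_smul, map_smul, map_smul, map_smul, smul_mul_assoc,
        mul_smul_comm, w.rep_ofPath, w.rep_ofPath]
      congr 2
      by_cases h : b = a'
      · subst h
        rw [PathAlgebra.ofPath_mul_ofPath, w.rep_ofPath, Matrix.single_mul_single_same,
          w.path_comp]
      · rw [PathAlgebra.ofPath_mul_ofPath_of_ne _ _ h, map_zero, Matrix.single_mul_single_of_ne _ _ _ _ h]

/-- A representation that kills the defining relations kills the Jacobian ideal. -/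
theorem Weights.rep_eq_zero_of_mem [Fintype V] (w : Weights V R) {W : Potential K V} {F : Set V}
    (h : ∀ (x y : V) (α : x ⟶ y), (x ∉ F ∨ y ∉ F) → w.rep K (cyclicDerivative α W) = 0)
    {z : PathAlgebra K V} (hz : z ∈ jacobianIdeal W F) : w.rep K z = 0 := by
  let f : PathAlgebra K V →ₙ+* Matrix V V R :=
    { toFun := w.rep K
      map_mul' := w.rep_mul
      map_zero' := map_zero _
      map_add' := map_add _ }
  have : jacobianIdeal W F ≤ TwoSidedIdeal.ker f := by
    rw [jacobianIdeal, TwoSidedIdeal.span_le]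
    rintro _ ⟨x, y, α, hα, rfl⟩
    exact (TwoSidedIdeal.mem_ker f).2 (h x y α hα)
  exact (TwoSidedIdeal.mem_ker f).1 (this hz)

variable [Fintype V] {W : Potential K V} {F : Set V}

variable (W F) in
/-- The projection from the path algebra to the frozen Jacobian algebra. -/
def jacobianMk : PathAlgebra K V →ₐ[K] FrozenJacobianAlgebra W F :=
  RingCon.mkₐ K (jacobianIdeal W F).ringCon

theorem jacobianMk_surjective : Function.Surjective (jacobianMk W F) :=
  Quotient.mk_surjective

theorem jacobianMk_eq_zero_iff {x : PathAlgebra K V} :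
    jacobianMk W F x = 0 ↔ x ∈ jacobianIdeal W F := by
  rw [TwoSidedIdeal.mem_iff, ← RingCon.eq]
  exact Iff.rfl

/-- The representation of the frozen Jacobian algebra induced by a representation of the path
algebra. -/
def Weights.quotientRep (w : Weights V R)
    (h : ∀ (x y : V) (α : x ⟶ y), (x ∉ F ∨ y ∉ F) → w.rep K (cyclicDerivative α W) = 0) :
    FrozenJacobianAlgebra W F →ₗ[K] Matrix V V R :=
  ((LinearMap.ker (jacobianMk W F).toLinearMap).liftQ (w.rep K) (fun _ hx =>
      w.rep_eq_zero_of_mem h (jacobianMk_eq_zero_iff.1 hx))).comp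
    ((jacobianMk W F).toLinearMap.quotKerEquivOfSurjective
      jacobianMk_surjective).symm.toLinearMap

theorem Weights.quotientRep_mk (w : Weights V R)
    (h : ∀ (x y : V) (α : x ⟶ y), (x ∉ F ∨ y ∉ F) → w.rep K (cyclicDerivative α W) = 0)
    (x : PathAlgebra K V) : w.quotientRep h (jacobianMk W F x) = w.rep K x := by
  have : ((jacobianMk W F).toLinearMap.quotKerEquivOfSurjective jacobianMk_surjective).symm
      (jacobianMk W F x) = Submodule.Quotient.mk x := by
    rw [LinearEquiv.symm_apply_eq]
    rfl
  simp only [quotientRep, LinearMap.comp_apply, LinearEquiv.coe_coe]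
  rw [this]
  rfl

theorem Weights.quotientRep_mul (w : Weights V R)
    (h : ∀ (x y : V) (α : x ⟶ y), (x ∉ F ∨ y ∉ F) → w.rep K (cyclicDerivative α W) = 0)
    (x y : FrozenJacobianAlgebra W F) :
    w.quotientRep h (x * y) = w.quotientRep h x * w.quotientRep h y := by
  obtain ⟨x, rfl⟩ := jacobianMk_surjective x
  obtain ⟨y, rfl⟩ := jacobianMk_surjective y
  rw [← map_mul, w.quotientRep_mk, w.quotientRep_mk, w.quotientRep_mk, w.rep_mul]

end Representation

/-! ### Modules over a principal ideal domain -/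

section Modules

theorem _root_.RingHom.IsIntegralElem.of_pow {R S : Type*} [CommRing R] [CommRing S] {f : R →+* S}
    {x : S} {m : ℕ} (hm : 0 < m) (h : f.IsIntegralElem (x ^ m)) : f.IsIntegralElem x :=
  letI := f.toAlgebra
  IsIntegral.of_pow (R := R) hm h

open Polynomial in
/-- The ring `K[t]` is finite over its subring `K[t ^ m]`. -/
theorem finite_expand (K : Type*) [Field K] {m : ℕ} (hm : 0 < m) :
    (expand K m : K[X] →+* K[X]).Finite := by
  refine RingHom.IsIntegral.to_finite ?_ ?_
  · intro p
    have hC : ∀ c : K, (expand K m : K[X] →+* K[X]).IsIntegralElem (C c) := fun c => by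
      have := (expand K m : K[X] →+* K[X]).isIntegralElem_map (x := C c)
      simpa using this
    have hX : (expand K m : K[X] →+* K[X]).IsIntegralElem X := by
      refine RingHom.IsIntegralElem.of_pow hm ?_
      have := (expand K m : K[X] →+* K[X]).isIntegralElem_map (x := X)
      simpa using this
    induction p using Polynomial.induction_on with
    | C c => exact hC c
    | add p q hp hq => exact hp.add _ hq
    | monomial k c h => rw [pow_succ, ← mul_assoc]; exact h.mul _ hX
  · refine RingHom.FiniteType.of_comp_finiteType (f := (C : K →+* K[X])) ?_
    have : (expand K m : K[X] →+* K[X]).comp C = algebraMap K K[X] := by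
      ext c
      simp
    rw [this, RingHom.finiteType_algebraMap]
    infer_instance

/-- A module that embeds semilinearly in a finitely generated torsion-free module. -/
theorem finite_of_injective {R S M N : Type*} [CommRing R] [IsNoetherianRing R]
    [CommRing S] {e : R →+* S} (hfin : e.Finite) [AddCommGroup M]
    [Module R M] [AddCommGroup N] [Module S N] [Module.Finite S N] (f : M →+ N)
    (hf : Function.Injective f) (hsmul : ∀ r m, f (r • m) = e r • f m) : Module.Finite R M := by
  let : Algebra R S := e.toAlgebra
  let : Module R N := Module.compHom N e
  have : Module.Finite R S := hfin
  have : IsScalarTower R S N := ⟨fun r s x => mul_smul (e r) s x⟩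
  have : Module.Finite R N := Module.Finite.trans S N
  exact Module.Finite.of_injective
    ({ toFun := f, map_add' := f.map_add, map_smul' := hsmul } : M →ₗ[R] N) hf

theorem isTorsionFree_of_injective {R S M N : Type*} [CommRing R] [IsDomain R]
    [CommRing S] [IsDomain S] {e : R →+* S} (he : Function.Injective e) [AddCommGroup M]
    [Module R M] [AddCommGroup N] [Module S N] [Module.IsTorsionFree S N] (f : M →+ N)
    (hf : Function.Injective f) (hsmul : ∀ r m, f (r • m) = e r • f m) :
    Module.IsTorsionFree R M := by
  refine ⟨fun r hr x y h => hf ?_⟩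
  have h : r • x = r • y := h
  have h' := congrArg f h
  rw [hsmul, hsmul] at h'
  refine smul_right_injective N ?_ h'
  rw [Ne, map_eq_zero_iff e he]
  exact hr.ne_zero

/-- A torsion-free module over a domain that is not a field has no simple submodules. -/
theorem socle_eq_bot {R M : Type*} [CommRing R] [IsDomain R] (hR : ¬ IsField R) [AddCommGroup M]
    [Module R M] [Module.IsTorsionFree R M] : socle R M = ⊥ := by
  refine sSup_eq_bot.2 fun N (hN : IsSimpleModule R N) => ?_
  exfalso
  obtain ⟨a, ha, hau⟩ := Ring.exists_not_isUnit_of_not_isField hR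
  have := hN.nontrivial
  obtain ⟨x, hx⟩ := exists_ne (0 : N)
  have hax : a • x ≠ 0 := smul_ne_zero ha hx
  have htop := IsSimpleModule.span_singleton_eq_top R hax
  obtain ⟨b, hb⟩ := Submodule.mem_span_singleton.1 (htop ▸ Submodule.mem_top : x ∈ _)
  have h0 : (b * a - 1) • x = 0 := by
    rw [sub_smul, mul_smul, hb, one_smul, sub_self]
  rcases smul_eq_zero.1 h0 with h | h
  · exact hau (IsUnit.of_mul_eq_one b (by rw [mul_comm]; exact sub_eq_zero.1 h))
  · exact hx h

end Modules

namespace TaggedTriangulation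

/-! ### Lifting the edges of a triangulation to the universal cover -/

section Lifts

variable {n : ℕ} [NeZero n] [Fact (2 ≤ n)] (σ : TaggedTriangulation n)

/-- The chord from `P_i` to `P_j` is an edge of `σ`, and the integers `i` and `j` are the endpoints
of one of its lifts. -/
def HasChord (i j : ℤ) : Prop :=
  i < j ∧ j < i + n ∧ Edge.chord (i : ZMod n) (j : ZMod n) ∈ σ.edges

/-- The arc from `P_k` to the puncture tagged by `t` belongs to `σ`. -/
def HasSpoke (t : Tag) (k : ℤ) : Prop := Edge.spoke (k : ZMod n) t ∈ σ.edges

theorem two_le_cast : (2 : ℤ) ≤ n := by exact_mod_cast (Fact.out : 2 ≤ n)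

theorem intCast_add_mul (i m : ℤ) : ((i + m * n : ℤ) : ZMod n) = i := by simp

theorem exists_add_mul_of_cast_eq {i j : ℤ} (h : (i : ZMod n) = j) : ∃ m : ℤ, i = j + m * n := by
  rw [ZMod.intCast_eq_intCast_iff_dvd_sub] at h
  obtain ⟨m, hm⟩ := h
  exact ⟨-m, by linarith⟩

theorem eq_of_cast_eq {i j : ℤ} (h : (i : ZMod n) = j) (h₁ : i < j + n) (h₂ : j < i + n) :
    i = j := by
  obtain ⟨m, rfl⟩ := exists_add_mul_of_cast_eq h
  have : m = 0 := by nlinarith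
  simp [this]

theorem ccwDist_intCast {i j : ℤ} (h₁ : i ≤ j) (h₂ : j < i + n) :
    (ccwDist (i : ZMod n) (j : ZMod n) : ℤ) = j - i := by
  unfold ccwDist
  rw [← Int.cast_sub, ZMod.val_intCast, Int.emod_eq_of_lt (by omega) (by omega)]

theorem ccwDist_lt (r s : ZMod n) : (ccwDist r s : ℤ) < n := by exact_mod_cast ZMod.val_lt _

theorem intCast_add_ccwDist {i : ℤ} {r s : ZMod n} (h : (i : ZMod n) = r) :
    ((i + ccwDist r s : ℤ) : ZMod n) = s := by
  simp [ccwDist, h]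

variable {σ}

theorem ccwDist_pos {r s : ZMod n} (h : r ≠ s) : (0 : ℤ) < ccwDist r s := by
  have : (s - r).val ≠ 0 := by rw [Ne, ZMod.val_eq_zero, sub_eq_zero]; exact h.symm
  simp only [ccwDist]; omega

theorem ne_add_one (r : ZMod n) : r ≠ r + 1 := by
  intro h
  have h1 : (1 : ZMod n) = 0 := by simpa using h.symm
  rw [ZMod.one_eq_zero_iff] at h1
  have := (Fact.out : 2 ≤ n)
  omega

theorem chord_ne {r s : ZMod n} (h : Edge.chord r s ∈ σ.edges) : r ≠ s := by
  rcases h with h | h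
  · change s = r + 1 at h
    rw [h]
    exact ne_add_one r
  · exact (σ.maximal.1.1 _ h).1.symm

theorem exists_hasChord {r s : ZMod n} (h : Edge.chord r s ∈ σ.edges) {i : ℤ}
    (hi : (i : ZMod n) = r) : ∃ j : ℤ, (j : ZMod n) = s ∧ σ.HasChord i j := by
  refine ⟨i + ccwDist r s, intCast_add_ccwDist hi, ?_, ?_, ?_⟩
  · have := ccwDist_pos (chord_ne h); omega
  · have := ccwDist_lt r s; omega
  · rw [intCast_add_ccwDist hi, hi]; exact h

theorem exists_hasChord' {r s : ZMod n} (h : Edge.chord r s ∈ σ.edges) {j : ℤ}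
    (hj : (j : ZMod n) = s) : ∃ i : ℤ, (i : ZMod n) = r ∧ σ.HasChord i j := by
  refine ⟨j - ccwDist r s, ?_, ?_, ?_, ?_⟩
  · simp [ccwDist, hj]
  · have := ccwDist_pos (chord_ne h); omega
  · have := ccwDist_lt r s; omega
  · rw [hj]; convert h; simp [ccwDist, hj]

namespace HasChord

theorem lt {i j : ℤ} (h : σ.HasChord i j) : i < j := h.1

theorem lt_add {i j : ℤ} (h : σ.HasChord i j) : j < i + n := h.2.1

theorem shift {i j : ℤ} (h : σ.HasChord i j) (m : ℤ) : σ.HasChord (i + m * n) (j + m * n) := by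
  refine ⟨by linarith [h.1], by linarith [h.2.1], ?_⟩
  rw [intCast_add_mul, intCast_add_mul]
  exact h.2.2

theorem add {i j : ℤ} (h : σ.HasChord i j) : σ.HasChord (i + n) (j + n) := by
  simpa using h.shift 1

theorem sub {i j : ℤ} (h : σ.HasChord i j) : σ.HasChord (i - n) (j - n) := by
  simpa [← sub_eq_add_neg] using h.shift (-1)

theorem mem_arcs {i j : ℤ} (h : σ.HasChord i j) (h' : i + 1 < j) :
    Edge.chord (i : ZMod n) (j : ZMod n) ∈ σ.arcs := by
  rcases h.2.2 with hs | hs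
  · change (j : ZMod n) = i + 1 at hs
    have := eq_of_cast_eq (n := n) (i := j) (j := i + 1) (by push_cast; exact hs)
      (by have := h.2.1; omega) (by have := h.2.1; omega)
    omega
  · exact hs

/-- Edges of a triangulation do not cross. -/
theorem not_cross {i j k l : ℤ} (h : σ.HasChord i j) (h' : σ.HasChord k l) (hik : i < k)
    (hkj : k < j) : l ≤ j := by
  by_contra! hjl
  have hne : Edge.chord (i : ZMod n) (j : ZMod n) ≠ Edge.chord (k : ZMod n) (l : ZMod n) := by
    intro he
    injection he with h1 h2
    have := eq_of_cast_eq h1 (by have := h.2.1; omega) (by have := h.2.1; omega)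
    omega
  refine (σ.maximal.1.2 (h.mem_arcs (by omega)) (h'.mem_arcs (by omega)) hne).1 (Or.inl ?_)
  refine ⟨i, k, rfl, rfl, hik, ?_, ?_⟩
  · rw [ccwDist_intCast h.1.le h.2.1]; omega
  · rw [ccwDist_intCast h.1.le h.2.1, ccwDist_intCast h'.1.le h'.2.1]; omega

theorem not_cross_spoke {i j k : ℤ} {t : Tag} (h : σ.HasChord i j) (h' : σ.HasSpoke t k)
    (hik : i < k) : j ≤ k := by
  by_contra! hkj
  have h'' : Edge.spoke (k : ZMod n) t ∈ σ.arcs := h'.resolve_left id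
  refine (σ.maximal.1.2 (h.mem_arcs (by omega)) h'' (by simp)).1 ?_
  refine ⟨i, k, rfl, rfl, hik, ?_⟩
  rw [ccwDist_intCast h.1.le h.2.1]; omega

end HasChord

theorem hasChord_side (i : ℤ) : σ.HasChord i (i + 1) := by
  have := two_le_cast (n := n)
  refine ⟨by omega, by omega, Or.inl ?_⟩
  simp [Edge.IsSide]

theorem hasChord_side' {i j : ℤ} (h : j = i + 1) : σ.HasChord i j := h ▸ hasChord_side i

theorem HasSpoke.shift {k : ℤ} {t : Tag} (h : σ.HasSpoke t k) (m : ℤ) :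
    σ.HasSpoke t (k + m * n) := by
  unfold HasSpoke
  rw [intCast_add_mul]
  exact h

theorem HasSpoke.add {k : ℤ} {t : Tag} (h : σ.HasSpoke t k) : σ.HasSpoke t (k + n) := by
  simpa using h.shift 1

theorem HasSpoke.tag_eq {k k' : ℤ} {t t' : Tag} (h : σ.HasSpoke t k) (h' : σ.HasSpoke t' k')
    (hk : (k : ZMod n) ≠ k') : t = t' :=
  (σ.maximal.1.2 (h.resolve_left id) (h'.resolve_left id) (by
    intro he
    injection he with h1 h2
    exact hk h1)).2 _ _ _ _ rfl rfl hk

/-- By maximality, a tagged arc compatible with all arcs of `σ` belongs to `σ`. -/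
theorem mem_arcs_of_compatible {e : Edge n} (he : e.IsTaggedArc)
    (h : ∀ a ∈ σ.arcs, e ≠ a → e.Compatible a ∧ a.Compatible e) : e ∈ σ.arcs := by
  have := σ.maximal.2 (y := insert e σ.arcs) ⟨?_, ?_⟩ (Set.subset_insert _ _)
  · exact this (Set.mem_insert _ _)
  · rintro a (rfl | ha)
    · exact he
    · exact σ.maximal.1.1 a ha
  · exact (Set.pairwise_insert).2 ⟨σ.maximal.1.2, h⟩

/-- A chord that crosses no edge of `σ` is an edge of `σ`. -/
theorem hasChord_of_not_cross {i j : ℤ} (hij : i < j) (hji : j < i + n)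
    (h₁ : ∀ k l, σ.HasChord k l → i < k → k < j → l ≤ j)
    (h₂ : ∀ k l, σ.HasChord k l → k < i → i < l → j ≤ l)
    (h₃ : ∀ t k, σ.HasSpoke t k → i < k → j ≤ k) : σ.HasChord i j := by
  rcases eq_or_ne j (i + 1) with rfl | hne
  · exact hasChord_side i
  have hd := ccwDist_intCast hij.le hji
  refine ⟨hij, hji, Or.inr (mem_arcs_of_compatible ⟨?_, ?_⟩ ?_)⟩
  · intro h
    have := eq_of_cast_eq h (by omega) (by omega)
    omega
  · intro h
    exact hne (eq_of_cast_eq (n := n) (by push_cast; exact h) (by omega) (by omega))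
  · have key : ∀ a ∈ σ.arcs, ¬ (Edge.chord (i : ZMod n) (j : ZMod n)).Crosses a := by
      rintro (⟨r, s⟩ | ⟨k, t⟩) ha hc
      · rcases hc with ⟨x, x', hx, hx', h1, h2, h3⟩ | ⟨x, x', hx, hx', h1, h2, h3⟩
        · obtain ⟨m, rfl⟩ := exists_add_mul_of_cast_eq hx
          obtain ⟨l, hl, hc⟩ := exists_hasChord (Or.inr ha) (i := x' - m * n) (by simpa using hx')
          have hd' := ccwDist_intCast hc.1.le hc.2.1
          rw [hl] at hd'
          simp only [Int.cast_sub, hx', Int.cast_mul, Int.cast_natCast, CharP.cast_eq_zero,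
            mul_zero, sub_zero] at hd'
          have := h₁ _ _ hc (by omega) (by omega)
          omega
        · obtain ⟨m, rfl⟩ := exists_add_mul_of_cast_eq hx'
          obtain ⟨l, hl, hc⟩ := exists_hasChord (Or.inr ha) (i := x - m * n) (by simpa using hx)
          have hd' := ccwDist_intCast hc.1.le hc.2.1
          rw [hl] at hd'
          simp only [Int.cast_sub, hx, Int.cast_mul, Int.cast_natCast, CharP.cast_eq_zero,
            mul_zero, sub_zero] at hd'
          have := h₂ _ _ hc (by omega) (by omega)
          omega
      · obtain ⟨x, z, hx, hz, h1, h2⟩ := hc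
        obtain ⟨m, rfl⟩ := exists_add_mul_of_cast_eq hx
        have : σ.HasSpoke t (z - m * n) := by
          unfold HasSpoke
          push_cast
          rw [hz, CharP.cast_eq_zero, mul_zero, sub_zero]
          exact Or.inr ha
        have := h₃ _ _ this (by omega)
        omega
    rintro a ha -
    refine ⟨⟨key a ha, by simp⟩, ?_, by simp⟩
    rintro hc
    refine key a ha ?_
    rcases a with ⟨r, s⟩ | ⟨k, t⟩
    · exact Or.symm hc
    · exact hc

/-- An arc to the puncture that is compatible with all edges of `σ` is an edge of `σ`. -/
theorem hasSpoke_of_not_cross {k : ℤ} {t : Tag}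
    (h₁ : ∀ i j, σ.HasChord i j → i < k → j ≤ k)
    (h₂ : ∀ t' k', σ.HasSpoke t' k' → (k' : ZMod n) ≠ k → t' = t) : σ.HasSpoke t k := by
  refine Or.inr (mem_arcs_of_compatible trivial ?_)
  have key : ∀ a ∈ σ.arcs, ¬ (Edge.spoke (k : ZMod n) t).Crosses a := by
    rintro (⟨r, s⟩ | ⟨k', t'⟩) ha hc
    · obtain ⟨x, z, hx, hz, h1, h2⟩ := hc
      obtain ⟨m, rfl⟩ := exists_add_mul_of_cast_eq hz
      obtain ⟨l, hl, hc⟩ := exists_hasChord (Or.inr ha) (i := x - m * n) (by simpa using hx)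
      have hd' := ccwDist_intCast hc.1.le hc.2.1
      rw [hl] at hd'
      simp only [Int.cast_sub, hx, Int.cast_mul, Int.cast_natCast, CharP.cast_eq_zero,
        mul_zero, sub_zero] at hd'
      have := h₁ _ _ hc (by omega)
      omega
    · exact hc
  rintro a ha -
  refine ⟨⟨key a ha, ?_⟩, ?_, ?_⟩
  · rintro r r' t₁ t₂ h3 rfl hr
    injection h3 with h4 h5
    subst h4 h5
    obtain ⟨x, rfl⟩ := ZMod.intCast_surjective r'
    exact (h₂ t₂ x (Or.inr ha) hr.symm).symm
  · intro hc
    refine key a ha ?_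
    rcases a with ⟨r, s⟩ | ⟨k, t⟩
    · exact hc
    · exact hc
  · rintro r r' t₁ t₂ rfl h3 hr
    injection h3 with h4 h5
    subst h4 h5
    obtain ⟨x, rfl⟩ := ZMod.intCast_surjective r
    exact h₂ t₁ x (Or.inr ha) hr

end Lifts

/-! ### Triangles and outermost chords -/

section Triangles

variable {n : ℕ} [NeZero n] [Fact (2 ≤ n)] {σ : TaggedTriangulation n}

/-- The triangle on the far side (seen from the puncture) of an edge that is not a side. -/
theorem HasChord.exists_middle {i j : ℤ} (h : σ.HasChord i j) (hij : i + 1 < j) :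
    ∃ c, i < c ∧ c < j ∧ σ.HasChord i c ∧ σ.HasChord c j := by
  obtain ⟨c, ⟨hc, hcj⟩, hmax⟩ := Int.exists_greatest_of_bdd (P := fun c => σ.HasChord i c ∧ c < j)
    ⟨j, fun z hz => hz.2.le⟩ ⟨i + 1, hasChord_side i, hij⟩
  refine ⟨c, hc.lt, hcj, hc, hasChord_of_not_cross hcj (by have := h.lt_add; have := hc.lt; omega)
    ?_ ?_ ?_⟩
  · intro k l hkl h1 h2
    exact h.not_cross hkl (by have := hc.lt; omega) h2
  · intro k l hkl h1 h2
    by_contra! hlj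
    rcases lt_trichotomy k i with hk | rfl | hk
    · have := hkl.not_cross h hk (by have := hc.lt; omega)
      omega
    · have := hmax l ⟨hkl, hlj⟩
      omega
    · have := hc.not_cross hkl hk h1
      omega
  · intro t k hk h1
    exact h.not_cross_spoke hk (by have := hc.lt; omega)

/-- An edge properly contained in another one is a side of a triangle on its near side. -/
theorem HasChord.exists_parent_of_le {i j : ℤ} (h : σ.HasChord i j) {p q : ℤ}
    (hpq : σ.HasChord p q) (hp : p ≤ i) (hq : j ≤ q) (hne : ¬ (p = i ∧ q = j)) :
    (∃ e, j < e ∧ σ.HasChord i e ∧ σ.HasChord j e) ∨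
      ∃ e, e < i ∧ σ.HasChord e i ∧ σ.HasChord e j := by
  induction hd : (q - p).toNat using Nat.strong_induction_on generalizing p q with
  | _ d ih =>
    have := h.lt
    obtain ⟨c, h1, h2, h3, h4⟩ := hpq.exists_middle (by omega)
    have hc : c ≤ i ∨ j ≤ c := by
      by_contra! hc
      rcases hp.lt_or_eq with hp | rfl
      · have := h3.not_cross h hp hc.1
        omega
      · have := h.not_cross h4 hc.1 hc.2
        omega
    rcases hc with hc | hc
    · by_cases hcq : c = i ∧ q = j
      · obtain ⟨rfl, rfl⟩ := hcq
        exact Or.inr ⟨p, h1, h3, hpq⟩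
      · exact ih _ (by omega) h4 hc hq hcq rfl
    · by_cases hcq : p = i ∧ c = j
      · obtain ⟨rfl, rfl⟩ := hcq
        exact Or.inl ⟨q, h2, hpq, h4⟩
      · exact ih _ (by omega) h3 hp hc hcq rfl

variable (σ) in
/-- Both the plain and the notched arc from `P_k` to the puncture belong to `σ`. -/
def IsDigonAt (k : ℤ) : Prop := ∀ t, σ.HasSpoke t k

variable (σ) in
open Classical in
/-- A tag such that all arcs of `σ` to the puncture are tagged by it, except in the digon case,
where it is `plain`. -/
def tag : Tag := if ∃ k, σ.HasSpoke .plain k then .plain else .notched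

theorem IsDigonAt.shift {k : ℤ} (h : σ.IsDigonAt k) (m : ℤ) : σ.IsDigonAt (k + m * n) :=
  fun t => (h t).shift m

theorem HasSpoke.tag_eq_tag {t : Tag} {k : ℤ} (h : σ.HasSpoke t k) (hk : ¬ σ.IsDigonAt k) :
    t = σ.tag := by
  unfold tag
  split_ifs with hp
  · obtain ⟨k', hk'⟩ := hp
    by_cases hkk : (k : ZMod n) = k'
    · have : σ.HasSpoke .plain k := by unfold HasSpoke at hk' ⊢; rwa [hkk]
      rcases t with _ | _
      · rfl
      · exact absurd (fun t => by cases t <;> assumption) hk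
    · exact h.tag_eq hk' hkk
  · rcases t with _ | _
    · exact absurd ⟨k, h⟩ hp
    · rfl

theorem IsDigonAt.cast_eq {k m : ℤ} {t : Tag} (hk : σ.IsDigonAt k) (hm : σ.HasSpoke t m) :
    (m : ZMod n) = k := by
  by_contra h
  have h1 := hm.tag_eq (hk .plain) h
  have h2 := hm.tag_eq (hk .notched) h
  rw [h1] at h2
  cases h2

theorem IsDigonAt.tag_eq_plain {k : ℤ} (hk : σ.IsDigonAt k) : σ.tag = .plain :=
  if_pos ⟨k, hk .plain⟩

theorem IsDigonAt.hasSpoke {k : ℤ} (hk : σ.IsDigonAt k) : σ.HasSpoke σ.tag k := hk _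

/-- An edge (different from the arcs to the puncture) is on its near side a side of a triangle not
incident to the puncture, or of a triangle incident to the puncture, or of a digon. -/
theorem HasChord.near_side {i j : ℤ} (h : σ.HasChord i j) :
    (∃ e, j < e ∧ σ.HasChord i e ∧ σ.HasChord j e) ∨
    (∃ e, e < i ∧ σ.HasChord e i ∧ σ.HasChord e j) ∨
    ((∀ k, ¬ σ.IsDigonAt k) ∧ σ.HasSpoke σ.tag i ∧ σ.HasSpoke σ.tag j) ∨
    (σ.IsDigonAt i ∧ σ.HasChord j (i + n)) ∨ (σ.IsDigonAt j ∧ σ.HasChord j (i + n)) := by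
  have hij := h.lt
  have hji := h.lt_add
  by_cases hout : ∀ p q, σ.HasChord p q → p ≤ i → j ≤ q → p = i ∧ q = j
  swap
  · push Not at hout
    obtain ⟨p, q, hpq, hp, hq, hne⟩ := hout
    rcases h.exists_parent_of_le hpq hp hq (by tauto) with h | h
    · exact Or.inl h
    · exact Or.inr (Or.inl h)
  refine Or.inr (Or.inr ?_)
  have hi : ∀ p q, σ.HasChord p q → p < i → q ≤ i := by
    intro p q hpq hp
    by_contra! hq
    have := hout _ _ hpq hp.le (hpq.not_cross h hp hq)
    omega
  have hj : ∀ p q, σ.HasChord p q → p < j → q ≤ j := by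
    intro p q hpq hp
    by_contra! hq
    rcases le_or_gt p i with hpi | hpi
    · have := hout _ _ hpq hpi hq.le
      omega
    · have := h.not_cross hpq hpi hp
      omega
  by_cases hd : ∃ k, σ.IsDigonAt k
  · obtain ⟨k, hk⟩ := hd
    -- choose the lift of the vertex of the digon with `i ≤ k < i + n`
    wlog hki : i ≤ k ∧ k < i + n generalizing k
    · have hn : (0 : ℤ) < n := by have := two_le_cast (n := n); omega
      refine this (k + -((k - i) / n) * n) (hk.shift _) ?_
      have h1 := Int.emod_add_mul_ediv (k - i) n
      have h2 := Int.emod_nonneg (k - i) hn.ne'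
      have h3 := Int.emod_lt_of_pos (k - i) hn
      constructor <;> nlinarith
    have hmem : ∀ t m, σ.HasSpoke t m → (m : ZMod n) = k := fun t m hm => hk.cast_eq hm
    have hchord : k = i ∨ k = j → σ.HasChord j (i + n) := by
      intro hkij
      refine hasChord_of_not_cross hji (by omega) ?_ ?_ ?_
      · intro p q hpq h1 h2
        by_contra! h3
        have := hi _ _ hpq.sub (by omega)
        omega
      · intro p q hpq h1 h2
        have := hj _ _ hpq h1
        omega
      · intro t m hm h1
        by_contra! h2
        have := eq_of_cast_eq (hmem t m hm) (by omega) (by omega)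
        omega
    by_cases h1 : k = i
    · exact Or.inr (Or.inl ⟨h1 ▸ hk, hchord (Or.inl h1)⟩)
    by_cases h2 : k = j
    · exact Or.inr (Or.inr ⟨h2 ▸ hk, hchord (Or.inr h2)⟩)
    exfalso
    have hjk : j < k := by
      have := h.not_cross_spoke (hk .plain) (by omega)
      omega
    have : σ.HasChord i k := by
      refine hasChord_of_not_cross (by omega) hki.2 ?_ ?_ ?_
      · intro p q hpq h1 h2
        by_contra! h3
        have := hpq.not_cross_spoke (hk .plain) h2
        omega
      · intro p q hpq h1 h2
        have := hi _ _ hpq h1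
        omega
      · intro t m hm h1
        by_contra! h2
        have := eq_of_cast_eq (hmem t m hm) (by omega) (by omega)
        omega
    have := hout _ _ this le_rfl hjk.le
    omega
  · push Not at hd
    refine Or.inl ⟨hd, hasSpoke_of_not_cross hi ?_, hasSpoke_of_not_cross hj ?_⟩
    · intro t m hm _
      exact hm.tag_eq_tag (hd m)
    · intro t m hm _
      exact hm.tag_eq_tag (hd m)

theorem HasSpoke.exists_next {k : ℤ} (hd : ∀ k, ¬ σ.IsDigonAt k) (h : σ.HasSpoke σ.tag k) :
    ∃ s, σ.HasChord k s ∧ σ.HasSpoke σ.tag s := by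
  obtain ⟨s, hs, hmax⟩ := Int.exists_greatest_of_bdd (P := fun s => σ.HasChord k s)
    ⟨k + n, fun z hz => hz.lt_add.le⟩ ⟨k + 1, hasChord_side k⟩
  refine ⟨s, hs, ?_⟩
  rcases hs.near_side with ⟨e, he, h1, h2⟩ | ⟨e, he, h1, h2⟩ | h' | ⟨h', -⟩ | ⟨h', -⟩
  · have := hmax e h1
    omega
  · have := h2.not_cross_spoke h he
    have := hs.lt
    omega
  · exact h'.2.2
  · exact absurd h' (hd _)
  · exact absurd h' (hd _)

theorem HasSpoke.exists_prev {k : ℤ} (hd : ∀ k, ¬ σ.IsDigonAt k) (h : σ.HasSpoke σ.tag k) :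
    ∃ r, σ.HasChord r k ∧ σ.HasSpoke σ.tag r := by
  obtain ⟨r, hr, hmax⟩ := Int.exists_least_of_bdd (P := fun s => σ.HasChord s k)
    ⟨k - n, fun z hz => by have := hz.lt_add; omega⟩ ⟨k - 1, by simpa using hasChord_side (k - 1)⟩
  refine ⟨r, hr, ?_⟩
  rcases hr.near_side with ⟨e, he, h1, h2⟩ | ⟨e, he, h1, h2⟩ | h' | ⟨h', -⟩ | ⟨h', -⟩
  · have := h1.not_cross_spoke h hr.lt
    omega
  · have := hmax e h2
    omega
  · exact h'.2.1
  · exact absurd h' (hd _)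
  · exact absurd h' (hd _)

theorem IsDigonAt.exists_sides {k : ℤ} (h : σ.IsDigonAt k) :
    ∃ s, σ.HasChord k s ∧ σ.HasChord s (k + n) := by
  obtain ⟨s, hs, hmax⟩ := Int.exists_greatest_of_bdd (P := fun s => σ.HasChord k s)
    ⟨k + n, fun z hz => hz.lt_add.le⟩ ⟨k + 1, hasChord_side k⟩
  refine ⟨s, hs, ?_⟩
  rcases hs.near_side with ⟨e, he, h1, h2⟩ | ⟨e, he, h1, h2⟩ | h' | ⟨-, h'⟩ | ⟨h', -⟩
  · have := hmax e h1
    omega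
  · have := h2.not_cross_spoke (h .plain) he
    have := hs.lt
    omega
  · exact absurd h (h'.1 k)
  · exact h'
  · have := h.cast_eq (h' .plain)
    have := eq_of_cast_eq this (by have := hs.lt_add; omega) (by have := hs.lt; omega)
    have := hs.lt
    omega

end Triangles

/-! ### Lifts of the pieces of a triangulation -/

section Lifts

variable {n : ℕ} [NeZero n] [Fact (2 ≤ n)] {σ : TaggedTriangulation n}

/-- The integers `i < j < k < i + n` lie over the vertices of the triangle. -/
structure OuterTriangle.Lifts (T : σ.OuterTriangle) (i j k : ℤ) : Prop where
  cast_i : (i : ZMod n) = T.i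
  cast_j : (j : ZMod n) = T.j
  cast_k : (k : ZMod n) = T.k
  ij : σ.HasChord i j
  jk : σ.HasChord j k
  ik : σ.HasChord i k

/-- The integers `r < s < r + n` lie over the vertices of the triangle. -/
structure PuncturedTriangle.Lifts (T : σ.PuncturedTriangle) (r s : ℤ) : Prop where
  cast_r : (r : ZMod n) = T.r
  cast_s : (s : ZMod n) = T.s
  tag_eq : T.t = σ.tag
  rs : σ.HasChord r s
  fst : σ.HasSpoke σ.tag r
  snd : σ.HasSpoke σ.tag s
  not_isDigonAt : ∀ k, ¬ σ.IsDigonAt k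

/-- The integers `k < s < k + n` lie over the vertices of the digon. -/
structure Digon.Lifts (D : σ.Digon) (k s : ℤ) : Prop where
  cast_k : (k : ZMod n) = D.k
  cast_s : (s : ZMod n) = D.s
  ks : σ.HasChord k s
  sk : σ.HasChord s (k + n)
  isDigonAt : σ.IsDigonAt k

theorem OuterTriangle.exists_lifts (T : σ.OuterTriangle) {i : ℤ} (hi : (i : ZMod n) = T.i) :
    ∃ j k, T.Lifts i j k := by
  obtain ⟨j, hj, hij⟩ := exists_hasChord T.mem_ij hi
  obtain ⟨k, hk, hjk⟩ := exists_hasChord T.mem_jk hj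
  obtain ⟨k', hk', hik⟩ := exists_hasChord T.mem_ik hi
  have h1 := ccwDist_intCast hij.lt.le hij.lt_add
  have h2 := ccwDist_intCast hjk.lt.le hjk.lt_add
  have h3 := ccwDist_intCast hik.lt.le hik.lt_add
  rw [hi, hj] at h1
  rw [hj, hk] at h2
  rw [hi, hk'] at h3
  have := T.add_eq
  obtain rfl : k = k' := by omega
  exact ⟨j, k, hi, hj, hk, hij, hjk, hik⟩

theorem OuterTriangle.Lifts.shift {T : σ.OuterTriangle} {i j k : ℤ} (h : T.Lifts i j k) (m : ℤ) :
    T.Lifts (i + m * n) (j + m * n) (k + m * n) where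
  cast_i := by rw [intCast_add_mul, h.cast_i]
  cast_j := by rw [intCast_add_mul, h.cast_j]
  cast_k := by rw [intCast_add_mul, h.cast_k]
  ij := h.ij.shift m
  jk := h.jk.shift m
  ik := h.ik.shift m

theorem OuterTriangle.exists_lifts_j (T : σ.OuterTriangle) {j : ℤ} (hj : (j : ZMod n) = T.j) :
    ∃ i k, T.Lifts i j k := by
  obtain ⟨i, hi⟩ := ZMod.intCast_surjective T.i
  obtain ⟨j', k, h⟩ := T.exists_lifts hi
  obtain ⟨m, rfl⟩ := exists_add_mul_of_cast_eq (hj.trans h.cast_j.symm)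
  exact ⟨_, _, h.shift m⟩

theorem OuterTriangle.exists_lifts_k (T : σ.OuterTriangle) {k : ℤ} (hk : (k : ZMod n) = T.k) :
    ∃ i j, T.Lifts i j k := by
  obtain ⟨i, hi⟩ := ZMod.intCast_surjective T.i
  obtain ⟨j', k, h⟩ := T.exists_lifts hi
  obtain ⟨m, rfl⟩ := exists_add_mul_of_cast_eq (hk.trans h.cast_k.symm)
  exact ⟨_, _, h.shift m⟩

theorem PuncturedTriangle.exists_lifts (T : σ.PuncturedTriangle) {r : ℤ}
    (hr : (r : ZMod n) = T.r) : ∃ s, T.Lifts r s := by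
  obtain ⟨s, hs, hrs⟩ := exists_hasChord T.mem_chord hr
  have h1 : σ.HasSpoke T.t r := by unfold HasSpoke; rw [hr]; exact T.mem_fst
  have h2 : σ.HasSpoke T.t s := by unfold HasSpoke; rw [hs]; exact T.mem_snd
  have hd : ∀ k, ¬ σ.IsDigonAt k := by
    intro k hk
    refine T.ne ?_
    rw [← hr, ← hs, hk.cast_eq h1, hk.cast_eq h2]
  have ht := h1.tag_eq_tag (hd r)
  exact ⟨s, hr, hs, ht, hrs, ht ▸ h1, ht ▸ h2, hd⟩

theorem PuncturedTriangle.Lifts.shift {T : σ.PuncturedTriangle} {r s : ℤ} (h : T.Lifts r s)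
    (m : ℤ) : T.Lifts (r + m * n) (s + m * n) where
  cast_r := by rw [intCast_add_mul, h.cast_r]
  cast_s := by rw [intCast_add_mul, h.cast_s]
  tag_eq := h.tag_eq
  rs := h.rs.shift m
  fst := h.fst.shift m
  snd := h.snd.shift m
  not_isDigonAt := h.not_isDigonAt

theorem PuncturedTriangle.exists_lifts_s (T : σ.PuncturedTriangle) {s : ℤ}
    (hs : (s : ZMod n) = T.s) : ∃ r, T.Lifts r s := by
  obtain ⟨i, hi⟩ := ZMod.intCast_surjective T.r
  obtain ⟨j', h⟩ := T.exists_lifts hi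
  obtain ⟨m, rfl⟩ := exists_add_mul_of_cast_eq (hs.trans h.cast_s.symm)
  exact ⟨_, h.shift m⟩

theorem Digon.exists_lifts (D : σ.Digon) {k : ℤ} (hk : (k : ZMod n) = D.k) :
    ∃ s, D.Lifts k s := by
  obtain ⟨s, hs, hks⟩ := exists_hasChord D.mem_from hk
  obtain ⟨k', hk', hsk⟩ := exists_hasChord D.mem_to hs
  have : k' = k + n := by
    refine eq_of_cast_eq (n := n) ?_ ?_ ?_
    · simp [hk', hk]
    · have := hks.lt; have := hsk.lt_add; have := hks.lt_add; omega
    · have := hks.lt; have := hsk.lt; omega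
  exact ⟨s, hk, hs, hks, this ▸ hsk, fun t => by
    unfold HasSpoke; rw [hk]; exact D.mem_spoke t⟩

theorem Digon.Lifts.shift {D : σ.Digon} {k s : ℤ} (h : D.Lifts k s) (m : ℤ) :
    D.Lifts (k + m * n) (s + m * n) where
  cast_k := by rw [intCast_add_mul, h.cast_k]
  cast_s := by rw [intCast_add_mul, h.cast_s]
  ks := h.ks.shift m
  sk := by convert h.sk.shift m using 1; ring
  isDigonAt := h.isDigonAt.shift m

theorem Digon.exists_lifts_s (D : σ.Digon) {s : ℤ} (hs : (s : ZMod n) = D.s) :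
    ∃ k, D.Lifts k s := by
  obtain ⟨i, hi⟩ := ZMod.intCast_surjective D.k
  obtain ⟨j', h⟩ := D.exists_lifts hi
  obtain ⟨m, rfl⟩ := exists_add_mul_of_cast_eq (hs.trans h.cast_s.symm)
  exact ⟨_, h.shift m⟩

theorem HasChord.exists_outerTriangle {i j k : ℤ} (hij : σ.HasChord i j) (hjk : σ.HasChord j k)
    (hik : σ.HasChord i k) : ∃ T : σ.OuterTriangle, T.Lifts i j k := by
  have h1 := ccwDist_intCast hij.lt.le hij.lt_add
  have h2 := ccwDist_intCast hjk.lt.le hjk.lt_add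
  have h3 := ccwDist_intCast hik.lt.le hik.lt_add
  exact ⟨⟨i, j, k, hij.2.2, hjk.2.2, hik.2.2, by omega⟩, rfl, rfl, rfl, hij, hjk, hik⟩

theorem HasChord.exists_puncturedTriangle {r s : ℤ} (hd : ∀ k, ¬ σ.IsDigonAt k)
    (hrs : σ.HasChord r s) (hr : σ.HasSpoke σ.tag r) (hs : σ.HasSpoke σ.tag s) :
    ∃ T : σ.PuncturedTriangle, T.Lifts r s :=
  ⟨⟨r, s, σ.tag, chord_ne hrs.2.2, hrs.2.2, hr, hs⟩, rfl, rfl, rfl, hrs, hr, hs, hd⟩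

theorem HasChord.exists_digon {k s : ℤ} (hk : σ.IsDigonAt k) (hks : σ.HasChord k s)
    (hsk : σ.HasChord s (k + n)) : ∃ D : σ.Digon, D.Lifts k s :=
  ⟨⟨k, s, chord_ne hks.2.2, hks.2.2, by simpa using hsk.2.2, hk⟩, rfl, rfl, hks, hsk, hk⟩

theorem OuterTriangle.Lifts.eq {T T' : σ.OuterTriangle} {i j k : ℤ} (h : T.Lifts i j k)
    (h' : T'.Lifts i j k) : T = T' := by
  rcases T with ⟨a, b, c, _, _, _, _⟩
  rcases T' with ⟨a', b', c', _, _, _, _⟩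
  obtain rfl : a = a' := h.cast_i.symm.trans h'.cast_i
  obtain rfl : b = b' := h.cast_j.symm.trans h'.cast_j
  obtain rfl : c = c' := h.cast_k.symm.trans h'.cast_k
  rfl

theorem PuncturedTriangle.Lifts.eq {T T' : σ.PuncturedTriangle} {r s : ℤ} (h : T.Lifts r s)
    (h' : T'.Lifts r s) : T = T' := by
  have ht := h.tag_eq.trans h'.tag_eq.symm
  rcases T with ⟨a, b, c, _, _, _, _⟩
  rcases T' with ⟨a', b', c', _, _, _, _⟩
  obtain rfl : a = a' := h.cast_r.symm.trans h'.cast_r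
  obtain rfl : b = b' := h.cast_s.symm.trans h'.cast_s
  obtain rfl : c = c' := ht
  rfl

theorem Digon.Lifts.eq {D D' : σ.Digon} {k s : ℤ} (h : D.Lifts k s) (h' : D'.Lifts k s) :
    D = D' := by
  rcases D with ⟨a, b, _, _, _, _⟩
  rcases D' with ⟨a', b', _, _, _, _⟩
  obtain rfl : a = a' := h.cast_k.symm.trans h'.cast_k
  obtain rfl : b = b' := h.cast_s.symm.trans h'.cast_s
  rfl

/-- The vertex `k` of the digon of a triangulation determines its other vertex. -/
theorem Digon.Lifts.eq_snd {D D' : σ.Digon} {k s s' : ℤ} (h : D.Lifts k s) (h' : D'.Lifts k s') :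
    s = s' := by
  rcases lt_trichotomy s s' with hs | hs | hs
  · have := h'.ks.not_cross h.sk h.ks.lt hs
    have := h'.ks.lt_add
    omega
  · exact hs
  · have := h.ks.not_cross h'.sk h'.ks.lt hs
    have := h.ks.lt_add
    omega

theorem Digon.eq (D D' : σ.Digon) : D = D' := by
  obtain ⟨k, hk⟩ := ZMod.intCast_surjective D.k
  obtain ⟨s, h⟩ := D.exists_lifts hk
  obtain ⟨k', hk'⟩ := ZMod.intCast_surjective D'.k
  obtain ⟨s', h'⟩ := D'.exists_lifts hk'
  have hkk : (k : ZMod n) = D'.k := by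
    rw [← h'.cast_k]
    exact h'.isDigonAt.cast_eq (h.isDigonAt .plain)
  obtain ⟨s', h'⟩ := D'.exists_lifts hkk
  obtain rfl := h.eq_snd h'
  exact h.eq h'

end Lifts

/-! ### The arrows of the quiver -/

section Arrows

variable {n : ℕ} {σ : TaggedTriangulation n}

/-- The arrows of `Q_σ`, without reference to their endpoints. -/
inductive AnyArrow (σ : TaggedTriangulation n)
  | outerI (T : σ.OuterTriangle)
  | outerK (T : σ.OuterTriangle)
  | outerJ (T : σ.OuterTriangle)
  | punctR (T : σ.PuncturedTriangle)
  | punctO (T : σ.PuncturedTriangle)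
  | punctS (T : σ.PuncturedTriangle)
  | digonBase (D : σ.Digon)
  | digonIn (D : σ.Digon) (t : Tag)
  | digonOut (D : σ.Digon) (t : Tag)
  | external (k : ZMod n) (h : ∃ a ∈ σ.arcs, a.IncidentTo k)

/-- An arrow together with its endpoints. -/
def AnyArrow.total : AnyArrow σ → Quiver.Total σ.Vertex
  | .outerI T => ⟨_, _, Arrow.outerI T⟩
  | .outerK T => ⟨_, _, Arrow.outerK T⟩
  | .outerJ T => ⟨_, _, Arrow.outerJ T⟩
  | .punctR T => ⟨_, _, Arrow.punctR T⟩
  | .punctO T => ⟨_, _, Arrow.punctO T⟩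
  | .punctS T => ⟨_, _, Arrow.punctS T⟩
  | .digonBase D => ⟨_, _, Arrow.digonBase D⟩
  | .digonIn D t => ⟨_, _, Arrow.digonIn D t⟩
  | .digonOut D t => ⟨_, _, Arrow.digonOut D t⟩
  | .external k h => ⟨_, _, Arrow.external k h⟩

/-- An arrow, forgetting its endpoints. -/
def Arrow.any {a b : σ.Vertex} : Arrow σ a b → AnyArrow σ
  | .outerI T => .outerI T
  | .outerK T => .outerK T
  | .outerJ T => .outerJ T
  | .punctR T => .punctR T
  | .punctO T => .punctO T
  | .punctS T => .punctS T
  | .digonBase D => .digonBase D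
  | .digonIn D t => .digonIn D t
  | .digonOut D t => .digonOut D t
  | .external k h => .external k h

theorem Arrow.total_any {a b : σ.Vertex} (f : Arrow σ a b) : f.any.total = ⟨a, b, f⟩ := by
  cases f <;> rfl

theorem AnyArrow.any_total (f : AnyArrow σ) : Arrow.any f.total.hom = f := by cases f <;> rfl

theorem AnyArrow.total_injective : Function.Injective (AnyArrow.total (σ := σ)) :=
  fun f g h => by
    rw [← f.any_total, ← g.any_total, h]

/-- The degree of an arrow. It is proportional to the angle of the corresponding rotation in a
centrally symmetric regular `2n`-gon that is a double cover of the punctured polygon, half a turn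
having degree `2n`. -/
def AnyArrow.deg : AnyArrow σ → ℕ
  | .outerI T => ccwDist T.j T.k
  | .outerK T => ccwDist T.i T.j
  | .outerJ T => 2 * n - ccwDist T.i T.k
  | .punctR T => n - ccwDist T.r T.s
  | .punctO T => 2 * ccwDist T.r T.s
  | .punctS T => n - ccwDist T.r T.s
  | .digonBase _ => n
  | .digonIn D _ => ccwDist D.s D.k
  | .digonOut D _ => ccwDist D.k D.s
  | .external _ _ => 2

end Arrows

/-! ### Fans: the edges incident to a vertex of the polygon -/

section Fans

variable {n : ℕ} [NeZero n] [Fact (2 ≤ n)] {σ : TaggedTriangulation n}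

/-- A position of an edge of `σ` in the strip covering the polygon twice. The position
`⟨0, u, v⟩` is the lift of the chord from `P_u` to `P_v`, the position `⟨1, u, u + n⟩` is the arc
from `P_u` to the puncture, considered as a diameter of the double cover, and `⟨2, u, v⟩` is the
chord from `P_{v - 2n}` to `P_u`, with its endpoints exchanged. -/
structure Position where
  /-- the level of a position: it is `0` before the first rotation across the puncture -/
  level : ℕ
  /-- the first endpoint -/
  fst : ℤ
  /-- the second endpoint -/
  snd : ℤ

variable (σ) in
/-- A position at which there is an edge of `σ`. -/
def IsPosition (x : Position) : Prop :=
  (x.level = 0 ∧ σ.HasChord x.fst x.snd) ∨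
  (x.level = 1 ∧ x.snd = x.fst + n ∧ σ.HasSpoke σ.tag x.fst) ∨
  (x.level = 2 ∧ σ.HasChord (x.snd - 2 * n) x.fst)

variable (σ) in
/-- The edge at a position. -/
def edgeAt (x : Position) : Edge n :=
  match x.level with
  | 0 => .chord x.fst x.snd
  | 1 => .spoke x.fst σ.tag
  | _ => .chord x.snd x.fst

theorem isPosition_zero {u v : ℤ} : σ.IsPosition ⟨0, u, v⟩ ↔ σ.HasChord u v := by
  simp [IsPosition]

theorem isPosition_one {u v : ℤ} :
    σ.IsPosition ⟨1, u, v⟩ ↔ v = u + n ∧ σ.HasSpoke σ.tag u := by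
  simp [IsPosition]

theorem isPosition_two {u v : ℤ} : σ.IsPosition ⟨2, u, v⟩ ↔ σ.HasChord (v - 2 * n) u := by
  simp [IsPosition]

theorem isPosition_two' {u v : ℤ} : σ.IsPosition ⟨2, u, v + 2 * n⟩ ↔ σ.HasChord v u := by
  simp [IsPosition]

theorem IsPosition.edgeAt_mem {x : Position} (h : σ.IsPosition x) : σ.edgeAt x ∈ σ.edges := by
  obtain ⟨l, u, v⟩ := x
  rcases h with ⟨h1, h2⟩ | ⟨h1, -, h2⟩ | ⟨h1, h2⟩ <;> simp only at h1 h2 <;> subst h1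
  · exact h2.2.2
  · exact h2
  · have := h2.2.2
    simpa [edgeAt] using this

/-- `σ.Turn k l v l' v' f` means that the arrow `f` turns around the lift `k` of its centre, from
the position `⟨l, k, v⟩` to the position `⟨l', k, v'⟩`. The arrows starting or ending at a notched
arc of a digon are not considered. -/
inductive Turn (σ : TaggedTriangulation n) : ℤ → ℕ → ℤ → ℕ → ℤ → AnyArrow σ → Prop
  | outerI {T : σ.OuterTriangle} {i j k : ℤ} (h : T.Lifts i j k) : Turn σ i 0 j 0 k (.outerI T)
  | outerK {T : σ.OuterTriangle} {i j k v v' : ℤ} (h : T.Lifts i j k) (hv : v = i + 2 * n)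
      (hv' : v' = j + 2 * n) : Turn σ k 2 v 2 v' (.outerK T)
  | outerJ {T : σ.OuterTriangle} {i j k v' : ℤ} (h : T.Lifts i j k) (hv' : v' = i + 2 * n) :
      Turn σ j 0 k 2 v' (.outerJ T)
  | punctR {T : σ.PuncturedTriangle} {r s v' : ℤ} (h : T.Lifts r s) (hv' : v' = r + n) :
      Turn σ r 0 s 1 v' (.punctR T)
  | punctS {T : σ.PuncturedTriangle} {r s v v' : ℤ} (h : T.Lifts r s) (hv : v = s + n)
      (hv' : v' = r + 2 * n) : Turn σ s 1 v 2 v' (.punctS T)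
  | digonBase {D : σ.Digon} {k s v v' : ℤ} (h : D.Lifts k s) (hv : v = k + n)
      (hv' : v' = k + 2 * n) : Turn σ s 0 v 2 v' (.digonBase D)
  | digonIn {D : σ.Digon} {k s v' : ℤ} (h : D.Lifts k s) (hv' : v' = k + n) :
      Turn σ k 0 s 1 v' (.digonIn D .plain)
  | digonOut {D : σ.Digon} {k s v v' : ℤ} (h : D.Lifts k s) (hv : v = k + n)
      (hv' : v' = s + n) : Turn σ k 1 v 2 v' (.digonOut D .plain)

namespace Turn

variable {k v v' : ℤ} {l l' : ℕ} {f : AnyArrow σ}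

theorem isPosition_left (h : Turn σ k l v l' v' f) : σ.IsPosition ⟨l, k, v⟩ := by
  cases h with
  | outerI h => exact isPosition_zero.2 h.ij
  | outerK h hv hv' => subst hv; exact isPosition_two'.2 h.ik
  | outerJ h hv' => exact isPosition_zero.2 h.jk
  | punctR h hv' => exact isPosition_zero.2 h.rs
  | punctS h hv hv' => exact isPosition_one.2 ⟨hv, h.snd⟩
  | digonBase h hv hv' => subst hv; exact isPosition_zero.2 h.sk
  | digonIn h hv' => exact isPosition_zero.2 h.ks
  | digonOut h hv hv' => exact isPosition_one.2 ⟨hv, h.isDigonAt.hasSpoke⟩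

theorem isPosition_right (h : Turn σ k l v l' v' f) : σ.IsPosition ⟨l', k, v'⟩ := by
  cases h with
  | outerI h => exact isPosition_zero.2 h.ik
  | outerK h hv hv' => subst hv'; exact isPosition_two'.2 h.jk
  | outerJ h hv' => subst hv'; exact isPosition_two'.2 h.ij
  | punctR h hv' => exact isPosition_one.2 ⟨hv', h.fst⟩
  | punctS h hv hv' => subst hv'; exact isPosition_two'.2 h.rs
  | digonBase h hv hv' => subst hv'; exact isPosition_two'.2 h.ks
  | digonIn h hv' => exact isPosition_one.2 ⟨hv', h.isDigonAt.hasSpoke⟩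
  | digonOut h hv hv' =>
    subst hv'
    refine isPosition_two.2 ?_
    convert h.sk.sub using 1 <;> ring

theorem edgeAt_left (h : Turn σ k l v l' v' f) : f.total.left.1 = σ.edgeAt ⟨l, k, v⟩ := by
  cases h with
  | outerI h =>
    simp [edgeAt, AnyArrow.total, OuterTriangle.ij, h.cast_i, h.cast_j]
  | outerK h hv hv' =>
    simp [edgeAt, AnyArrow.total, OuterTriangle.ik, h.cast_i, h.cast_k, hv]
  | outerJ h hv' =>
    simp [edgeAt, AnyArrow.total, OuterTriangle.jk, h.cast_j, h.cast_k]
  | punctR h hv' =>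
    simp [edgeAt, AnyArrow.total, PuncturedTriangle.base, h.cast_r, h.cast_s]
  | punctS h hv hv' =>
    simp [edgeAt, AnyArrow.total, PuncturedTriangle.snd, h.cast_s, h.tag_eq]
  | digonBase h hv hv' =>
    simp [edgeAt, AnyArrow.total, Digon.sideTo, h.cast_s, h.cast_k, hv]
  | digonIn h hv' =>
    simp [edgeAt, AnyArrow.total, Digon.sideFrom, h.cast_s, h.cast_k]
  | digonOut h hv hv' =>
    simp [edgeAt, AnyArrow.total, Digon.spoke, h.cast_k, h.isDigonAt.tag_eq_plain]

theorem edgeAt_right (h : Turn σ k l v l' v' f) : f.total.right.1 = σ.edgeAt ⟨l', k, v'⟩ := by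
  cases h with
  | outerI h =>
    simp [edgeAt, AnyArrow.total, OuterTriangle.ik, h.cast_i, h.cast_k]
  | outerK h hv hv' =>
    simp [edgeAt, AnyArrow.total, OuterTriangle.jk, h.cast_j, h.cast_k, hv']
  | outerJ h hv' =>
    simp [edgeAt, AnyArrow.total, OuterTriangle.ij, h.cast_j, h.cast_i, hv']
  | punctR h hv' =>
    simp [edgeAt, AnyArrow.total, PuncturedTriangle.fst, h.cast_r, h.tag_eq]
  | punctS h hv hv' =>
    simp [edgeAt, AnyArrow.total, PuncturedTriangle.base, h.cast_r, h.cast_s, hv']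
  | digonBase h hv hv' =>
    simp [edgeAt, AnyArrow.total, Digon.sideFrom, h.cast_s, h.cast_k, hv']
  | digonIn h hv' =>
    simp [edgeAt, AnyArrow.total, Digon.spoke, h.cast_k, h.isDigonAt.tag_eq_plain]
  | digonOut h hv hv' =>
    simp [edgeAt, AnyArrow.total, Digon.sideTo, h.cast_k, h.cast_s, hv']

theorem deg_eq (h : Turn σ k l v l' v' f) : v' = v + f.deg := by
  cases h with
  | outerI h =>
    have := ccwDist_intCast h.jk.lt.le h.jk.lt_add
    rw [h.cast_j, h.cast_k] at this
    simp only [AnyArrow.deg]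
    omega
  | outerK h hv hv' =>
    have := ccwDist_intCast h.ij.lt.le h.ij.lt_add
    rw [h.cast_i, h.cast_j] at this
    simp only [AnyArrow.deg]
    omega
  | outerJ h hv' =>
    have := ccwDist_intCast h.ik.lt.le h.ik.lt_add
    rw [h.cast_i, h.cast_k] at this
    have := h.ik.lt_add
    simp only [AnyArrow.deg]
    omega
  | punctR h hv' =>
    have := ccwDist_intCast h.rs.lt.le h.rs.lt_add
    rw [h.cast_r, h.cast_s] at this
    have := h.rs.lt_add
    simp only [AnyArrow.deg]
    omega
  | punctS h hv hv' =>
    have := ccwDist_intCast h.rs.lt.le h.rs.lt_add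
    rw [h.cast_r, h.cast_s] at this
    have := h.rs.lt_add
    simp only [AnyArrow.deg]
    omega
  | digonBase h hv hv' => simp only [AnyArrow.deg]; omega
  | digonIn h hv' =>
    have := ccwDist_intCast h.sk.lt.le h.sk.lt_add
    simp only [Int.cast_add, Int.cast_natCast, CharP.cast_eq_zero, add_zero] at this
    rw [h.cast_s, h.cast_k] at this
    simp only [AnyArrow.deg]
    omega
  | digonOut h hv hv' =>
    have := ccwDist_intCast h.ks.lt.le h.ks.lt_add
    rw [h.cast_s, h.cast_k] at this
    simp only [AnyArrow.deg]
    omega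

theorem lt (h : Turn σ k l v l' v' f) : v < v' := by
  cases h with
  | outerI h => exact h.jk.lt
  | outerK h hv hv' => have := h.ij.lt; omega
  | outerJ h hv' => have := h.ik.lt_add; have := two_le_cast (n := n); omega
  | punctR h hv' => have := h.rs.lt_add; omega
  | punctS h hv hv' => have := h.rs.lt_add; omega
  | digonBase h hv hv' => have := two_le_cast (n := n); omega
  | digonIn h hv' => have := h.sk.lt; omega
  | digonOut h hv hv' => have := h.ks.lt; omega

theorem level_le (h : Turn σ k l v l' v' f) : l ≤ l' := by
  cases h <;> omega

/-- The positions of the two ends of an arrow are consecutive in the fan around its centre. -/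
theorem not_between (h : Turn σ k l v l' v' f) {m : ℕ} {w : ℤ} (hw : σ.IsPosition ⟨m, k, w⟩)
    (h₁ : v < w) : v' ≤ w := by
  have hn := two_le_cast (n := n)
  by_contra! h₂
  rcases hw with ⟨-, hw⟩ | ⟨-, hw', hw⟩ | ⟨-, hw⟩
  · dsimp only at hw
    have hw1 := hw.lt
    have hw2 := hw.lt_add
    cases h with
    | outerI h => have := hw.not_cross h.jk h.ij.lt h₁; omega
    | outerK h hv hv' => have := h.ik.lt_add; omega
    | outerJ h hv' => have := h.ik.not_cross hw h.ij.lt h.jk.lt; omega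
    | punctR h hv' => have := hw.not_cross_spoke h.snd h.rs.lt; omega
    | punctS h hv hv' => have := h.rs.lt; omega
    | digonBase h hv hv' =>
      have := hw.not_cross_spoke (h.isDigonAt.hasSpoke.add) (by have := h.sk.lt; omega); omega
    | digonIn h hv' => have := hw.not_cross h.sk h.ks.lt h₁; omega
    | digonOut h hv hv' => omega
  · dsimp only at hw hw'
    subst hw'
    cases h with
    | outerI h => have := h.ik.lt_add; omega
    | outerK h hv hv' => have := h.ik.lt; have := h.ik.lt_add; omega
    | outerJ h hv' => have := h.ik.not_cross_spoke hw h.ij.lt; have := h.jk.lt; omega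
    | punctR h hv' => omega
    | punctS h hv hv' => omega
    | digonBase h hv hv' =>
      have := eq_of_cast_eq (h.isDigonAt.cast_eq hw) (by have := h.ks.lt_add; omega)
        (by have := h.ks.lt; omega)
      have := h.ks.lt
      omega
    | digonIn h hv' => omega
    | digonOut h hv hv' => omega
  · dsimp only at hw
    have hw1 := hw.lt
    have hw2 := hw.lt_add
    cases h with
    | outerI h => have := h.ik.lt_add; omega
    | outerK h hv hv' => have := h.ij.not_cross hw; have := h.ij.lt; have := h.jk.lt; omega
    | outerJ h hv' => have := hw.not_cross h.ik; have := h.ij.lt; have := h.jk.lt; omega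
    | punctR h hv' => omega
    | punctS h hv hv' => have := hw.not_cross_spoke h.fst; have := h.rs.lt; omega
    | digonBase h hv hv' =>
      have := hw.not_cross_spoke h.isDigonAt.hasSpoke
      have := h.ks.lt
      omega
    | digonIn h hv' => omega
    | digonOut h hv hv' =>
      have := h.ks.sub.not_cross hw
      have := h.sk.lt
      omega

end Turn

theorem IsPosition.bounds {x : Position} (h : σ.IsPosition x) :
    x.level ≤ 2 ∧ x.fst + 1 ≤ x.snd ∧ x.snd ≤ x.fst - 1 + 2 * n ∧
    (x.level = 0 → x.snd < x.fst + n) ∧ (x.level = 1 → x.snd = x.fst + n) ∧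
    (x.level = 2 → x.fst + n < x.snd) := by
  have := two_le_cast (n := n)
  rcases h with ⟨h1, h2⟩ | ⟨h1, h2, -⟩ | ⟨h1, h2⟩
  · have := h2.lt; have := h2.lt_add
    omega
  · omega
  · have := h2.lt; have := h2.lt_add
    omega

/-- An edge incident to `P_k` and an endpoint different from `k` determine the level. -/
theorem IsPosition.level_eq {l l' : ℕ} {k v : ℤ} (h : σ.IsPosition ⟨l, k, v⟩)
    (h' : σ.IsPosition ⟨l', k, v⟩) : l = l' := by
  have := h.bounds
  have := h'.bounds
  simp only at *
  omega

namespace Turn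

variable {k v v' w w' : ℤ} {l l' m m' : ℕ} {f g : AnyArrow σ}

/-- The positions of its ends determine an arrow turning around a given vertex. -/
theorem arrow_eq (hf : Turn σ k l v l' v' f) (hg : Turn σ k l v l' v' g) : f = g := by
  have hn := two_le_cast (n := n)
  cases hf with
  | outerI h => cases hg with
    | outerI h' => rw [h.eq h']
  | outerK h hv hv' => cases hg with
    | @outerK T i' j' _ _ _ h' hw hw' =>
      obtain rfl : _ = i' := by simpa [hv] using hw
      obtain rfl : _ = j' := by simpa [hv'] using hw'
      rw [h.eq h']
  | outerJ h hv' => cases hg with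
    | @outerJ T i' _ _ _ h' hw' =>
      obtain rfl : _ = i' := by simpa [hv'] using hw'
      rw [h.eq h']
    | digonBase h' hw hw' =>
      have := h.ik.lt_add
      omega
  | punctR h hv' => cases hg with
    | punctR h' _ => rw [h.eq h']
    | digonIn h' hw' => exact absurd h'.isDigonAt (h.not_isDigonAt _)
  | punctS h hv hv' => cases hg with
    | @punctS T r' _ _ _ h' hw hw' =>
      obtain rfl : _ = r' := by simpa [hv'] using hw'
      rw [h.eq h']
    | digonOut h' hw hw' => exact absurd h'.isDigonAt (h.not_isDigonAt _)
  | digonBase h hv hv' => cases hg with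
    | outerJ h' hw' =>
      have := h'.ik.lt_add
      omega
    | digonBase h' hw hw' => exact congrArg AnyArrow.digonBase (Digon.eq _ _)
  | digonIn h hv' => cases hg with
    | punctR h' hw' => exact absurd h.isDigonAt (h'.not_isDigonAt _)
    | digonIn h' hw' => exact congrArg (AnyArrow.digonIn · .plain) (Digon.eq _ _)
  | digonOut h hv hv' => cases hg with
    | punctS h' hw hw' => exact absurd h.isDigonAt (h'.not_isDigonAt _)
    | digonOut h' hw hw' => exact congrArg (AnyArrow.digonOut · .plain) (Digon.eq _ _)

theorem unique_right (hf : Turn σ k l v l' v' f) (hg : Turn σ k m v m' w' g) :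
    l = m ∧ l' = m' ∧ v' = w' ∧ f = g := by
  obtain rfl := hf.isPosition_left.level_eq hg.isPosition_left
  obtain rfl := le_antisymm (hf.not_between hg.isPosition_right hg.lt)
    (hg.not_between hf.isPosition_right hf.lt)
  obtain rfl := hf.isPosition_right.level_eq hg.isPosition_right
  exact ⟨rfl, rfl, rfl, hf.arrow_eq hg⟩

theorem unique_left (hf : Turn σ k l v l' v' f) (hg : Turn σ k m w m' v' g) :
    l = m ∧ l' = m' ∧ v = w ∧ f = g := by
  obtain rfl := hf.isPosition_right.level_eq hg.isPosition_right
  obtain rfl : v = w := by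
    by_contra hne
    have := hf.lt
    have := hg.lt
    rcases lt_or_gt_of_ne hne with h | h
    · have := hf.not_between hg.isPosition_left h
      omega
    · have := hg.not_between hf.isPosition_left h
      omega
  obtain rfl := hf.isPosition_left.level_eq hg.isPosition_left
  exact ⟨rfl, rfl, rfl, hf.arrow_eq hg⟩

end Turn

theorem IsPosition.exists_turn {l : ℕ} {k v : ℤ} (h : σ.IsPosition ⟨l, k, v⟩)
    (hv : v < k - 1 + 2 * n) : ∃ l' v' f, Turn σ k l v l' v' f := by
  rcases h with ⟨h1, h2⟩ | ⟨h1, h2, h3⟩ | ⟨h1, h2⟩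
  · dsimp only at h1 h2
    subst h1
    rcases h2.near_side with ⟨e, he, h3, h4⟩ | ⟨e, he, h3, h4⟩ | ⟨hd, h3, h4⟩ | ⟨hd, h3⟩ | ⟨hd, h3⟩
    · obtain ⟨T, hT⟩ := h2.exists_outerTriangle h4 h3
      exact ⟨_, _, _, .outerI hT⟩
    · obtain ⟨T, hT⟩ := h3.exists_outerTriangle h2 h4
      exact ⟨_, _, _, .outerJ hT rfl⟩
    · obtain ⟨T, hT⟩ := h2.exists_puncturedTriangle hd h3 h4
      exact ⟨_, _, _, .punctR hT rfl⟩
    · obtain ⟨D, hD⟩ := h2.exists_digon hd h3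
      exact ⟨_, _, _, .digonIn hD rfl⟩
    · obtain ⟨D, hD⟩ := HasChord.exists_digon (k := v - n) (s := k)
        (by simpa [← sub_eq_add_neg] using hd.shift (-1))
        (by simpa using h3.sub) (by simpa using h2)
      exact ⟨_, _, _, .digonBase hD (by ring) rfl⟩
  · dsimp only at h1 h2 h3
    subst h1
    by_cases hd : ∃ k, σ.IsDigonAt k
    · obtain ⟨k', hd⟩ := hd
      have hk : σ.IsDigonAt k := by
        have := hd.cast_eq h3
        intro t
        have := hd t
        unfold HasSpoke at this ⊢
        simp_all
      obtain ⟨s, hs, hs'⟩ := hk.exists_sides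
      obtain ⟨D, hD⟩ := hs.exists_digon hk hs'
      exact ⟨_, _, _, .digonOut hD h2 rfl⟩
    · push Not at hd
      obtain ⟨r, hr, hr'⟩ := h3.exists_prev hd
      obtain ⟨T, hT⟩ := hr.exists_puncturedTriangle hd hr' h3
      exact ⟨_, _, _, .punctS hT h2 rfl⟩
  · dsimp only at h1 h2
    subst h1
    obtain ⟨c, -, -, h3, h4⟩ := h2.exists_middle (by omega)
    obtain ⟨T, hT⟩ := h3.exists_outerTriangle h4 h2
    exact ⟨_, _, _, .outerK hT (by ring) rfl⟩

end Fans

/-! ### External cycles -/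

section ExternalCycles

variable {n : ℕ} [NeZero n] [Fact (2 ≤ n)] {σ : TaggedTriangulation n}

theorem Arrow.total_eq_of_any_eq {a b a' b' : σ.Vertex} {f : a ⟶ b} {g : a' ⟶ b'}
    (h : Arrow.any f = Arrow.any g) :
    (⟨a, b, f⟩ : Quiver.Total σ.Vertex) = ⟨a', b', g⟩ := by
  rw [← Arrow.total_any f, ← Arrow.total_any g, h]

theorem Turn.left_eq {k v v' : ℤ} {l l' : ℕ} {a b : σ.Vertex} {f : a ⟶ b}
    (h : Turn σ k l v l' v' (Arrow.any f)) : a.1 = σ.edgeAt ⟨l, k, v⟩ := by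
  rw [← h.edgeAt_left, Arrow.total_any]

theorem Turn.right_eq {k v v' : ℤ} {l l' : ℕ} {a b : σ.Vertex} {f : a ⟶ b}
    (h : Turn σ k l v l' v' (Arrow.any f)) : b.1 = σ.edgeAt ⟨l', k, v'⟩ := by
  rw [← h.edgeAt_right, Arrow.total_any]

/-- Positions of the same edge differ by a translation, once their levels agree. -/
theorem IsPosition.exists_shift {x y : Position} (hx : σ.IsPosition x) (hy : σ.IsPosition y)
    (hl : x.level = y.level) (h : σ.edgeAt x = σ.edgeAt y) :
    ∃ m : ℤ, y.fst = x.fst + m * n ∧ y.snd = x.snd + m * n := by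
  obtain ⟨l, u, v⟩ := x
  obtain ⟨l', u', v'⟩ := y
  obtain rfl : l = l' := hl
  have bx := hx.bounds
  have by' := hy.bounds
  simp only at bx by' ⊢
  have hl : l = 0 ∨ l = 1 ∨ l = 2 := by omega
  have key : (u' : ZMod n) = u ∧ (l ≠ 1 → (v' : ZMod n) = v) := by
    rcases hl with rfl | rfl | rfl <;> simp only [edgeAt, Edge.chord.injEq, Edge.spoke.injEq] at h
    · exact ⟨h.1.symm, fun _ => h.2.symm⟩
    · exact ⟨h.1.symm, by simp⟩
    · exact ⟨h.2.symm, fun _ => h.1.symm⟩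
  obtain ⟨m, rfl⟩ := exists_add_mul_of_cast_eq key.1
  refine ⟨m, rfl, ?_⟩
  by_cases h1 : l = 1
  · have := bx.2.2.2.2.1 h1
    have := by'.2.2.2.2.1 h1
    omega
  · refine eq_of_cast_eq (n := n) (by rw [key.2 h1, intCast_add_mul]) ?_ ?_ <;> omega

theorem IsPosition.eq_of_edgeAt_eq {k v v' : ℤ} {l l' : ℕ} (h : σ.IsPosition ⟨l, k, v⟩)
    (h' : σ.IsPosition ⟨l', k, v'⟩) (he : σ.edgeAt ⟨l, k, v⟩ = σ.edgeAt ⟨l', k, v'⟩) :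
    l = l' ∧ v = v' := by
  have hn := two_le_cast (n := n)
  have b := h.bounds
  have b' := h'.bounds
  simp only at b b'
  have hl : l = l' := by
    by_contra hne
    have hcases : (l = 0 ∨ l = 1 ∨ l = 2) ∧ (l' = 0 ∨ l' = 1 ∨ l' = 2) := by omega
    rcases hcases with ⟨rfl | rfl | rfl, rfl | rfl | rfl⟩ <;> simp [edgeAt] at he <;>
      try exact hne rfl
    · have := eq_of_cast_eq (n := n) (i := v' - n) (j := k) (by simpa using he.1.symm)
        (by omega) (by omega)
      omega
    · have := eq_of_cast_eq (n := n) (i := v - n) (j := k) (by simpa using he.1)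
        (by omega) (by omega)
      omega
  refine ⟨hl, ?_⟩
  obtain ⟨m, h1, h2⟩ := h.exists_shift h' hl he
  simp only at h1 h2
  have : m * n = 0 := by omega
  omega

/-- `σ.FanPath k l v l' v' p` means that `p` is a path of arrows turning around the lift `k` of a
vertex of the polygon, from the position `⟨l, k, v⟩` to the position `⟨l', k, v'⟩`. -/
inductive FanPath (σ : TaggedTriangulation n) (k : ℤ) (l : ℕ) (v : ℤ) :
    ℕ → ℤ → ∀ {a b : σ.Vertex}, Quiver.Path a b → Prop
  | nil {a : σ.Vertex} (h : σ.IsPosition ⟨l, k, v⟩) (ha : a.1 = σ.edgeAt ⟨l, k, v⟩) :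
      FanPath σ k l v l v (Quiver.Path.nil : Quiver.Path a a)
  | cons {l' l'' : ℕ} {v' v'' : ℤ} {a b c : σ.Vertex} {p : Quiver.Path a b} {f : b ⟶ c}
      (hp : FanPath σ k l v l' v' p) (hf : Turn σ k l' v' l'' v'' (Arrow.any f)) :
      FanPath σ k l v l'' v'' (p.cons f)

namespace FanPath

variable {k v v' v'' : ℤ} {l l' l'' : ℕ} {a b c : σ.Vertex}

theorem isPosition_right {p : Quiver.Path a b} (h : FanPath σ k l v l' v' p) :
    σ.IsPosition ⟨l', k, v'⟩ := by
  cases h with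
  | nil h ha => exact h
  | cons hp hf => exact hf.isPosition_right

theorem right_eq {p : Quiver.Path a b} (h : FanPath σ k l v l' v' p) :
    b.1 = σ.edgeAt ⟨l', k, v'⟩ := by
  cases h with
  | nil h ha => exact ha
  | cons hp hf => exact hf.right_eq

theorem le {p : Quiver.Path a b} (h : FanPath σ k l v l' v' p) : v ≤ v' := by
  induction h with
  | nil h ha => exact le_rfl
  | cons hp hf ih => exact ih.trans hf.lt.le

theorem trans {p : Quiver.Path a b} {q : Quiver.Path b c} (h : FanPath σ k l v l' v' p)
    (h' : FanPath σ k l' v' l'' v'' q) : FanPath σ k l v l'' v'' (p.comp q) := by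
  induction h' with
  | nil h ha => exact h
  | cons hp hf ih => exact .cons (ih h) hf

theorem toPath {f : a ⟶ b} (h : Turn σ k l v l' v' (Arrow.any f)) :
    FanPath σ k l v l' v' f.toPath :=
  .cons (.nil h.isPosition_left h.left_eq) h

/-- Any two positions of a fan are joined by a path around its vertex. -/
theorem exist (h : σ.IsPosition ⟨l, k, v⟩) (h' : σ.IsPosition ⟨l', k, v'⟩) (hv : v ≤ v')
    (ha : a.1 = σ.edgeAt ⟨l, k, v⟩) (hb : b.1 = σ.edgeAt ⟨l', k, v'⟩) :
    ∃ p : Quiver.Path a b, FanPath σ k l v l' v' p := by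
  induction hd : (v' - v).toNat using Nat.strong_induction_on generalizing v l a with
  | _ d ih =>
    rcases hv.lt_or_eq with hlt | rfl
    · have hb' := h'.bounds
      simp only at hb'
      obtain ⟨l₁, v₁, f, hf⟩ := h.exists_turn (by omega)
      have h1 := hf.lt
      have h2 := hf.not_between h' hlt
      obtain ⟨p, hp⟩ := ih _ (by omega) hf.isPosition_right h2 (a := f.total.right)
        hf.edgeAt_right rfl
      obtain rfl : f.total.left = a := Subtype.ext (hf.edgeAt_left.trans ha.symm)
      refine ⟨f.total.hom.toPath.comp p, (toPath ?_).trans hp⟩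
      rwa [AnyArrow.any_total]
    · obtain rfl := h.level_eq h'
      obtain rfl : a = b := Subtype.ext (ha.trans hb.symm)
      exact ⟨.nil, .nil h ha⟩

theorem eq {p q : Quiver.Path a b} (h : FanPath σ k l v l' v' p) (h' : FanPath σ k l v l' v' q) :
    p = q := by
  induction h with
  | nil h ha =>
    cases h' with
    | nil => rfl
    | cons hp hf => have := hp.le; have := hf.lt; omega
  | cons hp hf ih =>
    cases h' with
    | nil => have := hp.le; have := hf.lt; omega
    | cons hp' hf' =>
      obtain ⟨rfl, -, rfl, he⟩ := hf.unique_left hf'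
      have := Arrow.total_eq_of_any_eq he
      cases this
      rw [ih hp']

theorem mem_pathArrows {p : Quiver.Path a b} (h : FanPath σ k l v l' v' p)
    {f : Quiver.Total σ.Vertex} (hf : f ∈ pathArrows p) :
    ∃ m w m' w', Turn σ k m w m' w' (Arrow.any f.hom) ∧ v ≤ w ∧ w' ≤ v' := by
  induction h with
  | nil h ha => cases hf
  | cons hp hf' ih =>
    rw [pathArrows, List.mem_cons] at hf
    rcases hf with rfl | hf
    · exact ⟨_, _, _, _, hf', hp.le, le_rfl⟩
    · obtain ⟨m, w, m', w', h1, h2, h3⟩ := ih hf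
      exact ⟨m, w, m', w', h1, h2, h3.trans hf'.lt.le⟩

end FanPath

theorem Turn.centre {k v v' : ℤ} {l l' : ℕ} {f : AnyArrow σ} (h : Turn σ k l v l' v' f) :
    Arrow.centre f.total.hom = .polygon (k : ZMod n) := by
  cases h with
  | outerI h => simp [AnyArrow.total, Arrow.centre, h.cast_i]
  | outerK h => simp [AnyArrow.total, Arrow.centre, h.cast_k]
  | outerJ h => simp [AnyArrow.total, Arrow.centre, h.cast_j]
  | punctR h => simp [AnyArrow.total, Arrow.centre, h.cast_r]
  | punctS h => simp [AnyArrow.total, Arrow.centre, h.cast_s]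
  | digonBase h => simp [AnyArrow.total, Arrow.centre, h.cast_s]
  | digonIn h => simp [AnyArrow.total, Arrow.centre, h.cast_k]
  | digonOut h => simp [AnyArrow.total, Arrow.centre, h.cast_k]

theorem Turn.not_isExternal {k v v' : ℤ} {l l' : ℕ} {f : AnyArrow σ} (h : Turn σ k l v l' v' f) :
    ¬ Arrow.IsExternal f.total.hom := by
  cases h <;> exact not_false

theorem edgeAt_ne_notched {x : Position} (D : σ.Digon) :
    σ.edgeAt x ≠ (D.spoke .notched).1 := by
  obtain ⟨k, hk⟩ := ZMod.intCast_surjective D.k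
  obtain ⟨s, hD⟩ := D.exists_lifts hk
  obtain ⟨l, u, v⟩ := x
  intro h
  rcases l with _ | _ | l <;> simp [edgeAt, Digon.spoke, hD.isDigonAt.tag_eq_plain] at h

/-- The lift of a non-external arrow turning around a vertex of the polygon. -/
theorem Arrow.exists_turn {a b : σ.Vertex} (f : Arrow σ a b) {k : ℤ}
    (hk : f.centre = .polygon (k : ZMod n)) (he : ¬ f.IsExternal)
    (ha : ∀ D : σ.Digon, a ≠ D.spoke .notched) (hb : ∀ D : σ.Digon, b ≠ D.spoke .notched) :
    ∃ l v l' v', Turn σ k l v l' v' f.any := by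
  cases f with
  | outerI T =>
    obtain ⟨j, k, h⟩ := T.exists_lifts (MarkedPoint.polygon.inj hk).symm
    exact ⟨_, _, _, _, .outerI h⟩
  | outerK T =>
    obtain ⟨i, j, h⟩ := T.exists_lifts_k (MarkedPoint.polygon.inj hk).symm
    exact ⟨_, _, _, _, .outerK h rfl rfl⟩
  | outerJ T =>
    obtain ⟨i, k, h⟩ := T.exists_lifts_j (MarkedPoint.polygon.inj hk).symm
    exact ⟨_, _, _, _, .outerJ h rfl⟩
  | punctR T =>
    obtain ⟨s, h⟩ := T.exists_lifts (MarkedPoint.polygon.inj hk).symm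
    exact ⟨_, _, _, _, .punctR h rfl⟩
  | punctO T => cases hk
  | punctS T =>
    obtain ⟨s, h⟩ := T.exists_lifts_s (MarkedPoint.polygon.inj hk).symm
    exact ⟨_, _, _, _, .punctS h rfl rfl⟩
  | digonBase D =>
    obtain ⟨k, h⟩ := D.exists_lifts_s (MarkedPoint.polygon.inj hk).symm
    exact ⟨_, _, _, _, .digonBase h rfl rfl⟩
  | digonIn D t =>
    obtain ⟨s, h⟩ := D.exists_lifts (MarkedPoint.polygon.inj hk).symm
    rcases t with _ | _
    · exact ⟨_, _, _, _, .digonIn h rfl⟩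
    · exact absurd rfl (hb D)
  | digonOut D t =>
    obtain ⟨s, h⟩ := D.exists_lifts (MarkedPoint.polygon.inj hk).symm
    rcases t with _ | _
    · exact ⟨_, _, _, _, .digonOut h rfl rfl⟩
    · exact absurd rfl (ha D)
  | external k h => exact absurd trivial he

theorem isPosition_sideFrom (k : ℤ) : σ.IsPosition ⟨0, k, k + 1⟩ :=
  isPosition_zero.2 (hasChord_side k)

theorem isPosition_sideTo (k : ℤ) : σ.IsPosition ⟨2, k, k - 1 + 2 * n⟩ :=
  isPosition_two'.2 (hasChord_side' (by ring))

theorem edgeAt_sideFrom (k : ℤ) : (σ.sideFrom (k : ZMod n)).1 = σ.edgeAt ⟨0, k, k + 1⟩ := by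
  simp [sideFrom, edgeAt]

theorem edgeAt_sideTo (k : ℤ) :
    (σ.sideTo (k : ZMod n)).1 = σ.edgeAt ⟨2, k, k - 1 + 2 * n⟩ := by
  simp [sideTo, edgeAt]

/-- The paths occurring in external cycles are the complete rotations around the vertices. -/
theorem FanPath.of_forall {k : ℤ} {b : σ.Vertex} (p : Quiver.Path (σ.sideFrom (k : ZMod n)) b)
    (h : ∀ f ∈ pathArrows p, ¬ Arrow.IsExternal f.hom ∧
      Arrow.centre f.hom = .polygon (k : ZMod n) ∧ ∀ D : σ.Digon, f.left ≠ D.spoke .notched)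
    (hb : ∀ D : σ.Digon, b ≠ D.spoke .notched) :
    ∃ l v, FanPath σ k 0 (k + 1) l v p := by
  induction p with
  | nil => exact ⟨_, _, .nil (isPosition_sideFrom k) (edgeAt_sideFrom k)⟩
  | @cons b c p f ih =>
    have hf := h ⟨_, _, f⟩ (by simp [pathArrows])
    obtain ⟨l, v, hp⟩ := ih (fun g hg => h g (by simp [pathArrows, hg])) hf.2.2
    obtain ⟨m, w, m', w', ht⟩ := Arrow.exists_turn f hf.2.1 hf.1 hf.2.2 hb
    obtain ⟨rfl, rfl⟩ := hp.isPosition_right.eq_of_edgeAt_eq ht.isPosition_left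
      (hp.right_eq.symm.trans ht.left_eq)
    exact ⟨m', w', .cons hp ht⟩

theorem isExternalCycle_iff {c : Σ a : σ.Vertex, Quiver.Path a a} :
    IsExternalCycle c ↔ ∃ (k : ℤ) (h : ∃ a ∈ σ.arcs, a.IncidentTo (k : ZMod n))
      (p : Quiver.Path (σ.sideFrom (k : ZMod n)) (σ.sideTo (k : ZMod n))),
      FanPath σ k 0 (k + 1) 2 (k - 1 + 2 * n) p ∧
      c = ⟨σ.sideTo k, (Quiver.Hom.toPath (Arrow.external (k : ZMod n) h)).comp p⟩ := by
  constructor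
  · rintro ⟨κ, h, p, hp, rfl⟩
    obtain ⟨k, rfl⟩ := ZMod.intCast_surjective κ
    obtain ⟨l, v, hp'⟩ := FanPath.of_forall p hp (fun D hD => edgeAt_ne_notched D
      ((edgeAt_sideTo k).symm.trans (congrArg Subtype.val hD)))
    obtain ⟨rfl, rfl⟩ := hp'.isPosition_right.eq_of_edgeAt_eq (isPosition_sideTo k)
      (hp'.right_eq.symm.trans (edgeAt_sideTo k))
    exact ⟨k, h, p, hp', rfl⟩
  · rintro ⟨k, h, p, hp, rfl⟩
    refine ⟨k, h, p, fun f hf => ?_, rfl⟩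
    obtain ⟨m, w, m', w', h1, -⟩ := hp.mem_pathArrows hf
    have h2 := h1.not_isExternal
    have h3 := h1.centre
    rw [Arrow.total_any] at h2 h3
    exact ⟨h2, h3, fun D hD => edgeAt_ne_notched D
      (h1.left_eq.symm.trans (congrArg Subtype.val hD))⟩

theorem isExternalCycle_unique {k : ℤ} {h : ∃ a ∈ σ.arcs, a.IncidentTo (k : ZMod n)}
    {p : Quiver.Path (σ.sideFrom (k : ZMod n)) (σ.sideTo (k : ZMod n))}
    (hp : FanPath σ k 0 (k + 1) 2 (k - 1 + 2 * n) p) {k' : ℤ} (hk : (k' : ZMod n) = k)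
    {h' : ∃ a ∈ σ.arcs, a.IncidentTo (k' : ZMod n)}
    {p' : Quiver.Path (σ.sideFrom (k' : ZMod n)) (σ.sideTo (k' : ZMod n))}
    (hp' : FanPath σ k' 0 (k' + 1) 2 (k' - 1 + 2 * n) p') :
    (⟨_, (Quiver.Hom.toPath (Arrow.external (k' : ZMod n) h')).comp p'⟩ :
      Σ a : σ.Vertex, Quiver.Path a a) =
    ⟨_, (Quiver.Hom.toPath (Arrow.external (k : ZMod n) h)).comp p⟩ := by
  have : ∃ (q : Quiver.Path (σ.sideFrom (k : ZMod n)) (σ.sideTo (k : ZMod n))),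
      FanPath σ k 0 (k + 1) 2 (k - 1 + 2 * n) q ∧
      (⟨_, (Quiver.Hom.toPath (Arrow.external (k' : ZMod n) h')).comp p'⟩ :
        Σ a : σ.Vertex, Quiver.Path a a) =
      ⟨_, (Quiver.Hom.toPath (Arrow.external (k : ZMod n) h)).comp q⟩ := by
    have hc : IsExternalCycle (⟨_, (Quiver.Hom.toPath (Arrow.external (k' : ZMod n) h')).comp p'⟩ :
      Σ a : σ.Vertex, Quiver.Path a a) := isExternalCycle_iff.2 ⟨k', h', p', hp', rfl⟩
    obtain ⟨κ, h1, q, hq, he⟩ := hc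
    have : κ = k := by
      have := congrArg (fun c : (Σ a : σ.Vertex, Quiver.Path a a) => c.1.1) he
      simp only [sideTo, Edge.chord.injEq] at this
      rw [← hk, this.2]
    subst this
    obtain ⟨l, v, hq'⟩ := FanPath.of_forall q hq (fun D hD => edgeAt_ne_notched D
      ((edgeAt_sideTo k).symm.trans (congrArg Subtype.val hD)))
    obtain ⟨rfl, rfl⟩ := hq'.isPosition_right.eq_of_edgeAt_eq (isPosition_sideTo k)
      (hq'.right_eq.symm.trans (edgeAt_sideTo k))
    exact ⟨q, hq', he⟩
  obtain ⟨q, hq, he⟩ := this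
  rw [he, hp.eq hq]

theorem finite_isExternalCycle :
    {c : Σ a : σ.Vertex, Quiver.Path a a | IsExternalCycle c}.Finite := by
  refine Set.Finite.subset (Set.finite_iUnion (fun κ : ZMod n => Set.Subsingleton.finite
    (s := {c : Σ a : σ.Vertex, Quiver.Path a a | IsExternalCycle c ∧ c.1 = σ.sideTo κ}) ?_)) ?_
  · rintro _ ⟨h1, h2⟩ _ ⟨h3, h4⟩
    obtain ⟨k, h, p, hp, rfl⟩ := isExternalCycle_iff.1 h1
    obtain ⟨k', h', p', hp', rfl⟩ := isExternalCycle_iff.1 h3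
    refine isExternalCycle_unique hp' ?_ hp
    have := congrArg Subtype.val (h2.trans h4.symm)
    simp only [sideTo, Edge.chord.injEq] at this
    exact this.2
  · intro c hc
    obtain ⟨k, h, p, hp, rfl⟩ := isExternalCycle_iff.1 hc
    exact Set.mem_iUnion.2 ⟨k, hc, rfl⟩

end ExternalCycles

/-! ### The punctured cycle -/

section PuncturedCycle

variable {n : ℕ} [NeZero n] [Fact (2 ≤ n)] {σ : TaggedTriangulation n}

theorem PuncturedTriangle.Lifts.eq_snd {T T' : σ.PuncturedTriangle} {r s s' : ℤ}
    (h : T.Lifts r s) (h' : T'.Lifts r s') : s = s' := by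
  have h1 := h.rs.not_cross_spoke h'.snd h'.rs.lt
  have h2 := h'.rs.not_cross_spoke h.snd h.rs.lt
  omega

theorem PuncturedTriangle.Lifts.eq_fst {T T' : σ.PuncturedTriangle} {r r' s : ℤ}
    (h : T.Lifts r s) (h' : T'.Lifts r' s) : r = r' := by
  have h1 := h.rs.not_cross_spoke h'.fst
  have h2 := h'.rs.not_cross_spoke h.fst
  have := h.rs.lt
  have := h'.rs.lt
  omega

theorem Arrow.centre_eq_puncture_iff {a b : σ.Vertex} (f : Arrow σ a b) :
    f.centre = .puncture ↔ ∃ T, f.any = .punctO T := by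
  cases f <;> simp [Arrow.centre, Arrow.any]

/-- `σ.PunctPath r s p` means that `p` is a path of arrows turning around the puncture, from the
arc ending at `P_r` to the arc ending at `P_s`. -/
inductive PunctPath (σ : TaggedTriangulation n) (r : ℤ) :
    ℤ → ∀ {a b : σ.Vertex}, Quiver.Path a b → Prop
  | nil {a : σ.Vertex} (h : σ.HasSpoke σ.tag r) (ha : a.1 = .spoke r σ.tag) :
      PunctPath σ r r (Quiver.Path.nil : Quiver.Path a a)
  | cons {s t : ℤ} {a b c : σ.Vertex} {p : Quiver.Path a b} {f : b ⟶ c}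
      {T : σ.PuncturedTriangle} (hp : PunctPath σ r s p) (hT : T.Lifts s t)
      (hf : Arrow.any f = .punctO T) : PunctPath σ r t (p.cons f)

theorem PuncturedTriangle.Lifts.left_eq {T : σ.PuncturedTriangle} {r s : ℤ} (h : T.Lifts r s)
    {a b : σ.Vertex} {f : a ⟶ b} (hf : Arrow.any f = .punctO T) : a.1 = .spoke r σ.tag := by
  have := congrArg (fun f : Quiver.Total σ.Vertex => f.left.1)
    ((Arrow.total_any f).symm.trans (congrArg AnyArrow.total hf))
  simpa [AnyArrow.total, PuncturedTriangle.fst, h.cast_r, h.tag_eq] using this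

theorem PuncturedTriangle.Lifts.right_eq {T : σ.PuncturedTriangle} {r s : ℤ} (h : T.Lifts r s)
    {a b : σ.Vertex} {f : a ⟶ b} (hf : Arrow.any f = .punctO T) : b.1 = .spoke s σ.tag := by
  have := congrArg (fun f : Quiver.Total σ.Vertex => f.right.1)
    ((Arrow.total_any f).symm.trans (congrArg AnyArrow.total hf))
  simpa [AnyArrow.total, PuncturedTriangle.snd, h.cast_s, h.tag_eq] using this

namespace PunctPath

variable {r s t : ℤ} {a b c : σ.Vertex}

theorem hasSpoke_left {p : Quiver.Path a b} (h : PunctPath σ r s p) : σ.HasSpoke σ.tag r := by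
  induction h with
  | nil h ha => exact h
  | cons hp hT hf ih => exact ih

theorem left_eq {p : Quiver.Path a b} (h : PunctPath σ r s p) : a.1 = .spoke r σ.tag := by
  induction h with
  | nil h ha => exact ha
  | cons hp hT hf ih => exact ih

theorem right_eq {p : Quiver.Path a b} (h : PunctPath σ r s p) : b.1 = .spoke s σ.tag := by
  cases h with
  | nil h ha => exact ha
  | cons hp hT hf => exact hT.right_eq hf

theorem le {p : Quiver.Path a b} (h : PunctPath σ r s p) : r ≤ s := by
  induction h with
  | nil h ha => exact le_rfl
  | cons hp hT hf ih => exact ih.trans hT.rs.lt.le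

theorem trans {p : Quiver.Path a b} {q : Quiver.Path b c} (h : PunctPath σ r s p)
    (h' : PunctPath σ s t q) : PunctPath σ r t (p.comp q) := by
  induction h' with
  | nil h ha => exact h
  | cons hp hT hf ih => exact .cons (ih h) hT hf

theorem toPath {T : σ.PuncturedTriangle} (hT : T.Lifts r s) {f : a ⟶ b}
    (hf : Arrow.any f = .punctO T) : PunctPath σ r s f.toPath :=
  .cons (.nil hT.fst (hT.left_eq hf)) hT hf

theorem exist (hd : ∀ k, ¬ σ.IsDigonAt k) (h : σ.HasSpoke σ.tag r) (h' : σ.HasSpoke σ.tag s)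
    (hrs : r ≤ s) (ha : a.1 = .spoke r σ.tag) (hb : b.1 = .spoke s σ.tag) :
    ∃ p : Quiver.Path a b, PunctPath σ r s p := by
  induction hm : (s - r).toNat using Nat.strong_induction_on generalizing r a with
  | _ d ih =>
    rcases hrs.lt_or_eq with hlt | rfl
    · obtain ⟨t, ht, ht'⟩ := h.exists_next hd
      obtain ⟨T, hT⟩ := ht.exists_puncturedTriangle hd h ht'
      have h1 := ht.not_cross_spoke h' hlt
      have h2 := ht.lt
      have hO : Arrow.any (AnyArrow.punctO T).total.hom = .punctO T := AnyArrow.any_total _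
      obtain ⟨p, hp⟩ := ih _ (by omega) ht' h1 (a := (AnyArrow.punctO T).total.right)
        (hT.right_eq hO) rfl
      obtain rfl : (AnyArrow.punctO T).total.left = a :=
        Subtype.ext ((hT.left_eq hO).trans ha.symm)
      exact ⟨_, (toPath hT hO).trans hp⟩
    · obtain rfl : a = b := Subtype.ext (ha.trans hb.symm)
      exact ⟨.nil, .nil h ha⟩

theorem eq {p q : Quiver.Path a b} (h : PunctPath σ r s p) (h' : PunctPath σ r s q) : p = q := by
  induction h with
  | nil h ha =>
    cases h' with
    | nil => rfl
    | cons hp hT hf => have := hp.le; have := hT.rs.lt; omega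
  | cons hp hT hf ih =>
    cases h' with
    | nil => have := hp.le; have := hT.rs.lt; omega
    | cons hp' hT' hf' =>
      obtain rfl := hT.eq_fst hT'
      obtain rfl := hT.eq hT'
      have := Arrow.total_eq_of_any_eq (hf.trans hf'.symm)
      cases this
      rw [ih hp']

theorem mem_pathArrows {p : Quiver.Path a b} (h : PunctPath σ r s p) {f : Quiver.Total σ.Vertex}
    (hf : f ∈ pathArrows p) :
    ∃ T i j, PuncturedTriangle.Lifts T i j ∧ Arrow.any f.hom = .punctO T ∧ r ≤ i ∧ j ≤ s := by
  induction h with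
  | nil h ha => cases hf
  | cons hp hT hf' ih =>
    rw [pathArrows, List.mem_cons] at hf
    rcases hf with rfl | hf
    · exact ⟨_, _, _, hT, hf', hp.le, le_rfl⟩
    · obtain ⟨T, i, j, h1, h2, h3, h4⟩ := ih hf
      exact ⟨T, i, j, h1, h2, h3, h4.trans hT.rs.lt.le⟩

theorem not_mem_pathArrows {p : Quiver.Path a b} (h : PunctPath σ r s p)
    {T : σ.PuncturedTriangle} {i j : ℤ} (hT : T.Lifts i j) (hsi : s ≤ i) (hi : i < r + n)
    {f : Quiver.Total σ.Vertex} (hf : Arrow.any f.hom = .punctO T) : f ∉ pathArrows p := by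
  intro hmem
  obtain ⟨T', i', j', h1, h2, h3, h4⟩ := h.mem_pathArrows hmem
  have : T = T' := by rw [hf] at h2; injection h2
  subst this
  have := h1.rs.lt
  have := eq_of_cast_eq (hT.cast_r.trans h1.cast_r.symm) (by omega) (by omega)
  omega

theorem shift {p : Quiver.Path a b} (h : PunctPath σ r s p) (m : ℤ) :
    PunctPath σ (r + m * n) (s + m * n) p := by
  induction h with
  | nil h ha => exact .nil (h.shift m) (by rw [ha, intCast_add_mul])
  | cons hp hT hf ih => exact .cons ih (hT.shift m) hf

theorem nodup {p : Quiver.Path a b} (h : PunctPath σ r s p) (hrs : s ≤ r + n) :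
    (pathArrows p).Nodup := by
  induction h with
  | nil h ha => exact List.nodup_nil
  | cons hp hT hf ih =>
    have := hT.rs.lt
    rw [pathArrows, List.nodup_cons]
    exact ⟨hp.not_mem_pathArrows hT le_rfl (by omega) hf, ih (by omega)⟩

theorem of_forall {r : ℤ} (p : Quiver.Path a b) (hr : σ.HasSpoke σ.tag r)
    (ha : a.1 = .spoke r σ.tag)
    (h : ∀ f ∈ pathArrows p, Arrow.centre f.hom = .puncture) :
    ∃ s, PunctPath σ r s p := by
  induction p with
  | nil => exact ⟨r, .nil hr ha⟩
  | @cons b c p f ih =>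
    have hf := h ⟨_, _, f⟩ (by simp [pathArrows])
    obtain ⟨s, hp⟩ := ih (fun g hg => h g (by simp [pathArrows, hg]))
    obtain ⟨T, hT⟩ := (Arrow.centre_eq_puncture_iff f).1 hf
    have hs := hp.right_eq
    have : (s : ZMod n) = T.r := by
      have := congrArg (fun f : Quiver.Total σ.Vertex => f.left.1)
        ((Arrow.total_any f).symm.trans (congrArg AnyArrow.total hT))
      simp [AnyArrow.total, PuncturedTriangle.fst, hs] at this
      exact this.1
    obtain ⟨t, hT'⟩ := T.exists_lifts this
    exact ⟨t, .cons hp hT' hT⟩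

end PunctPath

/-- The punctured cycle is the complete rotation around the puncture. -/
theorem IsPuncturedCycle.exists_punctPath {c : Σ a : σ.Vertex, Quiver.Path a a}
    (h : IsPuncturedCycle c) : ∃ r : ℤ, PunctPath σ r (r + n) c.2 ∧
      (∀ k, ¬ σ.IsDigonAt k) ∧ ∀ (r' : ZMod n) (t' : Tag), .spoke r' t' ∈ σ.edges →
        (r : ZMod n).val ≤ r'.val := by
  obtain ⟨a, p⟩ := c
  obtain ⟨ρ, t, h1, h2, h3, h4, h5⟩ := h
  obtain ⟨r, rfl⟩ := ZMod.intCast_surjective ρ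
  have hn := two_le_cast (n := n)
  dsimp only at *
  have hd : ∀ k, ¬ σ.IsDigonAt k := by
    cases p with
    | nil => exact absurd rfl h3
    | cons p f =>
      have hf := h5 ⟨_, _, f⟩ (by simp [pathArrows])
      obtain ⟨T, hT⟩ := (Arrow.centre_eq_puncture_iff f).1 hf
      obtain ⟨i, hi⟩ := ZMod.intCast_surjective T.r
      obtain ⟨s, hs⟩ := T.exists_lifts hi
      exact hs.not_isDigonAt
  have hr : σ.HasSpoke t r := by
    unfold HasSpoke
    rw [← h1]
    exact a.2
  obtain rfl := hr.tag_eq_tag (hd r)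
  obtain ⟨s, hp⟩ := PunctPath.of_forall p hr h1 h5
  have hrs : (s : ZMod n) = r := by
    have := hp.right_eq
    rw [h1] at this
    injection this with this
    exact this.symm
  obtain ⟨m, rfl⟩ := exists_add_mul_of_cast_eq hrs
  have hm : m = 1 := by
    have h6 := hp.le
    have hm0 : 0 ≤ m := by
      by_contra! h0
      have : m * (n : ℤ) < 0 := mul_neg_of_neg_of_pos h0 (by omega)
      omega
    by_contra hm1
    rcases hm0.lt_or_eq with hm0 | rfl
    · have hm2 : 2 ≤ m := by omega
      -- an arrow used in the first turn is used again in the last one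
      have h7 : 2 * (n : ℤ) ≤ m * n := mul_le_mul_of_nonneg_right hm2 (by omega)
      obtain ⟨q, hq⟩ := PunctPath.exist hd hr hr.add (by omega) h1 (b := a) (by simpa using h1)
      obtain ⟨q', hq'⟩ := PunctPath.exist hd hr.add (hr.shift m) (by omega)
        (a := a) (b := a) (by simpa using h1) (by simpa using h1)
      obtain rfl := hp.eq (hq.trans hq')
      rw [pathArrows_comp] at h4
      generalize hA : r + n = A at hq hq'
      generalize hB : r + m * n = B at hq'
      cases hq with
      | nil => omega
      | cons hq₁ hT hf =>
        cases hq' with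
        | nil => omega
        | cons hq₁' hT' hf' =>
          have hsh := hT.shift (m - 1)
          obtain rfl : A + (m - 1) * n = B := by rw [← hA, ← hB]; ring
          obtain rfl := hT'.eq_fst hsh
          obtain rfl := hT'.eq hsh
          have := Arrow.total_eq_of_any_eq (hf.trans hf'.symm)
          simp [pathArrows, this] at h4
    · refine h3 ?_
      generalize hB : r + 0 * n = B at hp
      cases hp with
      | nil => rfl
      | cons hq₁ hT hf =>
        have := hq₁.le
        have := hT.rs.lt
        omega
  subst hm
  exact ⟨r, by simpa using hp, hd, h2⟩

theorem isPuncturedCycle_unique {c c' : Σ a : σ.Vertex, Quiver.Path a a}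
    (h : IsPuncturedCycle c) (h' : IsPuncturedCycle c') : c = c' := by
  obtain ⟨r, hr, hd, hmin⟩ := h.exists_punctPath
  obtain ⟨r', hr', -, hmin'⟩ := h'.exists_punctPath
  have hrr : (r : ZMod n) = r' := ZMod.val_injective n
    (le_antisymm (hmin _ _ hr'.hasSpoke_left) (hmin' _ _ hr.hasSpoke_left))
  obtain ⟨a, p⟩ := c
  obtain ⟨a', p'⟩ := c'
  obtain rfl : a = a' := Subtype.ext (by rw [hr.left_eq, hr'.left_eq, hrr])
  dsimp only at hr hr'
  obtain ⟨m, rfl⟩ := exists_add_mul_of_cast_eq hrr.symm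
  have := hr.shift m
  rw [show r + n + m * n = r + m * n + n by ring] at this
  rw [this.eq hr']

/-- The punctured cycle passes once through each of the arrows around the puncture. -/
theorem PuncturedTriangle.Lifts.exists_isPuncturedCycle {T : σ.PuncturedTriangle} {i j : ℤ}
    (hT : T.Lifts i j) : ∃ (a : σ.Vertex) (r : ℤ) (u : Quiver.Path a T.fst)
      (w : Quiver.Path T.snd a), PunctPath σ r i u ∧ PunctPath σ j (r + n) w ∧
      r ≤ i ∧ j ≤ r + n ∧ IsPuncturedCycle (σ := σ)
        ⟨a, u.comp ((Quiver.Hom.toPath (Arrow.punctO T)).comp w)⟩ := by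
  have hn := two_le_cast (n := n)
  obtain ⟨ρ, ⟨t, ht⟩, hmin⟩ := (Set.toFinite {ρ : ZMod n | ∃ t, .spoke ρ t ∈ σ.edges}).exists_minimalFor
    (fun ρ => ρ.val) _ ⟨(i : ZMod n), σ.tag, hT.fst⟩
  replace hmin : ∀ (r' : ZMod n) (t' : Tag), .spoke r' t' ∈ σ.edges → ρ.val ≤ r'.val := by
    intro r' t' h'
    rcases le_total ρ.val r'.val with h | h
    · exact h
    · exact hmin ⟨t', h'⟩ h
  obtain ⟨r, rfl, hri, hir⟩ : ∃ r : ℤ, (r : ZMod n) = ρ ∧ r ≤ i ∧ i < r + n := by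
    obtain ⟨r, rfl⟩ := ZMod.intCast_surjective ρ
    refine ⟨r + (i - r) / n * n, intCast_add_mul _ _, ?_, ?_⟩
    · have h1 := Int.emod_add_mul_ediv (i - r) n
      have h2 := Int.emod_nonneg (i - r) (b := n) (by omega)
      nlinarith
    · have h1 := Int.emod_add_mul_ediv (i - r) n
      have h3 := Int.emod_lt_of_pos (i - r) (b := n) (by omega)
      nlinarith
  have hr : σ.HasSpoke t r := ht
  have hd := hT.not_isDigonAt
  obtain rfl := hr.tag_eq_tag (hd r)
  have hj : j ≤ r + n := hT.rs.not_cross_spoke hr.add (by omega)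
  let a : σ.Vertex := ⟨.spoke r σ.tag, ht⟩
  obtain ⟨u, hu⟩ := PunctPath.exist hd hr hT.fst hri (a := a) (b := T.fst) rfl
    (by simp [PuncturedTriangle.fst, hT.cast_r, hT.tag_eq])
  obtain ⟨w, hw⟩ := PunctPath.exist hd hT.snd hr.add hj (a := T.snd) (b := a)
    (by simp [PuncturedTriangle.snd, hT.cast_s, hT.tag_eq]) (by simp [a])
  have hp := hu.trans ((PunctPath.toPath hT (f := Arrow.punctO T) rfl).trans hw)
  refine ⟨a, r, u, w, hu, hw, hri, hj, r, σ.tag, rfl, hmin, ?_, hp.nodup le_rfl, ?_⟩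
  · simp [Quiver.Path.length_comp, Quiver.Hom.toPath]
  · intro f hf
    obtain ⟨T', i', j', -, h2, -⟩ := hp.mem_pathArrows hf
    exact (Arrow.centre_eq_puncture_iff _).2 ⟨T', h2⟩

end PuncturedCycle

/-! ### The derivatives of the potential -/

section Derivatives

variable (K : Type*) [Field K] {n : ℕ} {σ : TaggedTriangulation n}

/-- The sum of the paths which complete an arrow to a clockwise triangle. -/
def AnyArrow.complement : AnyArrow σ → PathAlgebra K σ.Vertex
  | .outerI T => PathAlgebra.ofPath ((Quiver.Path.nil.cons (Arrow.outerK T)).cons (Arrow.outerJ T))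
  | .outerK T => PathAlgebra.ofPath ((Quiver.Path.nil.cons (Arrow.outerJ T)).cons (Arrow.outerI T))
  | .outerJ T => PathAlgebra.ofPath ((Quiver.Path.nil.cons (Arrow.outerI T)).cons (Arrow.outerK T))
  | .punctR T => PathAlgebra.ofPath ((Quiver.Path.nil.cons (Arrow.punctO T)).cons (Arrow.punctS T))
  | .punctO T => PathAlgebra.ofPath ((Quiver.Path.nil.cons (Arrow.punctS T)).cons (Arrow.punctR T))
  | .punctS T => PathAlgebra.ofPath ((Quiver.Path.nil.cons (Arrow.punctR T)).cons (Arrow.punctO T))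
  | .digonBase D =>
      PathAlgebra.ofPath
        ((Quiver.Path.nil.cons (Arrow.digonIn D .plain)).cons (Arrow.digonOut D .plain)) +
      PathAlgebra.ofPath
        ((Quiver.Path.nil.cons (Arrow.digonIn D .notched)).cons (Arrow.digonOut D .notched))
  | .digonIn D t =>
      PathAlgebra.ofPath ((Quiver.Path.nil.cons (Arrow.digonOut D t)).cons (Arrow.digonBase D))
  | .digonOut D t =>
      PathAlgebra.ofPath ((Quiver.Path.nil.cons (Arrow.digonBase D)).cons (Arrow.digonIn D t))
  | .external _ _ => 0

open Classical in
theorem cyclicDerivativeAux_triangle {V : Type*} [Quiver V] (α : Quiver.Total V) {a b c : V}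
    (f : a ⟶ b) (g : b ⟶ c) (h : c ⟶ a) :
    cyclicDerivativeAux K α (((Quiver.Path.nil.cons f).cons g).cons h) Quiver.Path.nil =
      (if (⟨_, _, f⟩ : Quiver.Total V) = α then
        PathAlgebra.ofPath ((Quiver.Path.nil.cons g).cons h) else 0) +
      (if (⟨_, _, g⟩ : Quiver.Total V) = α then
        PathAlgebra.ofPath ((Quiver.Path.nil.cons h).cons f) else 0) +
      (if (⟨_, _, h⟩ : Quiver.Total V) = α then
        PathAlgebra.ofPath ((Quiver.Path.nil.cons f).cons g) else 0) := by
  simp only [cyclicDerivativeAux, zero_add]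
  rfl

theorem finsum_tag {M : Type*} [AddCommMonoid M] (f : Tag → M) :
    ∑ᶠ t, f t = f .plain + f .notched := by
  classical
  rw [finsum_eq_sum_of_support_subset (s := {.plain, .notched}) f (by rintro (_ | _) _ <;> simp),
    Finset.sum_pair (by simp)]

variable {K}

instance [NeZero n] : Finite σ.OuterTriangle :=
  Finite.of_injective (fun T => (T.i, T.j, T.k)) (by
    rintro ⟨_, _, _, _, _, _, _⟩ ⟨_, _, _, _, _, _, _⟩ h
    simp_all)

instance [NeZero n] : Finite σ.PuncturedTriangle :=
  Finite.of_injective (fun T => (T.r, T.s, T.t)) (by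
    rintro ⟨_, _, _, _, _, _, _⟩ ⟨_, _, _, _, _, _, _⟩ h
    simp_all)

instance [NeZero n] : Finite σ.Digon :=
  Finite.of_injective (fun T => (T.k, T.s)) (by
    rintro ⟨_, _, _, _, _, _⟩ ⟨_, _, _, _, _, _⟩ h
    simp_all)

variable (K) in
theorem cyclicDerivativeAux_outerTriangle (T : σ.OuterTriangle) (g : AnyArrow σ) :
    cyclicDerivativeAux K g.total T.cycle.2 Quiver.Path.nil =
      open Classical in
      (if .outerI T = g then AnyArrow.complement K (.outerI T) else 0) +
      (if .outerK T = g then AnyArrow.complement K (.outerK T) else 0) +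
      (if .outerJ T = g then AnyArrow.complement K (.outerJ T) else 0) := by
  classical
  simp only [← AnyArrow.total_injective.eq_iff]
  exact cyclicDerivativeAux_triangle K _ _ _ _

variable (K) in
theorem cyclicDerivativeAux_puncturedTriangle (T : σ.PuncturedTriangle) (g : AnyArrow σ) :
    cyclicDerivativeAux K g.total T.cycle.2 Quiver.Path.nil =
      open Classical in
      (if .punctR T = g then AnyArrow.complement K (.punctR T) else 0) +
      (if .punctO T = g then AnyArrow.complement K (.punctO T) else 0) +
      (if .punctS T = g then AnyArrow.complement K (.punctS T) else 0) := by
  classical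
  simp only [← AnyArrow.total_injective.eq_iff]
  exact cyclicDerivativeAux_triangle K _ _ _ _

variable (K) in
theorem cyclicDerivativeAux_digon (D : σ.Digon) (t : Tag) (g : AnyArrow σ) :
    cyclicDerivativeAux K g.total (D.cycle t).2 Quiver.Path.nil =
      open Classical in
      (if .digonBase D = g then PathAlgebra.ofPath
        ((Quiver.Path.nil.cons (Arrow.digonIn D t)).cons (Arrow.digonOut D t)) else 0) +
      (if .digonIn D t = g then AnyArrow.complement K (.digonIn D t) else 0) +
      (if .digonOut D t = g then AnyArrow.complement K (.digonOut D t) else 0) := by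
  classical
  simp only [← AnyArrow.total_injective.eq_iff]
  exact cyclicDerivativeAux_triangle K _ _ _ _

variable (K) in
/-- The sum of the clockwise triangles. -/
def trianglePotential (σ : TaggedTriangulation n) : Potential K σ.Vertex :=
  (∑ᶠ T : σ.OuterTriangle, Finsupp.single T.cycle 1) +
    (∑ᶠ T : σ.PuncturedTriangle, Finsupp.single T.cycle 1) +
    (∑ᶠ (D : σ.Digon) (t : Tag), Finsupp.single (D.cycle t) 1)

theorem cyclicDerivative_trianglePotential [NeZero n] {a b : σ.Vertex} (f : a ⟶ b) :
    cyclicDerivative f (trianglePotential K σ) = AnyArrow.complement K (Arrow.any f) := by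
  classical
  have h1 : cyclicDerivative f (∑ᶠ T : σ.OuterTriangle, Finsupp.single T.cycle (1 : K)) =
      ∑ᶠ T : σ.OuterTriangle, cyclicDerivativeAux K (Arrow.any f).total T.cycle.2
        Quiver.Path.nil := by
    rw [map_finsum _ (Set.toFinite _)]
    exact finsum_congr fun T => by rw [cyclicDerivative_single, Arrow.total_any]
  have h2 : cyclicDerivative f (∑ᶠ T : σ.PuncturedTriangle, Finsupp.single T.cycle (1 : K)) =
      ∑ᶠ T : σ.PuncturedTriangle, cyclicDerivativeAux K (Arrow.any f).total T.cycle.2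
        Quiver.Path.nil := by
    rw [map_finsum _ (Set.toFinite _)]
    exact finsum_congr fun T => by rw [cyclicDerivative_single, Arrow.total_any]
  have h3 : cyclicDerivative f
      (∑ᶠ (D : σ.Digon) (t : Tag), Finsupp.single (D.cycle t) (1 : K)) =
      ∑ᶠ (D : σ.Digon) (t : Tag), cyclicDerivativeAux K (Arrow.any f).total (D.cycle t).2
        Quiver.Path.nil := by
    rw [map_finsum _ (Set.toFinite _)]
    refine finsum_congr fun D => ?_
    rw [map_finsum _ (Set.toFinite _)]
    exact finsum_congr fun T => by rw [cyclicDerivative_single, Arrow.total_any]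
  rw [trianglePotential, map_add, map_add, h1, h2, h3]
  generalize Arrow.any f = g
  simp only [cyclicDerivativeAux_outerTriangle, cyclicDerivativeAux_puncturedTriangle,
    cyclicDerivativeAux_digon, finsum_tag]
  have key : ∀ {α : Type} (t : α) (x : α → PathAlgebra K σ.Vertex),
      ∑ᶠ s, (if s = t then x s else 0) = x t := fun t x => by
    rw [finsum_eq_single _ t (fun s hs => if_neg hs), if_pos rfl]
  cases g with
  | outerI T => simp [key]
  | outerK T => simp [key]
  | outerJ T => simp [key]
  | punctR T => simp [key]
  | punctO T => simp [key]
  | punctS T => simp [key]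
  | digonBase D =>
    simp
    rw [finsum_eq_single _ D (fun s hs => by simp [hs])]
    simp [AnyArrow.complement]
  | digonIn D t =>
    simp
    rw [finsum_eq_single _ D (fun s hs => by simp [hs])]
    cases t <;> simp
  | digonOut D t =>
    simp
    rw [finsum_eq_single _ D (fun s hs => by simp [hs])]
    cases t <;> simp
  | external k h => simp [AnyArrow.complement]

variable [NeZero n] [Fact (2 ≤ n)]

theorem finite_isPuncturedCycle :
    {c : Σ a : σ.Vertex, Quiver.Path a a | IsPuncturedCycle c}.Finite :=
  Set.Subsingleton.finite fun _ h _ h' => isPuncturedCycle_unique h h'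

theorem cyclicDerivative_finsum {P : (Σ a : σ.Vertex, Quiver.Path a a) → Prop}
    (hP : {c | P c}.Finite) {a b : σ.Vertex} (f : a ⟶ b) :
    cyclicDerivative f (∑ᶠ (c : Σ a : σ.Vertex, Quiver.Path a a) (_ : P c),
      Finsupp.single c (1 : K)) =
    ∑ᶠ (c : Σ a : σ.Vertex, Quiver.Path a a) (_ : P c),
      cyclicDerivativeAux K ⟨a, b, f⟩ c.2 Quiver.Path.nil := by
  refine (AddMonoidHom.map_finsum_mem _ (cyclicDerivative f).toAddMonoidHom hP).trans ?_
  exact finsum_congr fun c => finsum_congr fun _ => cyclicDerivative_single K f c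

theorem cyclicDerivative_finsum_eq_zero {P : (Σ a : σ.Vertex, Quiver.Path a a) → Prop}
    (hP : {c | P c}.Finite) {a b : σ.Vertex} (f : a ⟶ b)
    (h : ∀ c, P c → (⟨a, b, f⟩ : Quiver.Total σ.Vertex) ∉ pathArrows c.2) :
    cyclicDerivative f (∑ᶠ (c : Σ a : σ.Vertex, Quiver.Path a a) (_ : P c),
      Finsupp.single c (1 : K)) = 0 := by
  rw [cyclicDerivative_finsum hP, finsum_eq_zero_of_forall_eq_zero]
  exact fun c => (finsum_congr fun hc => cyclicDerivativeAux_of_notMem K _ _ _ (h c hc)).trans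
    finsum_zero

theorem cyclicDerivative_finsum_eq {P : (Σ a : σ.Vertex, Quiver.Path a a) → Prop}
    (hP : {c | P c}.Finite) {a b : σ.Vertex} (f : a ⟶ b) {x : σ.Vertex} (u : Quiver.Path x a)
    (w : Quiver.Path b x) (hc : P ⟨x, u.comp (f.toPath.comp w)⟩)
    (hu : (⟨a, b, f⟩ : Quiver.Total σ.Vertex) ∉ pathArrows u)
    (hw : (⟨a, b, f⟩ : Quiver.Total σ.Vertex) ∉ pathArrows w)
    (h : ∀ c, P c → (⟨a, b, f⟩ : Quiver.Total σ.Vertex) ∈ pathArrows c.2 →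
      c = ⟨x, u.comp (f.toPath.comp w)⟩) :
    cyclicDerivative f (∑ᶠ (c : Σ a : σ.Vertex, Quiver.Path a a) (_ : P c),
      Finsupp.single c (1 : K)) = PathAlgebra.ofPath (w.comp u) := by
  rw [cyclicDerivative_finsum hP, finsum_eq_single _ ⟨x, u.comp (f.toPath.comp w)⟩]
  · rw [finsum_eq_single _ hc (fun h' hne => absurd rfl hne)]
    exact cyclicDerivativeAux_single K f u w hu hw
  · intro c hne
    exact (finsum_congr fun hc => cyclicDerivativeAux_of_notMem K _ _ _
      (fun hm => hne (h c hc hm))).trans finsum_zero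

theorem FanPath.not_mem_pathArrows_of_le {k v v' w w' : ℤ} {l l' m m' : ℕ} {a b x y : σ.Vertex}
    {f : x ⟶ y} (hf : Turn σ k l v l' v' (Arrow.any f)) {p : Quiver.Path a b}
    (hp : FanPath σ k m w m' w' p) (h : w' ≤ v ∨ v' ≤ w) :
    (⟨x, y, f⟩ : Quiver.Total σ.Vertex) ∉ pathArrows p := by
  intro hmem
  obtain ⟨l₁, v₁, l₂, v₂, h1, h2, h3⟩ := hp.mem_pathArrows hmem
  obtain ⟨-, rfl⟩ := hf.isPosition_left.eq_of_edgeAt_eq h1.isPosition_left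
    (hf.left_eq.symm.trans h1.left_eq)
  have := h1.lt
  obtain ⟨-, -, rfl, -⟩ := hf.unique_right h1
  omega

variable (K) in
/-- The derivative of the sum of the external cycles with respect to an arrow turning around `P_k`
is the remaining part of the external cycle at `P_k`. -/
theorem cyclicDerivative_external {k v v' : ℤ} {l l' : ℕ} {a b : σ.Vertex} {f : a ⟶ b}
    (hf : Turn σ k l v l' v' (Arrow.any f)) (h : ∃ a ∈ σ.arcs, a.IncidentTo (k : ZMod n))
    {u : Quiver.Path (σ.sideFrom (k : ZMod n)) a} (hu : FanPath σ k 0 (k + 1) l v u)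
    {w : Quiver.Path b (σ.sideTo (k : ZMod n))} (hw : FanPath σ k l' v' 2 (k - 1 + 2 * n) w) :
    cyclicDerivative f (∑ᶠ (c : Σ a : σ.Vertex, Quiver.Path a a) (_ : IsExternalCycle c),
      Finsupp.single c (1 : K)) =
    PathAlgebra.ofPath (w.comp ((Quiver.Hom.toPath (Arrow.external (k : ZMod n) h)).comp u)) := by
  have hne : ∀ κ h, Arrow.any f ≠ .external κ h := by
    rintro κ h he
    have := hf.not_isExternal
    rw [he] at this
    exact this trivial
  have hext : ∀ κ h, (⟨a, b, f⟩ : Quiver.Total σ.Vertex) ∉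
      pathArrows (Quiver.Hom.toPath (Arrow.external κ h)) := by
    intro κ h hm
    rw [pathArrows_toPath, List.mem_singleton] at hm
    refine hne κ h ?_
    have := congrArg (fun f : Quiver.Total σ.Vertex => Arrow.any f.hom) hm
    exact this
  have hp := hu.trans ((FanPath.toPath hf).trans hw)
  refine cyclicDerivative_finsum_eq finite_isExternalCycle f _ _ ?_ ?_ ?_ ?_
  · refine isExternalCycle_iff.2 ⟨k, h, _, hp, ?_⟩
    rw [Quiver.Path.comp_assoc]
  · rw [pathArrows_comp, List.mem_append, not_or]
    exact ⟨hu.not_mem_pathArrows_of_le hf (Or.inl le_rfl), hext _ _⟩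
  · exact hw.not_mem_pathArrows_of_le hf (Or.inr le_rfl)
  · intro c hc hmem
    obtain ⟨k', h', p', hp', rfl⟩ := isExternalCycle_iff.1 hc
    rw [pathArrows_comp, List.mem_append] at hmem
    obtain ⟨_, _, _, _, h1, -, -⟩ := hp'.mem_pathArrows (hmem.resolve_right (hext _ _))
    have hk : (k' : ZMod n) = k := by
      injection h1.centre.symm.trans hf.centre
    rw [isExternalCycle_unique hp hk hp' (h := h), Quiver.Path.comp_assoc]

theorem cyclicDerivative_external_eq_zero {a b : σ.Vertex} {f : a ⟶ b}
    (hf : ∀ k l v l' v', ¬ Turn σ k l v l' v' (Arrow.any f)) (he : ¬ Arrow.IsExternal f) :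
    cyclicDerivative f (∑ᶠ (c : Σ a : σ.Vertex, Quiver.Path a a) (_ : IsExternalCycle c),
      Finsupp.single c (1 : K)) = 0 := by
  refine cyclicDerivative_finsum_eq_zero finite_isExternalCycle f ?_
  intro c hc hmem
  obtain ⟨k', h', p', hp', rfl⟩ := isExternalCycle_iff.1 hc
  rw [pathArrows_comp, List.mem_append] at hmem
  rcases hmem with hmem | hmem
  · obtain ⟨_, _, _, _, h1, -, -⟩ := hp'.mem_pathArrows hmem
    exact hf _ _ _ _ _ h1
  · rw [pathArrows_toPath, List.mem_singleton] at hmem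
    cases hmem
    exact he trivial

theorem cyclicDerivative_punctured_eq_zero {a b : σ.Vertex} {f : a ⟶ b}
    (hf : Arrow.centre f ≠ .puncture) :
    cyclicDerivative f (∑ᶠ (c : Σ a : σ.Vertex, Quiver.Path a a) (_ : IsPuncturedCycle c),
      Finsupp.single c (1 : K)) = 0 := by
  refine cyclicDerivative_finsum_eq_zero finite_isPuncturedCycle f ?_
  rintro c ⟨r, t, -, -, -, -, h⟩ hmem
  exact hf (h _ hmem)

variable (K) in
theorem cyclicDerivative_punctured {T : σ.PuncturedTriangle} {i j : ℤ} (hT : T.Lifts i j)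
    {q : Quiver.Path T.snd T.fst} (hq : PunctPath σ j (i + n) q) :
    cyclicDerivative (x := T.fst) (y := T.snd) (Arrow.punctO T)
      (∑ᶠ (c : Σ a : σ.Vertex, Quiver.Path a a) (_ : IsPuncturedCycle c),
        Finsupp.single c (1 : K)) = PathAlgebra.ofPath q := by
  obtain ⟨a, r, u, w, hu, hw, hri, hjr, hc⟩ := hT.exists_isPuncturedCycle
  have hnd : (pathArrows (u.comp ((Quiver.Hom.toPath (Arrow.punctO T)).comp w))).Nodup := by
    obtain ⟨-, -, -, -, -, h, -⟩ := hc
    exact h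
  rw [pathArrows_comp, pathArrows_comp, pathArrows_toPath, List.append_assoc,
    List.nodup_append] at hnd
  obtain ⟨-, h2, h3⟩ := hnd
  rw [List.singleton_append, List.nodup_cons] at h2
  have := hu.shift 1
  rw [one_mul] at this
  rw [hq.eq (hw.trans this)]
  refine cyclicDerivative_finsum_eq finite_isPuncturedCycle _ _ _ hc h2.1 ?_
    (fun c h _ => isPuncturedCycle_unique h hc)
  exact fun hm => h3 _ hm _ (by simp) rfl

theorem potential_eq : potential K σ = trianglePotential K σ -
  (∑ᶠ (c : Σ a : σ.Vertex, Quiver.Path a a) (_ : IsExternalCycle c), Finsupp.single c 1) -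
  (∑ᶠ (c : Σ a : σ.Vertex, Quiver.Path a a) (_ : IsPuncturedCycle c), Finsupp.single c 1) := rfl

/-- The derivative of the potential with respect to an arrow turning around `P_k`. -/
theorem cyclicDerivative_potential_turn {k v v' : ℤ} {l l' : ℕ} {a b : σ.Vertex} {f : a ⟶ b}
    (hf : Turn σ k l v l' v' (Arrow.any f)) (h : ∃ a ∈ σ.arcs, a.IncidentTo (k : ZMod n))
    {u : Quiver.Path (σ.sideFrom (k : ZMod n)) a} (hu : FanPath σ k 0 (k + 1) l v u)
    {w : Quiver.Path b (σ.sideTo (k : ZMod n))} (hw : FanPath σ k l' v' 2 (k - 1 + 2 * n) w) :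
    cyclicDerivative f (potential K σ) = AnyArrow.complement K (Arrow.any f) -
    PathAlgebra.ofPath (w.comp ((Quiver.Hom.toPath (Arrow.external (k : ZMod n) h)).comp u)) := by
  have := hf.centre
  rw [Arrow.total_any] at this
  rw [potential_eq, map_sub, map_sub, cyclicDerivative_trianglePotential,
    cyclicDerivative_external K hf h hu hw, cyclicDerivative_punctured_eq_zero, sub_zero]
  rw [this]
  simp

/-- The derivative of the potential with respect to an arrow turning around the puncture. -/
theorem cyclicDerivative_potential_punctO {T : σ.PuncturedTriangle} {i j : ℤ} (hT : T.Lifts i j)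
    {q : Quiver.Path T.snd T.fst} (hq : PunctPath σ j (i + n) q) :
    cyclicDerivative (x := T.fst) (y := T.snd) (Arrow.punctO T) (potential K σ) =
      AnyArrow.complement K (.punctO T) - PathAlgebra.ofPath q := by
  rw [potential_eq, map_sub, map_sub, cyclicDerivative_trianglePotential,
    cyclicDerivative_punctured K hT hq, cyclicDerivative_external_eq_zero, sub_zero]
  · rfl
  · rintro k l v l' v' ⟨⟩
  · exact not_false

theorem cyclicDerivative_potential_digonIn (D : σ.Digon) :
    cyclicDerivative (x := D.sideFrom) (y := D.spoke .notched) (Arrow.digonIn D .notched)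
      (potential K σ) = AnyArrow.complement K (.digonIn D .notched) := by
  rw [potential_eq, map_sub, map_sub, cyclicDerivative_trianglePotential,
    cyclicDerivative_punctured_eq_zero, cyclicDerivative_external_eq_zero, sub_zero, sub_zero]
  · rfl
  · rintro k l v l' v' ⟨⟩
  · exact not_false
  · simp [Arrow.centre]

theorem cyclicDerivative_potential_digonOut (D : σ.Digon) :
    cyclicDerivative (x := D.spoke .notched) (y := D.sideTo) (Arrow.digonOut D .notched)
      (potential K σ) = AnyArrow.complement K (.digonOut D .notched) := by
  rw [potential_eq, map_sub, map_sub, cyclicDerivative_trianglePotential,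
    cyclicDerivative_punctured_eq_zero, cyclicDerivative_external_eq_zero, sub_zero, sub_zero]
  · rfl
  · rintro k l v l' v' ⟨⟩
  · exact not_false
  · simp [Arrow.centre]

end Derivatives

/-! ### A representation of the frozen Jacobian algebra -/

section Representation

open Polynomial

variable (K : Type*) [Field K]

/-- The element `(t ^ d, t ^ d)` or `(t ^ d, 0)` of `K[t] × K[t]`. -/
def biMonomial (d : ℕ) (b : Bool) : K[X] × K[X] := (X ^ d, if b then X ^ d else 0)

variable {K}

theorem biMonomial_mul (d e : ℕ) (b c : Bool) :
    biMonomial K d b * biMonomial K e c = biMonomial K (d + e) (b && c) := by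
  cases b <;> cases c <;> simp [biMonomial, pow_add]

variable {n : ℕ} {σ : TaggedTriangulation n}

variable (K) in
open Classical in
/-- The idempotents of the representation at the edges. -/
def edgeWeight (σ : TaggedTriangulation n) : Edge n → K[X] × K[X]
  | .chord _ _ => biMonomial K 0 true
  | .spoke _ t => if t = σ.tag then biMonomial K 0 false else (0, 1)

variable (K) in
/-- The monomials by which the arrows act. The second component of `K[t] × K[t]` is killed by
the rotations across the puncture, except for those which pass through the notched arc of a
digon: they kill the first component. -/
def AnyArrow.weight : AnyArrow σ → K[X] × K[X]
  | .outerI T => biMonomial K (AnyArrow.outerI T).deg true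
  | .outerK T => biMonomial K (AnyArrow.outerK T).deg true
  | .outerJ T => biMonomial K (AnyArrow.outerJ T).deg false
  | .punctR T => biMonomial K (AnyArrow.punctR T).deg false
  | .punctO T => biMonomial K (AnyArrow.punctO T).deg false
  | .punctS T => biMonomial K (AnyArrow.punctS T).deg false
  | .digonBase D => biMonomial K (AnyArrow.digonBase D).deg false
  | .digonIn D .plain => biMonomial K (AnyArrow.digonIn D .plain).deg false
  | .digonIn D .notched => (0, X ^ (AnyArrow.digonIn D .notched).deg)
  | .digonOut D .plain => biMonomial K (AnyArrow.digonOut D .plain).deg false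
  | .digonOut D .notched => (0, X ^ (AnyArrow.digonOut D .notched).deg)
  | .external k h => biMonomial K (AnyArrow.external (σ := σ) k h).deg true

variable [NeZero n] [Fact (2 ≤ n)]

theorem PuncturedTriangle.tag_eq (T : σ.PuncturedTriangle) : T.t = σ.tag := by
  obtain ⟨r, hr⟩ := ZMod.intCast_surjective T.r
  obtain ⟨s, h⟩ := T.exists_lifts hr
  exact h.tag_eq

theorem Digon.tag_eq (D : σ.Digon) : σ.tag = .plain := by
  obtain ⟨r, hr⟩ := ZMod.intCast_surjective D.k
  obtain ⟨s, h⟩ := D.exists_lifts hr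
  exact h.isDigonAt.tag_eq_plain

variable (K) in
/-- The weights defining the representation. -/
def weights (σ : TaggedTriangulation n) : Weights σ.Vertex (K[X] × K[X]) where
  vertex a := edgeWeight K σ a.1
  arrow f := (Arrow.any f).weight K
  vertex_mul_vertex := by
    rintro ⟨_ | ⟨r, t⟩, -⟩
    · simp [edgeWeight, biMonomial]
    · by_cases h : t = σ.tag <;> simp [edgeWeight, biMonomial, h]
  vertex_mul_arrow := by
    intro a b (f : Arrow σ a b)
    cases f with
    | punctO T => simp [edgeWeight, PuncturedTriangle.fst, Arrow.any, AnyArrow.weight, biMonomial,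
        T.tag_eq]
    | punctS T => simp [edgeWeight, PuncturedTriangle.snd, Arrow.any, AnyArrow.weight, biMonomial,
        T.tag_eq]
    | digonOut D t =>
      cases t <;> simp [edgeWeight, Digon.spoke, Arrow.any, AnyArrow.weight, biMonomial, D.tag_eq]
    | digonIn D t =>
      cases t <;> simp [edgeWeight, Digon.sideFrom, Arrow.any, AnyArrow.weight, biMonomial]
    | _ =>
      simp [edgeWeight, Arrow.any, AnyArrow.weight, biMonomial, OuterTriangle.ij, OuterTriangle.jk,
        OuterTriangle.ik, PuncturedTriangle.base, Digon.sideTo, sideTo]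
  arrow_mul_vertex := by
    intro a b (f : Arrow σ a b)
    cases f with
    | punctO T => simp [edgeWeight, PuncturedTriangle.snd, Arrow.any, AnyArrow.weight, biMonomial,
        T.tag_eq]
    | punctR T => simp [edgeWeight, PuncturedTriangle.fst, Arrow.any, AnyArrow.weight, biMonomial,
        T.tag_eq]
    | digonIn D t =>
      cases t <;> simp [edgeWeight, Digon.spoke, Arrow.any, AnyArrow.weight, biMonomial, D.tag_eq]
    | digonOut D t =>
      cases t <;> simp [edgeWeight, Digon.sideTo, Arrow.any, AnyArrow.weight, biMonomial]
    | _ =>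
      simp [edgeWeight, Arrow.any, AnyArrow.weight, biMonomial, OuterTriangle.ij, OuterTriangle.jk,
        OuterTriangle.ik, PuncturedTriangle.base, Digon.sideFrom, sideFrom]

theorem Turn.weight_eq {k v v' : ℤ} {l l' : ℕ} {f : AnyArrow σ} (h : Turn σ k l v l' v' f) :
    f.weight K = biMonomial K f.deg (decide (l = l')) := by
  cases h <;> rfl

theorem Turn.ne_one {k v v' : ℤ} {l l' : ℕ} {f : AnyArrow σ} (h : Turn σ k l v l' v' f) :
    ¬ (l = 1 ∧ l' = 1) := by
  cases h <;> simp

theorem FanPath.level_le {k v v' : ℤ} {l l' : ℕ} {a b : σ.Vertex} {p : Quiver.Path a b}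
    (h : FanPath σ k l v l' v' p) : l ≤ l' := by
  induction h with
  | nil h ha => exact le_rfl
  | cons hp hf ih => exact ih.trans hf.level_le

theorem edgeWeight_edgeAt {x : Position} (hx : σ.IsPosition x) :
    edgeWeight K σ (σ.edgeAt x) = biMonomial K 0 (decide (x.level ≠ 1)) := by
  obtain ⟨l, u, v⟩ := x
  have : l ≤ 2 := hx.bounds.1
  interval_cases l <;> simp [edgeAt, edgeWeight]

theorem FanPath.weight_eq {k v v' : ℤ} {l l' : ℕ} {a b : σ.Vertex} {p : Quiver.Path a b}
    (h : FanPath σ k l v l' v' p) :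
    (weights K σ).path p = biMonomial K (v' - v).toNat (decide (l = l' ∧ l ≠ 1)) := by
  induction h with
  | @nil a h ha =>
    change edgeWeight K σ a.1 = _
    rw [ha, edgeWeight_edgeAt h]
    simp
  | cons hp hf ih =>
    have h1 := hp.le
    have h2 := hf.deg_eq
    have h3 := hp.level_le
    have h4 := hf.level_le
    have h5 := hf.ne_one
    rw [Weights.path, ih]
    change _ * (Arrow.any _).weight K = _
    rw [hf.weight_eq, biMonomial_mul, ← Bool.decide_and]
    congr 1
    · omega
    · congr 1
      apply propext
      omega

theorem PunctPath.weight_eq {r s : ℤ} {a b : σ.Vertex} {p : Quiver.Path a b}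
    (h : PunctPath σ r s p) :
    (weights K σ).path p = biMonomial K (2 * (s - r)).toNat false := by
  induction h with
  | @nil a h ha =>
    change edgeWeight K σ a.1 = _
    rw [ha]
    simp [edgeWeight]
  | cons hp hT hf ih =>
    have h1 := hp.le
    have h2 := ccwDist_intCast hT.rs.lt.le hT.rs.lt_add
    have h3 := hT.rs.lt
    rw [hT.cast_r, hT.cast_s] at h2
    rw [Weights.path, ih]
    change _ * (Arrow.any _).weight K = _
    rw [hf, AnyArrow.weight, biMonomial_mul]
    congr 1
    simp only [AnyArrow.deg]
    omega

theorem Turn.deg_le {k v v' : ℤ} {l l' : ℕ} {f : AnyArrow σ} (h : Turn σ k l v l' v' f) :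
    f.deg ≤ 2 * n := by
  have h1 := h.deg_eq
  have h2 := h.isPosition_left.bounds
  have h3 := h.isPosition_right.bounds
  simp only at h2 h3
  omega

open Classical in
theorem rep_cons_cons {a b c : σ.Vertex} (f : a ⟶ b) (g : b ⟶ c) :
    (weights K σ).rep K (PathAlgebra.ofPath ((Quiver.Path.nil.cons f).cons g)) =
      Matrix.single a c ((Arrow.any f).weight K * (Arrow.any g).weight K) := by
  rw [Weights.rep_ofPath]
  exact congrArg (Matrix.single a c)
    (congrArg (· * (Arrow.any g).weight K) ((weights K σ).vertex_mul_arrow f))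

open Classical in
variable (K) in
/-- The complement of an arrow turning around a vertex of the polygon acts by a monomial. -/
theorem Turn.rep_complement {k v v' : ℤ} {l l' : ℕ} {f : AnyArrow σ} (h : Turn σ k l v l' v' f) :
    (weights K σ).rep K (f.complement K) = Matrix.single f.total.right f.total.left
      (biMonomial K (2 * n - f.deg) (decide (l = 0 ∧ l' = 2))) := by
  cases h with
  | @outerI T i j k h =>
    have h1 := ccwDist_intCast h.ij.lt.le h.ij.lt_add
    have h2 := ccwDist_intCast h.jk.lt.le h.jk.lt_add
    have h3 := ccwDist_intCast h.ik.lt.le h.ik.lt_add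
    rw [h.cast_i, h.cast_j] at h1
    rw [h.cast_j, h.cast_k] at h2
    rw [h.cast_i, h.cast_k] at h3
    have h4 := h.ij.lt
    have h5 := h.jk.lt
    have h6 := h.ik.lt_add
    rw [AnyArrow.complement, rep_cons_cons]
    simp only [Arrow.any, AnyArrow.weight, biMonomial_mul, AnyArrow.deg]
    congr 2
    omega
  | @outerK T i j k _ _ h hv hv' =>
    have h1 := ccwDist_intCast h.ij.lt.le h.ij.lt_add
    have h2 := ccwDist_intCast h.jk.lt.le h.jk.lt_add
    have h3 := ccwDist_intCast h.ik.lt.le h.ik.lt_add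
    rw [h.cast_i, h.cast_j] at h1
    rw [h.cast_j, h.cast_k] at h2
    rw [h.cast_i, h.cast_k] at h3
    have h4 := h.ij.lt
    have h5 := h.jk.lt
    have h6 := h.ik.lt_add
    rw [AnyArrow.complement, rep_cons_cons]
    simp only [Arrow.any, AnyArrow.weight, biMonomial_mul, AnyArrow.deg]
    congr 2
    omega
  | @outerJ T i j k _ h hv =>
    have h1 := ccwDist_intCast h.ij.lt.le h.ij.lt_add
    have h2 := ccwDist_intCast h.jk.lt.le h.jk.lt_add
    have h3 := ccwDist_intCast h.ik.lt.le h.ik.lt_add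
    rw [h.cast_i, h.cast_j] at h1
    rw [h.cast_j, h.cast_k] at h2
    rw [h.cast_i, h.cast_k] at h3
    have h4 := h.ij.lt
    have h5 := h.jk.lt
    have h6 := h.ik.lt_add
    rw [AnyArrow.complement, rep_cons_cons]
    simp only [Arrow.any, AnyArrow.weight, biMonomial_mul, AnyArrow.deg]
    congr 2
    omega
  | @punctR T r s _ h hv =>
    have h1 := ccwDist_intCast h.rs.lt.le h.rs.lt_add
    rw [h.cast_r, h.cast_s] at h1
    have h6 := h.rs.lt_add
    rw [AnyArrow.complement, rep_cons_cons]
    simp only [Arrow.any, AnyArrow.weight, biMonomial_mul, AnyArrow.deg]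
    congr 2
    omega
  | @punctS T r s _ _ h hv hv' =>
    have h1 := ccwDist_intCast h.rs.lt.le h.rs.lt_add
    rw [h.cast_r, h.cast_s] at h1
    have h6 := h.rs.lt_add
    rw [AnyArrow.complement, rep_cons_cons]
    simp only [Arrow.any, AnyArrow.weight, biMonomial_mul, AnyArrow.deg]
    congr 2
    omega
  | @digonBase D k s _ _ h hv hv' =>
    have h1 := ccwDist_intCast h.ks.lt.le h.ks.lt_add
    have h2 := ccwDist_intCast h.sk.lt.le h.sk.lt_add
    simp only [Int.cast_add, Int.cast_natCast, CharP.cast_eq_zero, add_zero] at h2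
    rw [h.cast_k, h.cast_s] at h1
    rw [h.cast_k, h.cast_s] at h2
    rw [AnyArrow.complement, map_add, rep_cons_cons, rep_cons_cons]
    simp only [Arrow.any, AnyArrow.weight, biMonomial_mul, AnyArrow.deg]
    erw [← Matrix.single_add]
    congr 1
    have e : ccwDist D.s D.k + ccwDist D.k D.s = 2 * n - n := by omega
    simp [biMonomial, ← pow_add, e]
  | @digonIn D k s _ h hv =>
    have h1 := ccwDist_intCast h.ks.lt.le h.ks.lt_add
    have h2 := ccwDist_intCast h.sk.lt.le h.sk.lt_add
    simp only [Int.cast_add, Int.cast_natCast, CharP.cast_eq_zero, add_zero] at h2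
    rw [h.cast_k, h.cast_s] at h1
    rw [h.cast_k, h.cast_s] at h2
    rw [AnyArrow.complement, rep_cons_cons]
    simp only [Arrow.any, AnyArrow.weight, biMonomial_mul, AnyArrow.deg]
    congr 2
    omega
  | @digonOut D k s _ _ h hv hv' =>
    have h1 := ccwDist_intCast h.ks.lt.le h.ks.lt_add
    have h2 := ccwDist_intCast h.sk.lt.le h.sk.lt_add
    simp only [Int.cast_add, Int.cast_natCast, CharP.cast_eq_zero, add_zero] at h2
    rw [h.cast_k, h.cast_s] at h1
    rw [h.cast_k, h.cast_s] at h2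
    rw [AnyArrow.complement, rep_cons_cons]
    simp only [Arrow.any, AnyArrow.weight, biMonomial_mul, AnyArrow.deg]
    congr 2
    omega

theorem edgeAt_incidentTo {l : ℕ} {k v : ℤ} : (σ.edgeAt ⟨l, k, v⟩).IncidentTo (k : ZMod n) := by
  rcases l with _ | _ | l <;> simp [edgeAt, Edge.IncidentTo]

theorem Turn.exists_incident {k v v' : ℤ} {l l' : ℕ} {a b : σ.Vertex} {f : a ⟶ b}
    (h : Turn σ k l v l' v' (Arrow.any f)) (hab : a ∉ σ.frozen ∨ b ∉ σ.frozen) :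
    ∃ a ∈ σ.arcs, a.IncidentTo (k : ZMod n) := by
  rcases hab with h' | h'
  · exact ⟨a.1, a.2.resolve_left h', h.left_eq ▸ edgeAt_incidentTo⟩
  · exact ⟨b.1, b.2.resolve_left h', h.right_eq ▸ edgeAt_incidentTo⟩

theorem Turn.exists_before {k v v' : ℤ} {l l' : ℕ} {a b : σ.Vertex} {f : a ⟶ b}
    (h : Turn σ k l v l' v' (Arrow.any f)) :
    ∃ u : Quiver.Path (σ.sideFrom (k : ZMod n)) a, FanPath σ k 0 (k + 1) l v u :=
  FanPath.exist (isPosition_sideFrom k) h.isPosition_left (h.isPosition_left.bounds.2.1)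
    (edgeAt_sideFrom k) h.left_eq

theorem Turn.exists_after {k v v' : ℤ} {l l' : ℕ} {a b : σ.Vertex} {f : a ⟶ b}
    (h : Turn σ k l v l' v' (Arrow.any f)) :
    ∃ w : Quiver.Path b (σ.sideTo (k : ZMod n)), FanPath σ k l' v' 2 (k - 1 + 2 * n) w :=
  FanPath.exist h.isPosition_right (isPosition_sideTo k) (h.isPosition_right.bounds.2.2.1)
    h.right_eq (edgeAt_sideTo k)

theorem Turn.rep_cyclicDerivative {k v v' : ℤ} {l l' : ℕ} {a b : σ.Vertex} {f : a ⟶ b}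
    (h : Turn σ k l v l' v' (Arrow.any f)) (hab : a ∉ σ.frozen ∨ b ∉ σ.frozen) :
    (weights K σ).rep K (cyclicDerivative f (potential K σ)) = 0 := by
  classical
  have hi := h.exists_incident hab
  obtain ⟨u, hu⟩ := h.exists_before
  obtain ⟨w, hw⟩ := h.exists_after
  rw [cyclicDerivative_potential_turn h hi hu hw, map_sub, h.rep_complement K, Weights.rep_ofPath,
    Weights.path_comp, Weights.path_comp, Weights.path_toPath, hu.weight_eq, hw.weight_eq,
    Arrow.total_any, sub_eq_zero]
  change _ = Matrix.single _ _ (_ * (biMonomial K 2 true * _))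
  rw [biMonomial_mul, biMonomial_mul]
  congr 2
  · have h1 := h.deg_eq
    have h2 := hu.le
    have h3 := hw.le
    omega
  · rw [Bool.true_and, ← Bool.decide_and]
    congr 1
    apply propext
    have : l' ≤ 2 := h.isPosition_right.bounds.1
    have := h.level_le
    omega

theorem rep_cyclicDerivative_eq_zero {a b : σ.Vertex} (f : Arrow σ a b)
    (hab : a ∉ σ.frozen ∨ b ∉ σ.frozen) :
    (weights K σ).rep K (cyclicDerivative (x := a) (y := b) f (potential K σ)) = 0 := by
  classical
  by_cases ht : ∃ k l v l' v', Turn σ k l v l' v' (Arrow.any f)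
  · obtain ⟨k, l, v, l', v', h⟩ := ht
    exact h.rep_cyclicDerivative hab
  cases f with
  | outerI T =>
    obtain ⟨i, hi⟩ := ZMod.intCast_surjective T.i
    obtain ⟨j, k, h⟩ := T.exists_lifts hi
    exact absurd ⟨_, _, _, _, _, .outerI h⟩ ht
  | outerK T =>
    obtain ⟨i, hi⟩ := ZMod.intCast_surjective T.i
    obtain ⟨j, k, h⟩ := T.exists_lifts hi
    exact absurd ⟨_, _, _, _, _, .outerK h rfl rfl⟩ ht
  | outerJ T =>
    obtain ⟨i, hi⟩ := ZMod.intCast_surjective T.i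
    obtain ⟨j, k, h⟩ := T.exists_lifts hi
    exact absurd ⟨_, _, _, _, _, .outerJ h rfl⟩ ht
  | punctR T =>
    obtain ⟨i, hi⟩ := ZMod.intCast_surjective T.r
    obtain ⟨j, h⟩ := T.exists_lifts hi
    exact absurd ⟨_, _, _, _, _, .punctR h rfl⟩ ht
  | punctS T =>
    obtain ⟨i, hi⟩ := ZMod.intCast_surjective T.r
    obtain ⟨j, h⟩ := T.exists_lifts hi
    exact absurd ⟨_, _, _, _, _, .punctS h rfl rfl⟩ ht
  | digonBase D =>
    obtain ⟨i, hi⟩ := ZMod.intCast_surjective D.k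
    obtain ⟨j, h⟩ := D.exists_lifts hi
    exact absurd ⟨_, _, _, _, _, .digonBase h rfl rfl⟩ ht
  | punctO T =>
    obtain ⟨i, hi⟩ := ZMod.intCast_surjective T.r
    obtain ⟨j, h⟩ := T.exists_lifts hi
    obtain ⟨q, hq⟩ := PunctPath.exist h.not_isDigonAt h.snd h.fst.add h.rs.lt_add.le
      (a := T.snd) (b := T.fst) (h.right_eq (f := Arrow.punctO T) rfl)
      ((h.left_eq (f := Arrow.punctO T) rfl).trans (by simp))
    have h1 := ccwDist_intCast h.rs.lt.le h.rs.lt_add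
    rw [h.cast_r, h.cast_s] at h1
    have h6 := h.rs.lt_add
    rw [cyclicDerivative_potential_punctO h hq, map_sub, sub_eq_zero, Weights.rep_ofPath,
      hq.weight_eq, AnyArrow.complement, Weights.rep_ofPath, Weights.path, Weights.path,
      Weights.path, (weights K σ).vertex_mul_arrow]
    change Matrix.single _ _ (biMonomial K _ _ * biMonomial K _ _) = _
    rw [biMonomial_mul]
    congr 2
    simp only [AnyArrow.deg]
    omega
  | digonIn D t =>
    obtain ⟨i, hi⟩ := ZMod.intCast_surjective D.k
    obtain ⟨j, h⟩ := D.exists_lifts hi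
    cases t with
    | plain => exact absurd ⟨_, _, _, _, _, .digonIn h rfl⟩ ht
    | notched =>
      rw [cyclicDerivative_potential_digonIn, AnyArrow.complement, Weights.rep_ofPath,
        Weights.path, Weights.path, Weights.path, (weights K σ).vertex_mul_arrow]
      change Matrix.single _ _ ((0, _) * (_, 0)) = _
      rw [Prod.mk_mul_mk, zero_mul, mul_zero]
      exact Matrix.single_zero _ _
  | digonOut D t =>
    obtain ⟨i, hi⟩ := ZMod.intCast_surjective D.k
    obtain ⟨j, h⟩ := D.exists_lifts hi
    cases t with
    | plain => exact absurd ⟨_, _, _, _, _, .digonOut h rfl rfl⟩ ht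
    | notched =>
      rw [cyclicDerivative_potential_digonOut, AnyArrow.complement, Weights.rep_ofPath,
        Weights.path, Weights.path, Weights.path, (weights K σ).vertex_mul_arrow]
      change Matrix.single _ _ ((_, 0) * (0, _)) = _
      rw [Prod.mk_mul_mk, zero_mul, mul_zero]
      exact Matrix.single_zero _ _
  | external k h =>
    exact absurd hab (not_or.2 ⟨not_not.2 (sub_add_cancel k 1).symm, not_not.2 rfl⟩)

variable (K σ) in
/-- The representation of `Γ_σ` by matrices over `K[t] × K[t]`. -/
def gammaRep : σ.Gamma K →ₗ[K] Matrix σ.Vertex σ.Vertex (K[X] × K[X]) :=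
  (weights K σ).quotientRep fun _ _ f h => rep_cyclicDerivative_eq_zero f h

theorem gammaRep_mk (x : PathAlgebra K σ.Vertex) :
    gammaRep K σ (jacobianMk _ _ x) = (weights K σ).rep K x :=
  Weights.quotientRep_mk _ _ x

theorem gammaRep_mul (x y : σ.Gamma K) :
    gammaRep K σ (x * y) = gammaRep K σ x * gammaRep K σ y :=
  Weights.quotientRep_mul _ _ x y

end Representation

/-! ### The relations of the frozen Jacobian algebra -/

section Relations

variable (K : Type*) [Field K] {n : ℕ} [NeZero n] {σ : TaggedTriangulation n}

/-- A path, as an element of `Γ_σ`. -/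
def pathElt {a b : σ.Vertex} (p : Quiver.Path a b) : σ.Gamma K :=
  jacobianMk _ _ (PathAlgebra.ofPath p)

/-- The idempotent of a vertex, as an element of `Γ_σ`. -/
def idem (a : σ.Vertex) : σ.Gamma K := pathElt K (Quiver.Path.nil : Quiver.Path a a)

/-- An arrow, as an element of `Γ_σ`. -/
def AnyArrow.elt (f : AnyArrow σ) : σ.Gamma K := pathElt K f.total.hom.toPath

/-- The sum of the paths which complete an arrow to a clockwise triangle, as an element of
`Γ_σ`. -/
def AnyArrow.compl (f : AnyArrow σ) : σ.Gamma K := jacobianMk _ _ (f.complement K)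

variable {K}

theorem pathElt_comp {a b c : σ.Vertex} (p : Quiver.Path a b) (q : Quiver.Path b c) :
    pathElt K (p.comp q) = pathElt K p * pathElt K q := by
  rw [pathElt, pathElt, pathElt, ← map_mul, PathAlgebra.ofPath_mul_ofPath]

theorem pathElt_mul_of_ne {a b c d : σ.Vertex} (p : Quiver.Path a b) (q : Quiver.Path c d)
    (h : b ≠ c) : pathElt K p * pathElt K q = 0 := by
  rw [pathElt, pathElt, ← map_mul, PathAlgebra.ofPath_mul_ofPath_of_ne _ _ h, map_zero]

theorem idem_mul_pathElt {a b : σ.Vertex} (p : Quiver.Path a b) :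
    idem K a * pathElt K p = pathElt K p := by
  rw [idem, ← pathElt_comp, Quiver.Path.nil_comp]

theorem pathElt_mul_idem {a b : σ.Vertex} (p : Quiver.Path a b) :
    pathElt K p * idem K b = pathElt K p := by
  rw [idem, ← pathElt_comp, Quiver.Path.comp_nil]

theorem pathElt_toPath {a b : σ.Vertex} (f : a ⟶ b) :
    pathElt K f.toPath = (Arrow.any f).elt K := by
  rw [AnyArrow.elt, Arrow.total_any]

theorem AnyArrow.idem_mul_compl (f : AnyArrow σ) :
    idem K f.total.right * f.compl K = f.compl K := by
  cases f with
  | digonBase D =>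
    rw [compl, complement, map_add, mul_add]
    exact congrArg₂ _ (idem_mul_pathElt _) (idem_mul_pathElt _)
  | external k h => simp [compl, complement]
  | _ => exact idem_mul_pathElt _

theorem AnyArrow.compl_mul_idem (f : AnyArrow σ) :
    f.compl K * idem K f.total.left = f.compl K := by
  cases f with
  | digonBase D =>
    rw [compl, complement, map_add, add_mul]
    exact congrArg₂ _ (pathElt_mul_idem _) (pathElt_mul_idem _)
  | external k h => simp [compl, complement]
  | _ => exact pathElt_mul_idem _

theorem jacobianMk_cyclicDerivative {a b : σ.Vertex} (f : a ⟶ b)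
    (h : a ∉ σ.frozen ∨ b ∉ σ.frozen) :
    jacobianMk (potential K σ) σ.frozen (cyclicDerivative f (potential K σ)) = 0 :=
  jacobianMk_eq_zero_iff.2 (TwoSidedIdeal.subset_span ⟨a, b, f, h, rfl⟩)

variable [Fact (2 ≤ n)]

theorem IsPosition.eq_of_isSide {l : ℕ} {k v : ℤ} (h : σ.IsPosition ⟨l, k, v⟩)
    (hs : (σ.edgeAt ⟨l, k, v⟩).IsSide) : (l = 0 ∧ v = k + 1) ∨ (l = 2 ∧ v = k - 1 + 2 * n) := by
  have hn := two_le_cast (n := n)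
  have hb := h.bounds
  simp only at hb
  have hl : l = 0 ∨ l = 1 ∨ l = 2 := by omega
  rcases hl with rfl | rfl | rfl
  · have : (v : ZMod n) = k + 1 := hs
    have := eq_of_cast_eq (n := n) (i := v) (j := k + 1) (by simpa using this) (by omega) (by omega)
    omega
  · exact hs.elim
  · have : (k : ZMod n) = v + 1 := hs
    have := eq_of_cast_eq (n := n) (i := k) (j := v - 2 * n + 1) (by simpa using this) (by omega)
      (by omega)
    omega

theorem Turn.spanning_of_frozen {k v v' : ℤ} {l l' : ℕ} {f : AnyArrow σ}
    (h : Turn σ k l v l' v' f) (hl : f.total.left ∈ σ.frozen) (hr : f.total.right ∈ σ.frozen) :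
    l = 0 ∧ v = k + 1 ∧ l' = 2 ∧ v' = k - 1 + 2 * n := by
  have h1 := h.isPosition_left.eq_of_isSide (h.edgeAt_left ▸ hl)
  have h2 := h.isPosition_right.eq_of_isSide (h.edgeAt_right ▸ hr)
  have := h.lt
  have hb := h.isPosition_right.bounds
  simp only at hb
  omega

/-- If a tagged arc is incident to `P_k`, then it has a position between those of the sides. -/
theorem exists_isPosition_of_incident {k : ℤ} (h : ∃ a ∈ σ.arcs, a.IncidentTo (k : ZMod n)) :
    ∃ m w, σ.IsPosition ⟨m, k, w⟩ ∧ k + 1 < w ∧ w < k - 1 + 2 * n := by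
  have hn := two_le_cast (n := n)
  obtain ⟨⟨r, s⟩ | ⟨r, t⟩, ha, hk⟩ := h
  · have hnot : s ≠ r + 1 := (σ.maximal.1.1 _ ha).2
    rcases hk with rfl | rfl
    · obtain ⟨j, rfl, hj⟩ := exists_hasChord (Or.inr ha) rfl
      have h1 := hj.lt
      have h2 := hj.lt_add
      have : j ≠ k + 1 := by rintro rfl; simp at hnot
      exact ⟨_, _, isPosition_zero.2 hj, by omega, by omega⟩
    · obtain ⟨j, rfl, hj⟩ := exists_hasChord' (Or.inr ha) rfl
      have h1 := hj.lt
      have h2 := hj.lt_add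
      have : j ≠ k - 1 := by rintro rfl; simp at hnot
      exact ⟨_, _, isPosition_two'.2 hj, by omega, by omega⟩
  · obtain rfl : (k : ZMod n) = r := hk
    have h1 : σ.HasSpoke t k := Or.inr ha
    have h2 : σ.HasSpoke σ.tag k := by
      by_cases hd : σ.IsDigonAt k
      · exact hd.hasSpoke
      · exact h1.tag_eq_tag hd ▸ h1
    exact ⟨_, _, isPosition_one.2 ⟨rfl, h2⟩, by omega, by omega⟩

theorem Turn.not_incident {k : ℤ} {l l' : ℕ} {f : AnyArrow σ}
    (h : Turn σ k l (k + 1) l' (k - 1 + 2 * n) f) : ¬ ∃ a ∈ σ.arcs, a.IncidentTo (k : ZMod n) := by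
  intro hi
  obtain ⟨m, w, h1, h2, h3⟩ := exists_isPosition_of_incident hi
  have := h.not_between h1 h2
  omega

variable (K) in
/-- The rotation from the side ending at `P_k` to the side starting there: it is the external arrow
or, if `P_k` is not incident to any tagged arc, the complement of the arrow from the second of these
sides to the first one. -/
def IsEps (σ : TaggedTriangulation n) (k : ℤ) (g : σ.Gamma K) : Prop :=
  (∃ h : ∃ a ∈ σ.arcs, a.IncidentTo (k : ZMod n),
    g = AnyArrow.elt K (.external (k : ZMod n) h)) ∨
  ∃ f, Turn σ k 0 (k + 1) 2 (k - 1 + 2 * n) f ∧ g = f.compl K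

theorem IsEps.eq {k : ℤ} {g g' : σ.Gamma K} (h : IsEps K σ k g) (h' : IsEps K σ k g') :
    g = g' := by
  rcases h with ⟨h, rfl⟩ | ⟨f, h, rfl⟩ <;> rcases h' with ⟨h', rfl⟩ | ⟨f', h', rfl⟩
  · rfl
  · exact absurd h h'.not_incident
  · exact absurd h' h.not_incident
  · rw [h.arrow_eq h']

variable (K σ) in
theorem exists_isEps (k : ℤ) : ∃ g, IsEps K σ k g := by
  by_cases hi : ∃ a ∈ σ.arcs, a.IncidentTo (k : ZMod n)
  · exact ⟨_, Or.inl ⟨hi, rfl⟩⟩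
  · have hn := two_le_cast (n := n)
    obtain ⟨l', v', f, hf⟩ := (isPosition_sideFrom (σ := σ) k).exists_turn (by omega)
    have hf' : Turn σ k 0 (k + 1) l' v' (Arrow.any f.total.hom) := by
      rwa [AnyArrow.any_total]
    have hl : f.total.left ∈ σ.frozen := by
      by_contra h
      exact hi (hf'.exists_incident (Or.inl h))
    have hr : f.total.right ∈ σ.frozen := by
      by_contra h
      exact hi (hf'.exists_incident (Or.inr h))
    obtain ⟨-, -, rfl, rfl⟩ := hf.spanning_of_frozen hl hr
    exact ⟨_, Or.inr ⟨f, hf, rfl⟩⟩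

theorem idem_mul_elt (f : AnyArrow σ) : idem K f.total.left * f.elt K = f.elt K :=
  idem_mul_pathElt _

theorem elt_mul_idem (f : AnyArrow σ) : f.elt K * idem K f.total.right = f.elt K :=
  pathElt_mul_idem _

theorem IsEps.idem_mul {k : ℤ} {g : σ.Gamma K} (h : IsEps K σ k g) :
    idem K (σ.sideTo (k : ZMod n)) * g = g := by
  rcases h with ⟨h, rfl⟩ | ⟨f, h, rfl⟩
  · exact idem_mul_elt _
  · rw [← Subtype.ext (h.edgeAt_right.trans (edgeAt_sideTo k).symm), AnyArrow.idem_mul_compl]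

theorem IsEps.mul_idem {k : ℤ} {g : σ.Gamma K} (h : IsEps K σ k g) :
    g * idem K (σ.sideFrom (k : ZMod n)) = g := by
  rcases h with ⟨h, rfl⟩ | ⟨f, h, rfl⟩
  · exact elt_mul_idem _
  · rw [← Subtype.ext (h.edgeAt_left.trans (edgeAt_sideFrom k).symm), AnyArrow.compl_mul_idem]

theorem FanPath.pathElt_eq_idem {k v v' : ℤ} {l l' : ℕ} {a b : σ.Vertex} {p : Quiver.Path a b}
    (h : FanPath σ k l v l' v' p) (hv : v' ≤ v) : pathElt K p = idem K a := by
  cases h with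
  | nil h ha => rfl
  | cons hp hf => have := hp.le; have := hf.lt; omega

/-- The complement of an arrow turning around `P_k` in a triangle is also its complement in the
external cycle at `P_k`. -/
theorem Turn.compl_eq {k v v' : ℤ} {l l' : ℕ} {f : AnyArrow σ} (h : Turn σ k l v l' v' f)
    {g : σ.Gamma K} (hg : IsEps K σ k g)
    {u : Quiver.Path (σ.sideFrom (k : ZMod n)) f.total.left} (hu : FanPath σ k 0 (k + 1) l v u)
    {w : Quiver.Path f.total.right (σ.sideTo (k : ZMod n))}
    (hw : FanPath σ k l' v' 2 (k - 1 + 2 * n) w) :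
    f.compl K = pathElt K w * (g * pathElt K u) := by
  have h' : Turn σ k l v l' v' (Arrow.any f.total.hom) := by rwa [AnyArrow.any_total]
  rcases hg with ⟨hi, rfl⟩ | ⟨f', hf', rfl⟩
  · have hnf : f.total.left ∉ σ.frozen ∨ f.total.right ∉ σ.frozen := by
      by_contra! hne
      obtain ⟨rfl, rfl, rfl, rfl⟩ := h.spanning_of_frozen hne.1 hne.2
      exact h.not_incident hi
    have hrel := jacobianMk_cyclicDerivative (K := K) f.total.hom hnf
    rw [cyclicDerivative_potential_turn h' hi hu hw, map_sub, sub_eq_zero,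
      AnyArrow.any_total] at hrel
    rw [AnyArrow.compl, hrel]
    change pathElt K _ = _
    rw [pathElt_comp, pathElt_comp]
    rfl
  · have h1 := hu.le
    have h2 := hw.le
    have h3 := h.lt
    have h4 := hf'.not_between h.isPosition_right (by omega)
    obtain rfl : v = k + 1 := by
      by_contra hne
      have := hf'.not_between h.isPosition_left (by omega)
      omega
    obtain ⟨rfl, rfl, rfl, rfl⟩ := h.unique_right hf'
    have hl : f.total.left = σ.sideFrom (k : ZMod n) :=
      Subtype.ext (h.edgeAt_left.trans (edgeAt_sideFrom k).symm)
    rw [hu.pathElt_eq_idem le_rfl, ← hl, hw.pathElt_eq_idem le_rfl, AnyArrow.compl_mul_idem,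
      AnyArrow.idem_mul_compl]

theorem PuncturedTriangle.Lifts.compl_punctO {T : σ.PuncturedTriangle} {i j : ℤ}
    (hT : T.Lifts i j) {q : Quiver.Path T.snd T.fst} (hq : PunctPath σ j (i + n) q) :
    AnyArrow.compl K (.punctO T) = pathElt K q := by
  have hrel := jacobianMk_cyclicDerivative (K := K) (a := T.fst) (b := T.snd) (Arrow.punctO T)
    (Or.inl id)
  rwa [cyclicDerivative_potential_punctO hT hq, map_sub, sub_eq_zero] at hrel

variable (K) in
theorem Digon.compl_digonIn (D : σ.Digon) : AnyArrow.compl K (.digonIn D .notched) = 0 := by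
  have hrel := jacobianMk_cyclicDerivative (K := K) (a := D.sideFrom) (b := D.spoke .notched)
    (Arrow.digonIn D .notched) (Or.inr id)
  rwa [cyclicDerivative_potential_digonIn] at hrel

variable (K) in
theorem Digon.compl_digonOut (D : σ.Digon) : AnyArrow.compl K (.digonOut D .notched) = 0 := by
  have hrel := jacobianMk_cyclicDerivative (K := K) (a := D.spoke .notched) (b := D.sideTo)
    (Arrow.digonOut D .notched) (Or.inl id)
  rwa [cyclicDerivative_potential_digonOut] at hrel

end Relations

/-! ### Products of rotations -/

section Steps

/-- The product order on positions. -/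
instance : LE Position := ⟨fun x y => x.level ≤ y.level ∧ x.fst ≤ y.fst ∧ x.snd ≤ y.snd⟩

theorem Position.le_def {x y : Position} :
    x ≤ y ↔ x.level ≤ y.level ∧ x.fst ≤ y.fst ∧ x.snd ≤ y.snd := Iff.rfl

theorem Position.le_refl (x : Position) : x ≤ x := ⟨le_rfl, le_rfl, le_rfl⟩

theorem Position.le_trans {x y z : Position} (h : x ≤ y) (h' : y ≤ z) : x ≤ z :=
  ⟨h.1.trans h'.1, h.2.1.trans h'.2.1, h.2.2.trans h'.2.2⟩

/-- The degree of a position. -/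
def Position.deg (x : Position) : ℤ := x.fst + x.snd

variable (K : Type*) [Field K] {n : ℕ} [NeZero n] [Fact (2 ≤ n)]

/-- `Step K σ x y g` means that `g` is an elementary rotation from the position `x` to the
position `y`: it is given by an arrow around one of the endpoints of `x`, by the rotation between the
sides of the polygon at a vertex, by an arrow around the puncture or, for a digon with vertices `P_k`
and `P_s`, by the path around the puncture through the plain arc ending at `P_k`. -/
inductive Step (σ : TaggedTriangulation n) : Position → Position → σ.Gamma K → Prop
  | turn {l l' : ℕ} {k v v' : ℤ} {f : AnyArrow σ} (h : Turn σ k l v l' v' f) :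
      Step σ ⟨l, k, v⟩ ⟨l', k, v'⟩ (f.elt K)
  | turnSnd {k v v' u u' : ℤ} {f : AnyArrow σ} (h : Turn σ k 2 v 2 v' f) (hu : v = u + 2 * n)
      (hu' : v' = u' + 2 * n) : Step σ ⟨0, u, k⟩ ⟨0, u', k⟩ (f.elt K)
  | turnFlip {k v v' w : ℤ} {f : AnyArrow σ} (h : Turn σ k 0 v 0 v' f) (hw : w = k + 2 * n) :
      Step σ ⟨2, v, w⟩ ⟨2, v', w⟩ (f.elt K)
  | eps {k u v : ℤ} {g : σ.Gamma K} (h : IsEps K σ k g) (hu : u + 1 = k) (hv : v = k + 1) :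
      Step σ ⟨0, u, k⟩ ⟨0, k, v⟩ g
  | epsFlip {k u v w : ℤ} {g : σ.Gamma K} (h : IsEps K σ k g) (hu : u = k - 1 + 2 * n)
      (hv : v = k + 1) (hw : w = k + 2 * n) : Step σ ⟨2, k, u⟩ ⟨2, v, w⟩ g
  | punctO {T : σ.PuncturedTriangle} {r s u v : ℤ} (h : T.Lifts r s) (hu : u = r + n)
      (hv : v = s + n) : Step σ ⟨1, r, u⟩ ⟨1, s, v⟩ (AnyArrow.elt K (.punctO T))
  | loop {D : σ.Digon} {k s u v w : ℤ} (h : D.Lifts k s) (hu : u = k + n) (hv : v = k + n)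
      (hw : w = k + 2 * n) : Step σ ⟨1, k, u⟩ ⟨1, v, w⟩
        (AnyArrow.elt K (.digonOut D .plain) * AnyArrow.elt K (.digonBase D) *
          AnyArrow.elt K (.digonIn D .plain))

/-- `Steps K σ x y g` means that `g` is a product of elementary rotations from the position `x` to
the position `y`. -/
inductive Steps (σ : TaggedTriangulation n) : Position → Position → σ.Gamma K → Prop
  | refl {x : Position} {a : σ.Vertex} (hx : σ.IsPosition x) (ha : a.1 = σ.edgeAt x) :
      Steps σ x x (idem K a)
  | head {x y z : Position} {g h : σ.Gamma K} (hg : Step K σ x y g) (hh : Steps σ y z h) :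
      Steps σ x z (g * h)

variable {K} {σ : TaggedTriangulation n} {x y z : Position} {g h : σ.Gamma K}

namespace Step

theorem isPosition_left (hg : Step K σ x y g) : σ.IsPosition x := by
  cases hg with
  | turn h => exact h.isPosition_left
  | turnSnd h hu hu' =>
    subst hu
    exact isPosition_zero.2 (isPosition_two'.1 h.isPosition_left)
  | turnFlip h hw =>
    subst hw
    exact isPosition_two'.2 (isPosition_zero.1 h.isPosition_left)
  | eps h hu hv => exact isPosition_zero.2 (hasChord_side' hu.symm)
  | epsFlip h hu hv hw => subst hu; exact isPosition_sideTo _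
  | punctO h hu hv => exact isPosition_one.2 ⟨hu, h.fst⟩
  | loop h hu hv hw => exact isPosition_one.2 ⟨hu, h.isDigonAt.hasSpoke⟩

theorem isPosition_right (hg : Step K σ x y g) : σ.IsPosition y := by
  cases hg with
  | turn h => exact h.isPosition_right
  | turnSnd h hu hu' =>
    subst hu'
    exact isPosition_zero.2 (isPosition_two'.1 h.isPosition_right)
  | turnFlip h hw =>
    subst hw
    exact isPosition_two'.2 (isPosition_zero.1 h.isPosition_right)
  | eps h hu hv => exact isPosition_zero.2 (hasChord_side' hv)
  | epsFlip h hu hv hw => subst hw; exact isPosition_two'.2 (hasChord_side' hv)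
  | punctO h hu hv => exact isPosition_one.2 ⟨hv, h.snd⟩
  | loop h hu hv hw =>
    subst hv
    exact isPosition_one.2 ⟨by omega, h.isDigonAt.hasSpoke.add⟩

theorem le (hg : Step K σ x y g) : x ≤ y := by
  have hn := two_le_cast (n := n)
  rw [Position.le_def]
  cases hg with
  | turn h => have := h.lt; have := h.level_le; simp only; omega
  | turnSnd h hu hu' => have := h.lt; simp only; omega
  | turnFlip h hw => have := h.lt; simp only; omega
  | eps h hu hv => simp only; omega
  | epsFlip h hu hv hw => simp only; omega
  | punctO h hu hv => have := h.rs.lt; simp only; omega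
  | loop h hu hv hw => simp only; omega

theorem deg_lt (hg : Step K σ x y g) : x.deg < y.deg := by
  have hn := two_le_cast (n := n)
  unfold Position.deg
  cases hg with
  | turn h => have := h.lt; simp only; omega
  | turnSnd h hu hu' => have := h.lt; simp only; omega
  | turnFlip h hw => have := h.lt; simp only; omega
  | eps h hu hv => simp only; omega
  | epsFlip h hu hv hw => simp only; omega
  | punctO h hu hv => have := h.rs.lt; simp only; omega
  | loop h hu hv hw => simp only; omega

theorem idem_mul (hg : Step K σ x y g) {a : σ.Vertex} (ha : a.1 = σ.edgeAt x) :
    idem K a * g = g := by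
  have key : ∀ f : AnyArrow σ, f.total.left.1 = σ.edgeAt x → idem K a * f.elt K = f.elt K := by
    intro f hf
    obtain rfl : f.total.left = a := Subtype.ext (hf.trans ha.symm)
    exact idem_mul_elt f
  cases hg with
  | turn h => exact key _ h.edgeAt_left
  | turnSnd h hu hu' =>
    refine key _ (h.edgeAt_left.trans ?_)
    simp [edgeAt, hu]
  | turnFlip h hw =>
    refine key _ (h.edgeAt_left.trans ?_)
    simp [edgeAt, hw]
  | @eps k u v g h hu hv =>
    obtain rfl : σ.sideTo (k : ZMod n) = a := by
      refine Subtype.ext ?_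
      rw [ha]
      subst hu
      simp [sideTo, edgeAt]
    exact h.idem_mul
  | @epsFlip k u v w g h hu hv hw =>
    obtain rfl : σ.sideTo (k : ZMod n) = a := by
      refine Subtype.ext ?_
      rw [ha, hu, edgeAt_sideTo]
    exact h.idem_mul
  | punctO h hu hv => exact key _ (h.left_eq (f := Arrow.punctO _) rfl)
  | loop h hu hv hw =>
    rw [← mul_assoc, ← mul_assoc, key]
    simp [edgeAt, AnyArrow.total, Digon.spoke, h.cast_k, h.isDigonAt.tag_eq_plain]

theorem mul_idem (hg : Step K σ x y g) {a : σ.Vertex} (ha : a.1 = σ.edgeAt y) :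
    g * idem K a = g := by
  have key : ∀ f : AnyArrow σ, f.total.right.1 = σ.edgeAt y → f.elt K * idem K a = f.elt K := by
    intro f hf
    obtain rfl : f.total.right = a := Subtype.ext (hf.trans ha.symm)
    exact elt_mul_idem f
  cases hg with
  | turn h => exact key _ h.edgeAt_right
  | turnSnd h hu hu' =>
    refine key _ (h.edgeAt_right.trans ?_)
    simp [edgeAt, hu']
  | turnFlip h hw =>
    refine key _ (h.edgeAt_right.trans ?_)
    simp [edgeAt, hw]
  | @eps k u v g h hu hv =>
    obtain rfl : σ.sideFrom (k : ZMod n) = a := by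
      refine Subtype.ext ?_
      rw [ha]
      subst hv
      simp [sideFrom, edgeAt]
    exact h.mul_idem
  | @epsFlip k u v w g h hu hv hw =>
    obtain rfl : σ.sideFrom (k : ZMod n) = a := by
      refine Subtype.ext ?_
      rw [ha, hv, hw]
      simp [sideFrom, edgeAt]
    exact h.mul_idem
  | punctO h hu hv => exact key _ (h.right_eq (f := Arrow.punctO _) rfl)
  | loop h hu hv hw =>
    rw [mul_assoc, key]
    simp [edgeAt, AnyArrow.total, Digon.spoke, h.cast_k, h.isDigonAt.tag_eq_plain, hv]

end Step

theorem IsPosition.exists_vertex (hx : σ.IsPosition x) : ∃ a : σ.Vertex, a.1 = σ.edgeAt x :=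
  ⟨⟨_, hx.edgeAt_mem⟩, rfl⟩

namespace Steps

theorem isPosition_left (hg : Steps K σ x y g) : σ.IsPosition x := by
  cases hg with
  | refl hx ha => exact hx
  | head hg hh => exact hg.isPosition_left

theorem isPosition_right (hg : Steps K σ x y g) : σ.IsPosition y := by
  induction hg with
  | refl hx ha => exact hx
  | head hg hh ih => exact ih

theorem le (hg : Steps K σ x y g) : x ≤ y := by
  induction hg with
  | refl hx ha => exact Position.le_refl _
  | head hg hh ih => exact Position.le_trans hg.le ih

theorem deg_le (hg : Steps K σ x y g) : x.deg ≤ y.deg := by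
  have h := hg.le
  have h1 := h.2.1
  have h2 := h.2.2
  unfold Position.deg
  omega

theorem idem_mul (hg : Steps K σ x y g) {a : σ.Vertex} (ha : a.1 = σ.edgeAt x) :
    idem K a * g = g := by
  cases hg with
  | @refl _ b hx hb =>
    obtain rfl : b = a := Subtype.ext (hb.trans ha.symm)
    exact idem_mul_pathElt _
  | head hg hh => rw [← mul_assoc, hg.idem_mul ha]

theorem mul_idem (hg : Steps K σ x y g) {a : σ.Vertex} (ha : a.1 = σ.edgeAt y) :
    g * idem K a = g := by
  induction hg with
  | @refl _ b hx hb =>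
    obtain rfl : b = a := Subtype.ext (hb.trans ha.symm)
    exact idem_mul_pathElt _
  | head hg hh ih => rw [mul_assoc, ih ha]

theorem trans (hg : Steps K σ x y g) (hh : Steps K σ y z h) : Steps K σ x z (g * h) := by
  induction hg with
  | refl hx ha => rwa [hh.idem_mul ha]
  | head hg hh' ih => rw [mul_assoc]; exact .head hg (ih hh)

theorem single (hg : Step K σ x y g) : Steps K σ x y g := by
  obtain ⟨a, ha⟩ := hg.isPosition_right.exists_vertex
  rw [← hg.mul_idem ha]
  exact .head hg (.refl hg.isPosition_right ha)

theorem of_eq {x' y' : Position} (hg : Steps K σ x y g) (hx : x = x') (hy : y = y') :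
    Steps K σ x' y' g := hx ▸ hy ▸ hg

end Steps

theorem FanPath.steps {k v v' : ℤ} {l l' : ℕ} {a b : σ.Vertex} {p : Quiver.Path a b}
    (h : FanPath σ k l v l' v' p) : Steps K σ ⟨l, k, v⟩ ⟨l', k, v'⟩ (pathElt K p) := by
  induction h with
  | nil h ha => exact .refl h ha
  | @cons l' l'' v' v'' a b c p f hp hf ih =>
    rw [show p.cons f = p.comp f.toPath from rfl, pathElt_comp, pathElt_toPath]
    exact ih.trans (.single (.turn hf))

theorem FanPath.steps_snd {k v v' : ℤ} {l l' : ℕ} {a b : σ.Vertex} {p : Quiver.Path a b}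
    (h : FanPath σ k l v l' v' p) (hl : l = 2) :
    Steps K σ ⟨0, v - 2 * n, k⟩ ⟨0, v' - 2 * n, k⟩ (pathElt K p) := by
  induction h with
  | nil h ha =>
    subst hl
    refine .refl (isPosition_zero.2 (isPosition_two.1 h)) (ha.trans ?_)
    simp [edgeAt]
  | @cons l' l'' v' v'' a b c p f hp hf ih =>
    rw [show p.cons f = p.comp f.toPath from rfl, pathElt_comp, pathElt_toPath]
    have h1 := hp.level_le
    have h2 := hf.level_le
    have h3 : l'' ≤ 2 := hf.isPosition_right.bounds.1
    obtain rfl : l' = 2 := by omega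
    obtain rfl : l'' = 2 := by omega
    exact ih.trans (.single (.turnSnd hf (by ring) (by ring)))

theorem FanPath.steps_flip {k v v' w : ℤ} {l l' : ℕ} {a b : σ.Vertex} {p : Quiver.Path a b}
    (h : FanPath σ k l v l' v' p) (hl : l' = 0) (hw : w = k + 2 * n) :
    Steps K σ ⟨2, v, w⟩ ⟨2, v', w⟩ (pathElt K p) := by
  subst hw
  induction h with
  | nil h ha =>
    subst hl
    refine .refl (isPosition_two'.2 (isPosition_zero.1 h)) (ha.trans ?_)
    simp [edgeAt]
  | @cons l' l'' v' v'' a b c p f hp hf ih =>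
    rw [show p.cons f = p.comp f.toPath from rfl, pathElt_comp, pathElt_toPath]
    have h1 := hp.level_le
    have h2 := hf.level_le
    obtain rfl : l' = 0 := by omega
    subst hl
    exact (ih rfl).trans (.single (.turnFlip hf rfl))

/-! #### Complements as products of rotations -/

theorem Turn.any {k v v' : ℤ} {l l' : ℕ} {f : AnyArrow σ} (h : Turn σ k l v l' v' f) :
    Turn σ k l v l' v' (Arrow.any f.total.hom) := by rwa [AnyArrow.any_total]

theorem AnyArrow.exists_hom (f : AnyArrow σ) {a : σ.Vertex} (h : f.total.left = a) :
    ∃ (c : σ.Vertex) (g : a ⟶ c), Arrow.any g = f := by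
  subst h
  exact ⟨_, f.total.hom, f.any_total⟩

section Complement

variable {k v v' w w' : ℤ} {l l' m : ℕ} {f f' : AnyArrow σ}

/-- The complement of an arrow ending at level `2` begins with a rotation around the same vertex, at
the other end of the position. -/
theorem Turn.compl_eq_turnSnd (hf : Turn σ k l v 2 v' f) (hf' : Turn σ k 2 v' 2 w f')
    (hw : w = w' + 2 * n) :
    ∃ h : σ.Gamma K, Steps K σ ⟨0, w', k⟩ ⟨l, k, v⟩ h ∧ f.compl K = f'.elt K * h := by
  obtain ⟨g, hg⟩ := exists_isEps K σ k
  obtain ⟨u, hu⟩ := hf.any.exists_before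
  obtain ⟨c, f', rfl⟩ := f'.exists_hom (Subtype.ext (hf'.edgeAt_left.trans hf.edgeAt_right.symm))
  obtain ⟨p, hp⟩ := hf'.exists_after
  refine ⟨pathElt K p * (g * pathElt K u), ?_, ?_⟩
  · refine ((hp.steps_snd rfl).trans (.head (.eps hg ?_ rfl) hu.steps)).of_eq ?_ rfl
    · ring
    · simp [hw]
  · rw [hf.compl_eq hg hu ((FanPath.toPath hf').trans hp), pathElt_comp, mul_assoc,
      pathElt_toPath]

/-- The preceding statement for an arrow ending at a side of the polygon. -/
theorem Turn.compl_eq_eps {g : σ.Gamma K} (hf : Turn σ k l v 2 v' f) (hv' : v' = k - 1 + 2 * n)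
    (hg : IsEps K σ k g) :
    ∃ h : σ.Gamma K, Steps K σ ⟨0, k, k + 1⟩ ⟨l, k, v⟩ h ∧ f.compl K = g * h := by
  subst hv'
  obtain ⟨u, hu⟩ := hf.any.exists_before
  obtain ⟨p, hp⟩ := hf.any.exists_after
  refine ⟨pathElt K u, hu.steps, ?_⟩
  rw [hf.compl_eq hg hu hp, hp.pathElt_eq_idem le_rfl,
    Subtype.ext (hf.edgeAt_right.trans (edgeAt_sideTo k).symm), ← mul_assoc, hg.idem_mul]

/-- The complement of an arrow starting at level `0` ends with a rotation around the same vertex, at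
the other end of the position. -/
theorem Turn.compl_eq_turn (hf : Turn σ k 0 v l' v' f) (hf' : Turn σ k l' v' m w f')
    (hw : w' = k + 2 * n) :
    ∃ h : σ.Gamma K, Steps K σ ⟨m, k, w⟩ ⟨2, v, w'⟩ h ∧ f.compl K = f'.elt K * h := by
  subst hw
  obtain ⟨g, hg⟩ := exists_isEps K σ k
  obtain ⟨u, hu⟩ := hf.any.exists_before
  obtain ⟨c, f', rfl⟩ := f'.exists_hom (Subtype.ext (hf'.edgeAt_left.trans hf.edgeAt_right.symm))
  obtain ⟨p, hp⟩ := hf'.exists_after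
  refine ⟨pathElt K p * (g * pathElt K u), ?_, ?_⟩
  · exact hp.steps.trans (.head (.epsFlip hg rfl rfl rfl) (hu.steps_flip rfl rfl))
  · rw [hf.compl_eq hg hu ((FanPath.toPath hf').trans hp), pathElt_comp, mul_assoc,
      pathElt_toPath]

/-- The preceding statement for an arrow ending at a side of the polygon. -/
theorem Turn.compl_eq_epsFlip {g : σ.Gamma K} (hf : Turn σ k 0 v 2 v' f)
    (hv' : v' = k - 1 + 2 * n) (hg : IsEps K σ k g) (hw : w' = k + 2 * n) :
    ∃ h : σ.Gamma K, Steps K σ ⟨2, k + 1, w'⟩ ⟨2, v, w'⟩ h ∧ f.compl K = g * h := by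
  subst hv'
  obtain ⟨u, hu⟩ := hf.any.exists_before
  obtain ⟨p, hp⟩ := hf.any.exists_after
  refine ⟨pathElt K u, hu.steps_flip rfl hw, ?_⟩
  rw [hf.compl_eq hg hu hp, hp.pathElt_eq_idem le_rfl,
    Subtype.ext (hf.edgeAt_right.trans (edgeAt_sideTo k).symm), ← mul_assoc, hg.idem_mul]

/-- The complement of an arrow ending at level `2` is itself a product of rotations, as it runs through
the rest of the external cycle. -/
theorem Turn.steps_compl (hf : Turn σ k l v 2 v' f) (hw : v' = w + 2 * n) :
    Steps K σ ⟨0, w, k⟩ ⟨l, k, v⟩ (f.compl K) := by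
  obtain ⟨g, hg⟩ := exists_isEps K σ k
  obtain ⟨u, hu⟩ := hf.any.exists_before
  obtain ⟨p, hp⟩ := hf.any.exists_after
  rw [hf.compl_eq hg hu hp]
  refine ((hp.steps_snd rfl).trans (.head (.eps hg ?_ rfl) hu.steps)).of_eq ?_ rfl
  · ring
  · simp [hw]

/-- The complement of an arrow starting at level `0` is itself a product of rotations. -/
theorem Turn.steps_compl_flip (hf : Turn σ k 0 v l' v' f) (hw : w = k + 2 * n) :
    Steps K σ ⟨l', k, v'⟩ ⟨2, v, w⟩ (f.compl K) := by
  subst hw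
  obtain ⟨g, hg⟩ := exists_isEps K σ k
  obtain ⟨u, hu⟩ := hf.any.exists_before
  obtain ⟨p, hp⟩ := hf.any.exists_after
  rw [hf.compl_eq hg hu hp]
  exact hp.steps.trans (.head (.epsFlip hg rfl rfl rfl) (hu.steps_flip rfl rfl))

end Complement

end Steps

/-! ### Existence of products of rotations -/

section Existence

variable {K : Type*} [Field K] {n : ℕ} [NeZero n] [Fact (2 ≤ n)] {σ : TaggedTriangulation n}
  {x z : Position}

theorem Turn.level_two {k v v' : ℤ} {l' : ℕ} {f : AnyArrow σ} (h : Turn σ k 2 v l' v' f) :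
    l' = 2 := by
  have h1 := h.level_le
  have h2 : l' ≤ 2 := h.isPosition_right.bounds.1
  omega

variable (K) in
/-- A position can be rotated without leaving the set of positions below a given larger one. -/
theorem IsPosition.exists_step (hx : σ.IsPosition x) (hz : σ.IsPosition z) (hxz : x ≤ z)
    (hne : x ≠ z) : ∃ y g, Step K σ x y g ∧ y ≤ z := by
  have hn := two_le_cast (n := n)
  have bx := hx.bounds
  have bz := hz.bounds
  obtain ⟨l, u, v⟩ := x
  obtain ⟨m, z₁, z₂⟩ := z
  simp only [Position.le_def] at hxz ⊢
  simp only at bx bz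
  obtain ⟨hlm, hu, hv⟩ := hxz
  -- rotations around the first endpoint of `x`, if it is also the first endpoint of `z`
  rcases hu.eq_or_lt with rfl | hu
  · have hlt : v < z₂ := by
      refine lt_of_le_of_ne hv fun h => hne ?_
      subst h
      rw [hx.level_eq hz]
    obtain ⟨l', v', f, hf⟩ := hx.exists_turn (by omega)
    have h1 := hf.not_between hz hlt
    have h2 := hf.isPosition_right.bounds
    simp only at h2
    exact ⟨_, _, .turn hf, by simp only; omega⟩
  have hl : l = 0 ∨ l = 1 ∨ l = 2 := by omega
  rcases hl with rfl | rfl | rfl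
  -- a chord before the puncture: if it is not a side, let `c` be the vertex of the triangle on its far
  -- side; a rotation around the second endpoint is possible unless `z` starts before `c`
  · have huv := isPosition_zero.1 hx
    rcases eq_or_ne (u + 1) v with rfl | huv1
    · obtain ⟨g, hg⟩ := exists_isEps K σ (u + 1)
      exact ⟨_, _, .eps hg rfl rfl, by simp only; omega⟩
    · obtain ⟨l', v', f, hf⟩ := (isPosition_two'.2 huv).exists_turn (by omega)
      obtain rfl := hf.level_two
      cases hf with
      | @outerK T i c k _ _ h hi hc =>
        obtain rfl : i = u := by omega
        have h3 := h.ij.lt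
        have h4 := h.jk.lt
        by_cases hc : c ≤ z₁
        · exact ⟨_, _, .turnSnd (.outerK h hi rfl) hi rfl, by simp only; omega⟩
        · push Not at hc
          rcases hz with ⟨hm, hz⟩ | ⟨hm, -, hz⟩ | ⟨hm, hz⟩ <;> dsimp only at hm hz <;> subst hm
          · have := h.ij.not_cross hz hu hc
            omega
          · have := h.ij.not_cross_spoke hz hu
            omega
          · obtain ⟨l', v', f, hf⟩ := hx.exists_turn (by omega)
            have h5 := hf.isPosition_right.bounds
            simp only at h5
            refine ⟨_, _, .turn hf, ?_⟩
            have := fun hi => hz.not_cross h.ij hi hu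
            simp only
            omega
  -- an arc to the puncture: rotate around the puncture if `z` is such an arc as well, and otherwise
  -- around the endpoint on the polygon
  · rcases hz with ⟨hm, hz⟩ | ⟨hm, hm', hz⟩ | ⟨hm, hz⟩ <;> dsimp only at hm hz <;> subst hm
    · omega
    · dsimp only at hm'
      have hu1 := (isPosition_one.1 hx).2
      by_cases hd : ∃ k, σ.IsDigonAt k
      · obtain ⟨k, hk⟩ := hd
        have hku := hk.cast_eq hu1
        obtain ⟨a, rfl⟩ := exists_add_mul_of_cast_eq hku
        replace hk := hk.shift a
        generalize k + a * n = u at *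
        obtain ⟨s, hs, hs'⟩ := hk.exists_sides
        obtain ⟨D, hD⟩ := hs.exists_digon hk hs'
        refine ⟨_, _, .loop hD (by omega) rfl rfl, ?_⟩
        have h1 := hk.cast_eq hz
        have : u + n ≤ z₁ := by
          by_contra hlt
          have := eq_of_cast_eq h1 (by omega) (by omega)
          omega
        simp only
        omega
      · push Not at hd
        obtain ⟨s, hs, hs'⟩ := hu1.exists_next hd
        obtain ⟨T, hT⟩ := hs.exists_puncturedTriangle hd hu1 hs'
        have := hs.not_cross_spoke hz hu
        exact ⟨_, _, .punctO hT (by omega) rfl, by simp only; omega⟩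
    · obtain ⟨l', v', f, hf⟩ := hx.exists_turn (by omega)
      have h5 := hf.isPosition_right.bounds
      simp only at h5
      refine ⟨_, _, .turn hf, ?_⟩
      have hlt := hz.lt
      have hlt' := hz.lt_add
      cases hf with
      | punctS h hv hv' =>
        have := hz.not_cross_spoke h.fst
        have := h.rs.lt
        simp only
        omega
      | digonOut h hv hv' =>
        have := h.ks.sub.not_cross hz
        have := h.sk.lt
        simp only
        omega
  -- a chord behind the puncture
  · obtain rfl : m = 2 := by omega
    replace hz := isPosition_two.1 hz
    rcases hv.eq_or_lt with rfl | hv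
    · have hx' := isPosition_two.1 hx
      obtain ⟨l', v', f, hf⟩ := (isPosition_zero.2 hx').exists_turn (by omega)
      have h1 := hf.not_between (isPosition_zero.2 hz) hu
      have h2 := hf.isPosition_right.bounds
      have h3 := hz.lt_add
      simp only at h2
      obtain rfl : l' = 0 := by omega
      exact ⟨_, _, .turnFlip hf (by ring), by simp only; omega⟩
    · rcases eq_or_ne v (u - 1 + 2 * n) with rfl | hv1
      · obtain ⟨g, hg⟩ := exists_isEps K σ u
        exact ⟨_, _, .epsFlip hg rfl rfl rfl, by simp only; omega⟩
      · obtain ⟨l', v', f, hf⟩ := hx.exists_turn (by omega)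
        obtain rfl := hf.level_two
        refine ⟨_, _, .turn hf, ?_⟩
        cases hf with
        | @outerK T i c k _ _ h hi hc =>
          have := h.ij.not_cross hz
          have := h.ij.lt
          have := h.jk.lt
          simp only
          omega

variable (K) in
/-- There is a product of rotations between any two comparable positions. -/
theorem IsPosition.exists_steps (hx : σ.IsPosition x) (hz : σ.IsPosition z) (hxz : x ≤ z) :
    ∃ g, Steps K σ x z g := by
  induction hd : (z.deg - x.deg).toNat using Nat.strong_induction_on generalizing x with
  | _ d ih =>
    by_cases hne : x = z
    · subst hne
      obtain ⟨a, ha⟩ := hx.exists_vertex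
      exact ⟨_, .refl hx ha⟩
    · obtain ⟨y, g, hg, hyz⟩ := hx.exists_step K hz hxz hne
      have h1 := hg.deg_lt
      have h2 : y.deg ≤ z.deg := add_le_add hyz.2.1 hyz.2.2
      obtain ⟨h, hh⟩ := ih _ (by omega) hg.isPosition_right hyz rfl
      exact ⟨_, .head hg hh⟩

end Existence

/-! ### Uniqueness of products of rotations -/

section Uniqueness

variable {K : Type*} [Field K] {n : ℕ} [NeZero n] {σ : TaggedTriangulation n}

theorem pathElt_cons_cons {a b c : σ.Vertex} (f : a ⟶ b) (g : b ⟶ c) :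
    pathElt K ((Quiver.Path.nil.cons f).cons g) =
      AnyArrow.elt K (Arrow.any f) * AnyArrow.elt K (Arrow.any g) := by
  rw [← pathElt_toPath, ← pathElt_toPath, ← pathElt_comp]
  rfl

namespace AnyArrow

variable (K)

theorem compl_outerI (T : σ.OuterTriangle) :
    compl K (.outerI T) = elt K (.outerK T) * elt K (.outerJ T) := pathElt_cons_cons _ _

theorem compl_outerK (T : σ.OuterTriangle) :
    compl K (.outerK T) = elt K (.outerJ T) * elt K (.outerI T) := pathElt_cons_cons _ _

theorem compl_outerJ (T : σ.OuterTriangle) :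
    compl K (.outerJ T) = elt K (.outerI T) * elt K (.outerK T) := pathElt_cons_cons _ _

theorem compl_punctR (T : σ.PuncturedTriangle) :
    compl K (.punctR T) = elt K (.punctO T) * elt K (.punctS T) := pathElt_cons_cons _ _

theorem compl_punctO (T : σ.PuncturedTriangle) :
    compl K (.punctO T) = elt K (.punctS T) * elt K (.punctR T) := pathElt_cons_cons _ _

theorem compl_punctS (T : σ.PuncturedTriangle) :
    compl K (.punctS T) = elt K (.punctR T) * elt K (.punctO T) := pathElt_cons_cons _ _

theorem compl_digonIn (D : σ.Digon) (t : Tag) :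
    compl K (.digonIn D t) = elt K (.digonOut D t) * elt K (.digonBase D) := pathElt_cons_cons _ _

theorem compl_digonOut (D : σ.Digon) (t : Tag) :
    compl K (.digonOut D t) = elt K (.digonBase D) * elt K (.digonIn D t) := pathElt_cons_cons _ _

theorem compl_digonBase (D : σ.Digon) :
    compl K (.digonBase D) = elt K (.digonIn D .plain) * elt K (.digonOut D .plain) +
      elt K (.digonIn D .notched) * elt K (.digonOut D .notched) := by
  rw [compl, complement, map_add]
  exact congrArg₂ _ (pathElt_cons_cons _ _) (pathElt_cons_cons _ _)

end AnyArrow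

variable [Fact (2 ≤ n)]

variable (K) in
theorem Digon.digonOut_mul_digonBase (D : σ.Digon) :
    AnyArrow.elt K (.digonOut D .notched) * AnyArrow.elt K (.digonBase D) = 0 := by
  rw [← AnyArrow.compl_digonIn, D.compl_digonIn K]

variable (K) in
theorem Digon.digonBase_mul_digonIn (D : σ.Digon) :
    AnyArrow.elt K (.digonBase D) * AnyArrow.elt K (.digonIn D .notched) = 0 := by
  rw [← AnyArrow.compl_digonOut, D.compl_digonOut K]

variable (K) in
/-- Below the position `z`, the rotations `g₁` to `y₁` and `g₂` to `y₂` can be completed to equal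
products of rotations. -/
def Joinable (σ : TaggedTriangulation n) (z y₁ : Position) (g₁ : σ.Gamma K) (y₂ : Position)
    (g₂ : σ.Gamma K) : Prop :=
  ∃ w h₁ h₂, w ≤ z ∧ Steps K σ y₁ w h₁ ∧ Steps K σ y₂ w h₂ ∧ g₁ * h₁ = g₂ * h₂

variable {z y₁ y₂ : Position} {g₁ g₂ : σ.Gamma K}

theorem Joinable.symm (h : Joinable K σ z y₁ g₁ y₂ g₂) : Joinable K σ z y₂ g₂ y₁ g₁ := by
  obtain ⟨w, h₁, h₂, hw, hs₁, hs₂, he⟩ := h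
  exact ⟨w, h₂, h₁, hw, hs₂, hs₁, he.symm⟩

theorem Joinable.refl (hy : σ.IsPosition y₁) (hyz : y₁ ≤ z) : Joinable K σ z y₁ g₁ y₁ g₁ := by
  obtain ⟨a, ha⟩ := hy.exists_vertex
  exact ⟨_, _, _, hyz, .refl hy ha, .refl hy ha, rfl⟩

/-- A rotation around the first endpoint of a position of level `0` can be joined with one around its
second endpoint `v`, below a position whose first endpoint is at least `v`. -/
theorem Turn.joinable_of_le {u v v' : ℤ} {l' : ℕ} {f : AnyArrow σ} (hf : Turn σ u 0 v l' v' f)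
    (hB : ∀ l w f, Turn σ v l w 2 (u + 2 * n) f →
      ∃ h : σ.Gamma K, Steps K σ y₂ ⟨l, v, w⟩ h ∧ f.compl K = g₂ * h)
    (hz : σ.IsPosition z) (h₁ : ⟨l', u, v'⟩ ≤ z) (hv : v ≤ z.fst) :
    Joinable K σ z ⟨l', u, v'⟩ (f.elt K) y₂ g₂ := by
  have hn := two_le_cast (n := n)
  have bz := hz.bounds
  obtain ⟨m, z₁, z₂⟩ := z
  simp only [Position.le_def] at h₁
  simp only at bz hv
  cases hf with
  | @outerI T _ _ e h =>
    obtain ⟨h₂, hs, he⟩ := hB _ _ _ (.outerJ h rfl)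
    refine ⟨_, _, h₂, ?_, .single (.turnSnd (.outerK h rfl rfl) rfl rfl), hs, ?_⟩
    · exact ⟨by simp only; omega, hv, by simp only; omega⟩
    · rw [← he, AnyArrow.compl_outerJ]
  | @outerJ T q _ _ _ h hv' =>
    subst hv'
    obtain ⟨h₂, hs, he⟩ := hB _ _ _ (.outerK h rfl rfl)
    refine ⟨_, _, h₂, ?_, .single (.turnFlip (.outerI h) rfl), hs, ?_⟩
    · exact ⟨by simp only; omega, hv, by simp only; omega⟩
    · rw [← he, AnyArrow.compl_outerK]
  | @punctR T _ _ _ h hv' =>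
    subst hv'
    obtain ⟨h₂, hs, he⟩ := hB _ _ _ (.punctS h rfl rfl)
    refine ⟨_, _, h₂, ?_, .single (.punctO h rfl rfl), hs, ?_⟩
    · exact ⟨by simp only; omega, hv, by simp only; omega⟩
    · rw [← he, AnyArrow.compl_punctS]
  | @digonIn D _ _ _ h hv' =>
    subst hv'
    obtain ⟨h₂, hs, he⟩ := hB _ _ _ (.digonBase h rfl rfl)
    have hks := h.ks.lt
    have hsk := h.ks.lt_add
    rcases hz with ⟨hm, hz⟩ | ⟨hm, hm', hz⟩ | ⟨hm, hz⟩ <;> dsimp only at hm hz <;> subst hm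
    · omega
    · dsimp only at hm'
      have h5 : u + n ≤ z₁ := by
        by_contra hlt
        have := eq_of_cast_eq (h.isDigonAt.cast_eq hz) (by omega) (by omega)
        omega
      have hD := h.shift 1
      rw [one_mul] at hD
      have hout : Turn σ (u + n) 1 (u + 2 * n) 2 (v + 2 * n) (.digonOut D .plain) :=
        .digonOut hD (by ring) (by ring)
      refine ⟨_, _, _, ?_, .single (.loop h rfl rfl rfl), hs.trans (hout.steps_compl rfl), ?_⟩
      · exact ⟨by simp only; omega, by simp only; omega, by simp only; omega⟩
      · rw [← mul_assoc g₂, ← he, AnyArrow.compl_digonBase, AnyArrow.compl_digonOut, add_mul,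
          mul_assoc (AnyArrow.elt K (.digonIn D .notched)), ← mul_assoc
          (AnyArrow.elt K (.digonOut D .notched)), D.digonOut_mul_digonBase K, zero_mul, mul_zero,
          add_zero]
        simp only [mul_assoc]
    · have h5 := fun h' => hz.not_cross_spoke h.isDigonAt.hasSpoke h'
      have hin : Turn σ u 0 v 1 (u + n) (.digonIn D .plain) := .digonIn h rfl
      refine ⟨_, _, _, ?_, hin.steps_compl_flip rfl,
        hs.trans (.single (.turn (.digonBase h rfl rfl))), ?_⟩
      · exact ⟨by simp only; omega, by simp only; omega, by simp only; omega⟩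
      · rw [← mul_assoc g₂, ← he, AnyArrow.compl_digonBase, AnyArrow.compl_digonIn, add_mul,
          mul_assoc (AnyArrow.elt K (.digonIn D .notched)), D.digonOut_mul_digonBase K, mul_zero,
          add_zero, mul_assoc]
  | @digonBase D k s _ _ h hk hv' =>
    subst hk hv'
    have hD := h.shift 1
    rw [one_mul] at hD
    have hout : Turn σ (k + n) 1 (k + 2 * n) 2 (u + 2 * n) (.digonOut D .plain) :=
      .digonOut hD (by ring) (by ring)
    have hbase : Turn σ u 0 (k + n) 2 (k + 2 * n) (.digonBase D) := .digonBase h rfl rfl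
    obtain ⟨h₂, hs, he⟩ := hB _ _ _ hout
    have hks := h.ks.lt
    have hsk := h.ks.lt_add
    obtain rfl : m = 2 := by omega
    replace hz := isPosition_two.1 hz
    refine ⟨_, _, _, ?_, hbase.steps_compl_flip rfl, hs.trans (.single (.turn hout)), ?_⟩
    · have h5 := h.ks.not_cross hz
      have h6 := hz.lt_add
      exact ⟨by simp only; omega, by simp only; omega, by simp only; omega⟩
    · rw [← mul_assoc g₂, ← he, AnyArrow.compl_digonBase, AnyArrow.compl_digonOut, mul_add,
        ← mul_assoc, ← mul_assoc, D.digonBase_mul_digonIn K, zero_mul, add_zero]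

/-- Rotations around the two endpoints of a chord before the puncture can be joined. If `z` starts before
the second endpoint `v`, it lies behind the puncture, and they are joined on the near side of the
triangle beyond the chord. -/
theorem Turn.joinable_turnSnd {u v v' w w' u' : ℤ} {l' : ℕ} {f f' : AnyArrow σ}
    (hf : Turn σ u 0 v l' v' f) (hf' : Turn σ v 2 w 2 w' f') (hw : w = u + 2 * n)
    (hw' : w' = u' + 2 * n) (hz : σ.IsPosition z) (h₁ : ⟨l', u, v'⟩ ≤ z) (h₂ : ⟨0, u', v⟩ ≤ z) :
    Joinable K σ z ⟨l', u, v'⟩ (f.elt K) ⟨0, u', v⟩ (f'.elt K) := by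
  have hn := two_le_cast (n := n)
  rcases le_or_gt v z.fst with hv | hv
  · exact hf.joinable_of_le (fun l w'' f'' hf'' => hf''.compl_eq_turnSnd (hw ▸ hf') hw') hz h₁ hv
  · have bz := hz.bounds
    have bf := hf.isPosition_right.bounds
    have hlt := hf.lt
    obtain ⟨m, z₁, z₂⟩ := z
    simp only [Position.le_def] at h₁ h₂
    simp only at bz bf hv
    cases hf' with
    | @outerK T i c k _ _ h hi hc =>
      obtain rfl : i = u := by omega
      obtain rfl : c = u' := by omega
      have hic := h.ij.lt
      have hcv := h.jk.lt
      rcases hz with ⟨hm, hz⟩ | ⟨hm, hm', hz⟩ | ⟨hm, hz⟩ <;> dsimp only at hm hz <;> subst hm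
      · have := h.ik.not_cross hz
        omega
      · have := h.ik.not_cross_spoke hz
        omega
      · have hcross := fun h' => hz.not_cross h.ik h'
        obtain ⟨h₁, hs, he⟩ := Turn.compl_eq_turn (K := K) (.outerI h) hf rfl
        refine ⟨_, h₁, _, ?_, hs, .single (.turn (.outerJ h rfl)), ?_⟩
        · exact ⟨by simp only; omega, by simp only; omega, by simp only; omega⟩
        · rw [← he, AnyArrow.compl_outerI]

/-- A rotation around the second endpoint of a chord behind the puncture can be joined with one around
its first endpoint `u`, whose properties are summarised by `hA`. -/
theorem Turn.joinable_turnFlip {i u e w : ℤ} {f : AnyArrow σ}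
    (hf : Turn σ i 0 u 0 e f) (hw : w = i + 2 * n)
    (hA : ∀ f, Turn σ u 0 e 2 w f →
      ∃ h : σ.Gamma K, Steps K σ y₁ ⟨2, e, u + 2 * n⟩ h ∧ f.compl K = g₁ * h)
    (hz : σ.IsPosition z) (hlt : w < z.snd) (h₂ : ⟨2, e, w⟩ ≤ z) :
    Joinable K σ z y₁ g₁ ⟨2, e, w⟩ (f.elt K) := by
  have bz := hz.bounds
  obtain ⟨m, z₁, z₂⟩ := z
  simp only [Position.le_def] at h₂
  simp only at bz hlt
  obtain rfl : m = 2 := by omega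
  replace hz := isPosition_two.1 hz
  cases hf with
  | @outerI T _ _ _ h =>
    obtain ⟨h₁, hs, he⟩ := hA _ (.outerJ h hw)
    refine ⟨_, h₁, _, ?_, hs, .single (.turn (.outerK h hw rfl)), ?_⟩
    · have := h.ij.not_cross hz
      have := h.jk.lt
      exact ⟨by simp only; omega, by simp only; omega, by simp only; omega⟩
    · rw [← he, AnyArrow.compl_outerJ]

/-- For an arc to the puncture, the rotations around its endpoint and around the puncture can be
joined. -/
theorem Turn.joinable_punctO {T : σ.PuncturedTriangle} {r s v v' u : ℤ} {l' : ℕ} {f : AnyArrow σ}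
    (hf : Turn σ r 1 v l' v' f) (h : T.Lifts r s) (hu : u = s + n) (hz : σ.IsPosition z)
    (h₁ : ⟨l', r, v'⟩ ≤ z) (h₂ : ⟨1, s, u⟩ ≤ z) :
    Joinable K σ z ⟨l', r, v'⟩ (f.elt K) ⟨1, s, u⟩ (AnyArrow.elt K (.punctO T)) := by
  have hv : v = r + n := (isPosition_one.1 hf.isPosition_left).1
  subst hv
  have hlt := hf.lt
  have bz := hz.bounds
  have bf := hf.isPosition_right.bounds
  have hl := hf.level_le
  obtain ⟨m, z₁, z₂⟩ := z
  simp only [Position.le_def] at h₁ h₂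
  simp only at bz bf
  obtain rfl : m = 2 := by omega
  replace hz := isPosition_two.1 hz
  obtain ⟨h₁, hs, he⟩ := Turn.compl_eq_turn (K := K) (.punctR h rfl) hf rfl
  refine ⟨_, h₁, _, ?_, hs, .single (.turn (.punctS h hu rfl)), ?_⟩
  · have := hz.not_cross_spoke h.fst
    have := h.rs.lt
    exact ⟨by simp only; omega, by simp only; omega, by simp only; omega⟩
  · rw [← he, AnyArrow.compl_punctR]

/-- For the arcs in a digon, the rotations around the endpoint and around the puncture can be joined. -/
theorem Turn.joinable_loop {D : σ.Digon} {k s v v' u w : ℤ} {l' : ℕ} {f : AnyArrow σ}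
    (hf : Turn σ k 1 v l' v' f) (h : D.Lifts k s) (hu : u = k + n) (hw : w = k + 2 * n)
    (hz : σ.IsPosition z) (h₁ : ⟨l', k, v'⟩ ≤ z) (h₂ : ⟨1, u, w⟩ ≤ z) :
    Joinable K σ z ⟨l', k, v'⟩ (f.elt K) ⟨1, u, w⟩
      (AnyArrow.elt K (.digonOut D .plain) * AnyArrow.elt K (.digonBase D) *
          AnyArrow.elt K (.digonIn D .plain)) := by
  have hv : v = k + n := (isPosition_one.1 hf.isPosition_left).1
  subst hv hu hw
  have hlt := hf.lt
  have bz := hz.bounds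
  have bf := hf.isPosition_right.bounds
  have hl := hf.level_le
  obtain ⟨m, z₁, z₂⟩ := z
  simp only [Position.le_def] at h₁ h₂
  simp only at bz bf
  obtain rfl : m = 2 := by omega
  replace hz := isPosition_two.1 hz
  have hD := h.shift 1
  rw [one_mul] at hD
  have hout : Turn σ (k + n) 1 (k + 2 * n) 2 (s + 2 * n) (.digonOut D .plain) :=
    .digonOut hD (by ring) (by ring)
  have hbase : Turn σ s 0 (k + n) 2 (k + 2 * n) (.digonBase D) := .digonBase h rfl rfl
  obtain ⟨h₁, hs, he⟩ := Turn.compl_eq_turn (K := K) (.digonIn h rfl) hf rfl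
  refine ⟨_, _, _, ?_, hs.trans (hbase.steps_compl_flip rfl), .single (.turn hout), ?_⟩
  · have := h.ks.not_cross hz
    have := h.ks.lt
    have := h.ks.lt_add
    have := hz.lt_add
    exact ⟨by simp only; omega, by simp only; omega, by simp only; omega⟩
  · rw [← mul_assoc, ← he, AnyArrow.compl_digonBase, AnyArrow.compl_digonIn, mul_add,
      ← mul_assoc, ← mul_assoc, mul_assoc _ _ (AnyArrow.elt K (.digonIn D .notched)),
      D.digonBase_mul_digonIn K, mul_zero, zero_mul, add_zero]

/-- Two elementary rotations from the same position can be joined. -/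
theorem Step.joinable {x : Position} (hg₁ : Step K σ x y₁ g₁) (hg₂ : Step K σ x y₂ g₂)
    (hz : σ.IsPosition z) (h₁ : y₁ ≤ z) (h₂ : y₂ ≤ z) : Joinable K σ z y₁ g₁ y₂ g₂ := by
  have hn := two_le_cast (n := n)
  -- it suffices to consider the following pairs of rotations
  have turn_eps : ∀ {l' u v v' k w g} {f : AnyArrow σ}, Turn σ u 0 v l' v' f → IsEps K σ v g →
      u + 1 = v → w = v + 1 → k = v → (⟨l', u, v'⟩ : Position) ≤ z → (⟨0, k, w⟩ : Position) ≤ z →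
      Joinable K σ z ⟨l', u, v'⟩ (f.elt K) ⟨0, k, w⟩ g := by
    intro l' u v v' k w g f hf hg hu hw hk h₁ h₂
    subst hw hk
    exact hf.joinable_of_le (fun l w f' hf' => hf'.compl_eq_eps (by omega) hg) hz h₁ h₂.2.1
  have turn_turnFlip : ∀ {i u e w l' v'} {f f' : AnyArrow σ}, Turn σ u 2 w l' v' f →
      Turn σ i 0 u 0 e f' → w = i + 2 * n → (⟨l', u, v'⟩ : Position) ≤ z →
      (⟨2, e, w⟩ : Position) ≤ z →
      Joinable K σ z ⟨l', u, v'⟩ (f.elt K) ⟨2, e, w⟩ (f'.elt K) := by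
    intro i u e w l' v' f f' hf hf' hw h₁ h₂
    exact hf'.joinable_turnFlip hw (fun f'' hf'' => hf''.compl_eq_turn hf rfl) hz
      (hf.lt.trans_le h₁.2.2) h₂
  have epsFlip_turnFlip : ∀ {i u e w v' v'' g} {f' : AnyArrow σ}, IsEps K σ u g →
      Turn σ i 0 u 0 e f' → w = i + 2 * n → w = u - 1 + 2 * n → v' = u + 1 → v'' = u + 2 * n →
      (⟨2, v', v''⟩ : Position) ≤ z → (⟨2, e, w⟩ : Position) ≤ z →
      Joinable K σ z ⟨2, v', v''⟩ g ⟨2, e, w⟩ (f'.elt K) := by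
    intro i u e w v' v'' g f' hg hf' hw hw' hv' hv'' h₁ h₂
    subst hv' hv''
    refine hf'.joinable_turnFlip hw (fun f'' hf'' => hf''.compl_eq_epsFlip hw' hg rfl) hz ?_ h₂
    have := h₁.2.2
    simp only at this
    omega
  cases hg₁ with
  | @turn l l' k v v' f h =>
    cases hg₂ with
    | turn h' =>
      obtain ⟨-, rfl, rfl, rfl⟩ := h.unique_right h'
      exact .refl h.isPosition_right h₁
    | turnSnd h' hu hu' => exact h.joinable_turnSnd h' hu hu' hz h₁ h₂
    | turnFlip h' hw => exact turn_turnFlip h h' hw h₁ h₂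
    | eps h' hu hv => exact turn_eps h h' hu hv rfl h₁ h₂
    | epsFlip h' hu hv hw =>
      have := h.isPosition_right.bounds
      have := h.lt
      simp only at *
      omega
    | punctO h' hu hv => exact h.joinable_punctO h' hv hz h₁ h₂
    | loop h' hu hv hw => exact h.joinable_loop h' hv hw hz h₁ h₂
  | @turnSnd k v v' u u' f h hu hu' =>
    cases hg₂ with
    | turn h' => exact (h'.joinable_turnSnd h hu hu' hz h₂ h₁).symm
    | turnSnd h' hv hv' =>
      subst hu hv
      obtain ⟨-, -, he, rfl⟩ := h.unique_right h'
      subst hu'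
      obtain rfl : u' = _ := add_right_cancel (he.trans hv')
      exact .refl (Step.turnSnd (K := K) h rfl rfl).isPosition_right h₁
    | eps h' hu'' hv =>
      have := h.isPosition_right.bounds
      have := h.lt
      simp only at *
      omega
  | @turnFlip k v v' w f h hw =>
    cases hg₂ with
    | turn h' => exact (turn_turnFlip h' h hw h₂ h₁).symm
    | @turnFlip k' _ _ _ _ h' hw' =>
      obtain rfl : k = k' := by omega
      obtain ⟨-, -, rfl, rfl⟩ := h.unique_right h'
      exact .refl (Step.turnFlip (K := K) h hw).isPosition_right h₁
    | epsFlip h' hu hv hw' => exact (epsFlip_turnFlip h' h hw hu hv hw' h₂ h₁).symm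
  | @eps k u v g h hu hv =>
    cases hg₂ with
    | turn h' => exact (turn_eps h' h hu hv rfl h₂ h₁).symm
    | turnSnd h' hu'' hv' =>
      have := h'.isPosition_right.bounds
      have := h'.lt
      simp only at *
      omega
    | eps h' hu' hv' =>
      subst hv hv'
      rw [h.eq h']
      exact .refl (isPosition_sideFrom k) h₁
  | @epsFlip k u v w g h hu hv hw =>
    cases hg₂ with
    | turn h' =>
      have := h'.isPosition_right.bounds
      have := h'.lt
      simp only at *
      omega
    | turnFlip h' hw' => exact epsFlip_turnFlip h h' hw' hu hv hw h₁ h₂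
    | epsFlip h' hu' hv' hw' =>
      subst hv hv' hw hw'
      rw [h.eq h']
      exact .refl (Step.epsFlip (K := K) h hu rfl rfl).isPosition_right h₁
  | @punctO T r s u v h hu hv =>
    cases hg₂ with
    | turn h' => exact (h'.joinable_punctO h hv hz h₂ h₁).symm
    | punctO h' hu' hv' =>
      obtain rfl := h.eq_snd h'
      obtain rfl := h.eq h'
      subst hv hv'
      exact .refl (isPosition_one.2 ⟨rfl, h.snd⟩) h₁
    | loop h' hu' hv' hw' => exact absurd h'.isDigonAt (h.not_isDigonAt _)
  | @loop D k s u v w h hu hv hw =>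
    cases hg₂ with
    | turn h' => exact (h'.joinable_loop h hv hw hz h₂ h₁).symm
    | punctO h' hu' hv' => exact absurd h.isDigonAt (h'.not_isDigonAt _)
    | @loop D' _ _ _ _ _ h' hu' hv' hw' =>
      obtain rfl := Digon.eq D D'
      subst hv hv' hw hw'
      exact .refl (Step.loop (K := K) h hu rfl rfl).isPosition_right h₁

/-- There is only one product of rotations between two given positions. -/
theorem Steps.eq {x z : Position} {g g' : σ.Gamma K} (hg : Steps K σ x z g)
    (hg' : Steps K σ x z g') : g = g' := by
  induction hd : (z.deg - x.deg).toNat using Nat.strong_induction_on generalizing x g g' with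
  | _ d ih =>
    have hz := hg.isPosition_right
    cases hg with
    | @refl _ a hx ha =>
      cases hg' with
      | @refl _ b hx hb => rw [Subtype.ext (ha.trans hb.symm)]
      | head hg₂ hh₂ =>
        have := hg₂.deg_lt
        have := hh₂.deg_le
        omega
    | head hg₁ hh₁ =>
      cases hg' with
      | refl hx ha =>
        have := hg₁.deg_lt
        have := hh₁.deg_le
        omega
      | head hg₂ hh₂ =>
        have h1 := hg₁.deg_lt
        have h2 := hh₁.deg_le
        have h3 := hg₂.deg_lt
        have h4 := hh₂.deg_le
        obtain ⟨w, k₁, k₂, hw, hs₁, hs₂, he⟩ := hg₁.joinable hg₂ hz hh₁.le hh₂.le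
        obtain ⟨m, hm⟩ := hs₁.isPosition_right.exists_steps K hz hw
        -- both products agree with one that passes through the joining position `w`
        rw [ih _ (by omega) hh₁ (hs₁.trans hm) rfl, ih _ (by omega) hh₂ (hs₂.trans hm) rfl,
          ← mul_assoc, he, mul_assoc]

end Uniqueness

/-! ### Multiplication of products of rotations by arrows -/

section Closure

variable {K : Type*} [Field K] {n : ℕ} [NeZero n] [Fact (2 ≤ n)] {σ : TaggedTriangulation n}

theorem Turn.shift {k v v' : ℤ} {l l' : ℕ} {f : AnyArrow σ} (h : Turn σ k l v l' v' f) (m : ℤ) :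
    Turn σ (k + m * n) l (v + m * n) l' (v' + m * n) f := by
  cases h with
  | outerI h => exact .outerI (h.shift m)
  | outerK h hv hv' => exact .outerK (h.shift m) (by rw [hv]; ring) (by rw [hv']; ring)
  | outerJ h hv' => exact .outerJ (h.shift m) (by rw [hv']; ring)
  | punctR h hv' => exact .punctR (h.shift m) (by rw [hv']; ring)
  | punctS h hv hv' => exact .punctS (h.shift m) (by rw [hv]; ring) (by rw [hv']; ring)
  | digonBase h hv hv' => exact .digonBase (h.shift m) (by rw [hv]; ring) (by rw [hv']; ring)
  | digonIn h hv' => exact .digonIn (h.shift m) (by rw [hv']; ring)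
  | digonOut h hv hv' => exact .digonOut (h.shift m) (by rw [hv]; ring) (by rw [hv']; ring)

theorem IsEps.shift {k : ℤ} {g : σ.Gamma K} (h : IsEps K σ k g) (m : ℤ) :
    IsEps K σ (k + m * n) g := by
  rcases h with ⟨h, rfl⟩ | ⟨f, h, rfl⟩
  · left
    rw [intCast_add_mul]
    exact ⟨h, rfl⟩
  · refine Or.inr ⟨f, ?_, rfl⟩
    convert h.shift m using 1 <;> ring

theorem AnyArrow.left_incidentTo {f : AnyArrow σ} {κ : ZMod n}
    (h : Arrow.centre f.total.hom = .polygon κ) : f.total.left.1.IncidentTo κ := by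
  cases f <;> simp only [total, Arrow.centre, MarkedPoint.polygon.injEq, reduceCtorEq] at h <;>
    subst h <;>
    simp [total, Edge.IncidentTo, OuterTriangle.ij, OuterTriangle.jk, OuterTriangle.ik,
      PuncturedTriangle.base, PuncturedTriangle.snd, Digon.sideTo, Digon.sideFrom, Digon.spoke,
      sideTo]

/-- An arrow crosses to the other side of the puncture if it starts at an edge which is not incident
to the puncture and turns towards the puncture. -/
def AnyArrow.Crosses : AnyArrow σ → Prop
  | .outerJ _ | .punctR _ | .digonBase _ | .digonIn _ .plain => True
  | _ => False

theorem Turn.crosses_iff {k v v' : ℤ} {l l' : ℕ} {f : AnyArrow σ} (h : Turn σ k l v l' v' f) :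
    f.Crosses ↔ l = 0 ∧ l' ≠ 0 := by
  cases h <;> simp [AnyArrow.Crosses]

variable (K) in
/-- An arrow starting at the edge of a position is an elementary rotation from this position, unless it
starts behind the puncture and crosses it or ends at a notched arc of a digon. -/
theorem IsPosition.step_or {z : Position} (hz : σ.IsPosition z) {f : AnyArrow σ}
    (hf : f.total.left.1 = σ.edgeAt z) :
    (∃ y, Step K σ z y (f.elt K) ∧ f.total.right.1 = σ.edgeAt y) ∨
    (z.level = 2 ∧ ∃ l' v', Turn σ (z.snd - 2 * n) 0 z.fst l' v' f ∧ l' ≠ 0) ∨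
    ∃ D, f = .digonIn D .notched := by
  have hn := two_le_cast (n := n)
  by_cases hN : ∃ D, f = .digonIn D .notched
  · exact Or.inr (Or.inr hN)
  by_cases hE : Arrow.IsExternal f.total.hom
  · left
    cases f with
    | external κ h =>
      have bz := hz.bounds
      obtain ⟨l, u, v⟩ := z
      have hl : l = 0 ∨ l = 1 ∨ l = 2 := by simp only at bz; omega
      simp only [AnyArrow.total, sideTo] at hf
      rcases hl with rfl | rfl | rfl <;> simp only [edgeAt, Edge.chord.injEq, reduceCtorEq] at hf
      · have h1 := isPosition_zero.1 hz
        have := h1.lt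
        have := h1.lt_add
        obtain ⟨h2, rfl⟩ := hf
        have := eq_of_cast_eq (n := n) (i := v - 1) (j := u) (by simpa using h2) (by omega)
          (by omega)
        refine ⟨_, .eps (Or.inl ⟨h, rfl⟩) (by omega) rfl, ?_⟩
        simp [AnyArrow.total, sideFrom, edgeAt]
      · have h1 := isPosition_two.1 hz
        have := h1.lt
        have := h1.lt_add
        obtain ⟨h2, rfl⟩ := hf
        have := eq_of_cast_eq (n := n) (i := u - 1) (j := v - 2 * n) (by simpa using h2) (by omega)
          (by omega)
        refine ⟨_, .epsFlip (Or.inl ⟨h, rfl⟩) (by omega) rfl rfl, ?_⟩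
        simp [AnyArrow.total, sideFrom, edgeAt]
    | _ => exact absurd hE id
  have hNl : ∀ D : σ.Digon, f.total.left ≠ D.spoke .notched := fun D hD =>
    edgeAt_ne_notched D (hf.symm.trans (congrArg Subtype.val hD))
  have hNr : ∀ D : σ.Digon, f.total.right ≠ D.spoke .notched := by
    intro D hD
    have h1 := congrArg Subtype.val hD
    cases f with
    | digonIn D' t =>
      cases t with
      | plain => simp [AnyArrow.total, Digon.spoke] at h1
      | notched => exact hN ⟨D', rfl⟩
    | punctR T => simp [AnyArrow.total, Digon.spoke, PuncturedTriangle.fst, T.tag_eq, D.tag_eq] at h1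
    | punctO T => simp [AnyArrow.total, Digon.spoke, PuncturedTriangle.snd, T.tag_eq, D.tag_eq] at h1
    | _ =>
      simp [AnyArrow.total, Digon.spoke, OuterTriangle.ij, OuterTriangle.jk, OuterTriangle.ik,
        PuncturedTriangle.base, Digon.sideTo, Digon.sideFrom, sideFrom] at h1
  rcases hc : Arrow.centre f.total.hom with κ | _
  · have turn : ∀ {l : ℕ} {k v : ℤ}, (k : ZMod n) = κ → σ.IsPosition ⟨l, k, v⟩ →
        σ.edgeAt ⟨l, k, v⟩ = σ.edgeAt z → ∃ l' v', Turn σ k l v l' v' f := by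
      intro l k v hk hp he
      obtain ⟨m, w, l', v', ht⟩ := Arrow.exists_turn f.total.hom (k := k) (hc.trans (by rw [hk]))
        hE hNl hNr
      rw [AnyArrow.any_total] at ht
      obtain ⟨rfl, rfl⟩ := hp.eq_of_edgeAt_eq ht.isPosition_left
        (he.trans (hf.symm.trans ht.edgeAt_left))
      exact ⟨_, _, ht⟩
    have hinc := AnyArrow.left_incidentTo hc
    rw [hf] at hinc
    have bz := hz.bounds
    obtain ⟨l, u, v⟩ := z
    have hl : l = 0 ∨ l = 1 ∨ l = 2 := by simp only at bz; omega
    rcases hl with rfl | rfl | rfl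
    · rcases hinc with rfl | rfl
      · obtain ⟨l', v', ht⟩ := turn rfl hz rfl
        exact Or.inl ⟨_, .turn ht, ht.edgeAt_right⟩
      · obtain ⟨l', v', ht⟩ := turn (l := 2) (v := u + 2 * n) rfl
          (isPosition_two'.2 (isPosition_zero.1 hz)) (by simp [edgeAt])
        obtain rfl := ht.level_two
        refine Or.inl ⟨_, .turnSnd ht rfl (u' := v' - 2 * n) (by ring), ht.edgeAt_right.trans ?_⟩
        simp [edgeAt]
    · obtain rfl : κ = u := hinc
      obtain ⟨l', v', ht⟩ := turn rfl hz rfl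
      exact Or.inl ⟨_, .turn ht, ht.edgeAt_right⟩
    · rcases hinc with rfl | rfl
      · obtain ⟨l', v', ht⟩ := turn (l := 0) (k := v - 2 * n) (v := u) (by simp)
          (isPosition_zero.2 (isPosition_two.1 hz)) (by simp [edgeAt])
        rcases eq_or_ne l' 0 with rfl | hl'
        · refine Or.inl ⟨_, .turnFlip ht (by ring), ht.edgeAt_right.trans ?_⟩
          simp [edgeAt]
        · exact Or.inr (Or.inl ⟨rfl, _, _, ht, hl'⟩)
      · obtain ⟨l', v', ht⟩ := turn rfl hz rfl
        exact Or.inl ⟨_, .turn ht, ht.edgeAt_right⟩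
  · left
    obtain ⟨T, hT⟩ := (Arrow.centre_eq_puncture_iff f.total.hom).1 hc
    rw [AnyArrow.any_total] at hT
    subst hT
    obtain ⟨l, u, v⟩ := z
    rcases hz with ⟨hl, hz⟩ | ⟨hl, hv, hz⟩ | ⟨hl, hz⟩ <;> dsimp only at hl hz <;> subst hl <;>
      simp [AnyArrow.total, PuncturedTriangle.fst, edgeAt] at hf
    obtain ⟨s, h⟩ := T.exists_lifts hf.1.symm
    refine ⟨_, .punctO h hv rfl, ?_⟩
    exact h.right_eq (f := Arrow.punctO T) rfl

variable (K) in
/-- The element `y` is zero or a product of rotations, from the position `x` to a position of the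
edge `b` which is not of level `0`. -/
def Far (σ : TaggedTriangulation n) (x : Position) (b : σ.Vertex) (y : σ.Gamma K) : Prop :=
  y = 0 ∨ ∃ z, z.level ≠ 0 ∧ b.1 = σ.edgeAt z ∧ Steps K σ x z y

/-- A product of rotations ending at the level `2` is killed by the arrow to the notched arc. -/
theorem Steps.mul_digonIn_notched {x z : Position} {y : σ.Gamma K} (hy : Steps K σ x z y)
    (hx : x.level ≤ 1) (hz : z.level ≠ 0) {D : σ.Digon} (hD : D.sideFrom.1 = σ.edgeAt z) :
    y * AnyArrow.elt K (.digonIn D .notched) = 0 := by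
  have hn := two_le_cast (n := n)
  have hxz := hy.le
  have hpx := hy.isPosition_left
  have hpz := hy.isPosition_right
  obtain ⟨l, u, v⟩ := z
  have hl2 := hpz.bounds.1
  have hl : l = 1 ∨ l = 2 := by simp only at hl2 hz; omega
  rcases hl with rfl | rfl
  · simp [Digon.sideFrom, edgeAt] at hD
  · have h1 := isPosition_two.1 hpz
    simp only [Digon.sideFrom, edgeAt, Edge.chord.injEq] at hD
    obtain ⟨s, hs⟩ := D.exists_lifts (k := v - 2 * n) (by simpa using hD.1.symm)
    generalize hk : v - 2 * n = k at *
    obtain rfl : v = k + 2 * n := by omega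
    have := hs.ks.lt
    have := hs.ks.lt_add
    have := h1.lt
    have := h1.lt_add
    obtain rfl : s = u := eq_of_cast_eq (hs.cast_s.trans hD.2) (by omega) (by omega)
    simp only [Position.le_def] at hxz
    obtain ⟨m, a, b⟩ := x
    simp only at hxz hx
    rcases hpx with ⟨hm, hp⟩ | ⟨hm, hab, hp⟩ | ⟨hm, -⟩ <;> simp only at hm
    · subst hm
      simp only at hp
      have h2 := hp.not_cross_spoke hs.isDigonAt.hasSpoke.add
      obtain ⟨y₀, hy₀⟩ := hy.isPosition_left.exists_steps K (isPosition_zero.2 hs.sk)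
        (⟨le_rfl, hxz.2.1, by simp only; omega⟩)
      rw [hy.eq (hy₀.trans (.single (.turn (.digonBase hs rfl rfl)))), mul_assoc,
        D.digonBase_mul_digonIn K, mul_zero]
    · subst hm
      simp only at hp hab
      have h2 : a ≤ k := by
        by_contra hlt
        have := eq_of_cast_eq (hs.isDigonAt.cast_eq hp) (by omega) (by omega)
        omega
      obtain ⟨y₀, hy₀⟩ := hy.isPosition_left.exists_steps K
        (isPosition_one.2 ⟨rfl, hs.isDigonAt.hasSpoke⟩)
        (⟨le_rfl, h2, by simp only; omega⟩)
      have hin : Turn σ k 0 s 1 (k + n) (.digonIn D .plain) := .digonIn hs rfl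
      rw [hy.eq (hy₀.trans (hin.steps_compl_flip rfl)), AnyArrow.compl_digonIn, mul_assoc,
        mul_assoc, D.digonBase_mul_digonIn K, mul_zero, mul_zero]
    · omega

/-- The number of sides of the polygon cut off by a chord. -/
def _root_.PuncturedPolygon.Edge.len : Edge n → ℕ
  | .chord r s => ccwDist r s
  | .spoke _ _ => 0

/-- Multiplication by an arrow, under the assumption that the arrows crossing the puncture from
chords of length at least `N` have already been considered. -/
theorem Far.mul_elt {x : Position} (hx : x.level ≤ 1) {N : ℕ}
    (hN : ∀ {y : σ.Gamma K} {z l' v'} {f : AnyArrow σ}, z.level = 2 → Steps K σ x z y →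
      Turn σ (z.snd - 2 * n) 0 z.fst l' v' f → l' ≠ 0 → N ≤ f.total.left.1.len →
      Far K σ x f.total.right (y * f.elt K))
    {f : AnyArrow σ} {y : σ.Gamma K} (hf : f.Crosses → N ≤ f.total.left.1.len)
    (hy : Far K σ x f.total.left y) : Far K σ x f.total.right (y * f.elt K) := by
  rcases hy with rfl | ⟨z, hz, hb, hy⟩
  · exact Or.inl (zero_mul _)
  rcases hy.isPosition_right.step_or K hb with ⟨w, hw, hw'⟩ | ⟨hz2, l', v', ht, hl'⟩ | ⟨D, rfl⟩
  · refine Or.inr ⟨w, ?_, hw', hy.trans (.single hw)⟩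
    have := hw.le.1
    omega
  · exact hN hz2 hy ht hl' (hf (ht.crosses_iff.2 ⟨rfl, hl'⟩))
  · exact Or.inl (hy.mul_digonIn_notched hx hz hb)

theorem len_edgeAt_zero {u v : ℤ} (h : σ.IsPosition ⟨0, u, v⟩) :
    ((σ.edgeAt ⟨0, u, v⟩).len : ℤ) = v - u :=
  ccwDist_intCast (isPosition_zero.1 h).lt.le (isPosition_zero.1 h).lt_add

/-- Multiplication by a path turning around a vertex, under the same assumption. -/
theorem Far.mul_fanPath {x : Position} (hx : x.level ≤ 1) {N : ℕ}
    (hN : ∀ {y : σ.Gamma K} {z l' v'} {f : AnyArrow σ}, z.level = 2 → Steps K σ x z y →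
      Turn σ (z.snd - 2 * n) 0 z.fst l' v' f → l' ≠ 0 → N ≤ f.total.left.1.len →
      Far K σ x f.total.right (y * f.elt K))
    {k v v' : ℤ} {l l' : ℕ} {a b : σ.Vertex} {p : Quiver.Path a b}
    (hp : FanPath σ k l v l' v' p) (hl : l' = 0 ∨ (N : ℤ) ≤ v - k) {y : σ.Gamma K}
    (hy : Far K σ x a y) : Far K σ x b (y * pathElt K p) := by
  induction hp with
  | @nil a h ha =>
    rcases hy with rfl | ⟨z, hz, hb, hy⟩
    · exact Or.inl (zero_mul _)
    · refine Or.inr ⟨z, hz, hb, ?_⟩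
      have := hy.mul_idem hb
      rw [idem] at this
      rwa [this]
  | @cons l' l'' v' v'' a b c p f hp hf ih =>
    have h1 := hf.level_le
    have h2 := ih (by omega) hy
    have h3 := Far.mul_elt hx hN (f := Arrow.any f) (y := y * pathElt K p) ?_
      (by rw [Arrow.total_any]; exact h2)
    · rw [Arrow.total_any] at h3
      rw [show p.cons f = p.comp f.toPath from rfl, pathElt_comp, pathElt_toPath, ← mul_assoc]
      exact h3
    · intro hc
      obtain ⟨rfl, h4⟩ := hf.crosses_iff.1 hc
      have h5 := len_edgeAt_zero hf.isPosition_left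
      have h6 := hp.le
      rw [hf.edgeAt_left]
      omega

theorem Far.mul_eps {x : Position} {k : ℤ} {g : σ.Gamma K} (hg : IsEps K σ k g) {y : σ.Gamma K}
    (hy : Far K σ x (σ.sideTo (k : ZMod n)) y) :
    Far K σ x (σ.sideFrom (k : ZMod n)) (y * g) := by
  rcases hy with rfl | ⟨z, hz, hb, hy⟩
  · exact Or.inl (zero_mul _)
  have hpz := hy.isPosition_right
  obtain ⟨l, u, v⟩ := z
  have hl2 := hpz.bounds.1
  have hl : l = 1 ∨ l = 2 := by simp only at hl2 hz; omega
  rcases hl with rfl | rfl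
  · simp [sideTo, edgeAt] at hb
  · have hu : (u : ZMod n) = k := by
      simp only [sideTo, edgeAt, Edge.chord.injEq] at hb
      exact hb.2.symm
    obtain ⟨m, rfl⟩ := exists_add_mul_of_cast_eq hu
    obtain ⟨-, rfl⟩ := hpz.eq_of_edgeAt_eq (isPosition_sideTo (k + m * n))
      (hb.symm.trans (by rw [← hu, edgeAt_sideTo]))
    refine Or.inr ⟨_, ?_, ?_, hy.trans (.single (.epsFlip (hg.shift m) rfl rfl rfl))⟩
    · simp
    · simp [sideFrom, edgeAt]

theorem PunctPath.steps {r s : ℤ} {a b : σ.Vertex} {p : Quiver.Path a b}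
    (h : PunctPath σ r s p) : Steps K σ ⟨1, r, r + n⟩ ⟨1, s, s + n⟩ (pathElt K p) := by
  induction h with
  | nil h ha => exact .refl (isPosition_one.2 ⟨rfl, h⟩) ha
  | @cons s t a b c p f T hp hT hf ih =>
    rw [show p.cons f = p.comp f.toPath from rfl, pathElt_comp, pathElt_toPath, hf]
    exact ih.trans (.single (.punctO hT rfl rfl))

/-- Multiplication by an arrow which would cross the puncture for the second time: the product of
rotations before it can be chosen to end in such a way that, by one of the relations, the last two
factors can be replaced. For `outerJ`, the replacement turns around another vertex and may itself
contain arrows crossing the puncture, but these start at longer chords. -/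
theorem Steps.far_of_crosses {x z : Position} (hx : x.level ≤ 1) {y : σ.Gamma K}
    (hy : Steps K σ x z y) (hz : z.level = 2) {l' : ℕ} {v' : ℤ} {f : AnyArrow σ}
    (hf : Turn σ (z.snd - 2 * n) 0 z.fst l' v' f) (hl' : l' ≠ 0) :
    Far K σ x f.total.right (y * f.elt K) := by
  have hn := two_le_cast (n := n)
  induction hd : n - f.total.left.1.len using Nat.strong_induction_on generalizing y z l' v' f with
  | _ d ih =>
    have hxz := hy.le
    have hpx := hy.isPosition_left
    have bx := hpx.bounds
    have bz := hy.isPosition_right.bounds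
    obtain ⟨m, a, b⟩ := x
    obtain ⟨l, u, v⟩ := z
    simp only [Position.le_def] at hxz
    simp only at hz hf bx bz hx
    subst hz
    generalize hk : v - 2 * n = k at *
    obtain rfl : v = k + 2 * n := by omega
    cases hf with
    | outerI h => exact absurd rfl hl'
    | @outerJ T i _ _ _ h hv' =>
      have h1 := h.ij.lt
      have h2 := h.ik.lt_add
      have h3 := h.jk.lt_add
      have h4 := ccwDist_intCast h.jk.lt.le h.jk.lt_add
      rw [h.cast_j, h.cast_k] at h4
      obtain ⟨y₀, hy₀⟩ := hpx.exists_steps K (isPosition_two'.2 h.ik)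
        ⟨by simp only; omega, hxz.2.1, by simp only; omega⟩
      have hI : Turn σ i 0 k 0 u (.outerI T) := .outerI h
      obtain ⟨g, hg⟩ := exists_isEps K σ i
      obtain ⟨p, hp⟩ := hI.any.exists_before
      obtain ⟨w, hw⟩ := hI.any.exists_after
      rw [hy.eq (hy₀.trans (.single (.turn (.outerK h rfl rfl)))), mul_assoc,
        ← AnyArrow.compl_outerI, hI.compl_eq hg hp hw, ← mul_assoc, ← mul_assoc]
      -- the chord from `P_i` to `P_k` and the following ones cut off more sides of the polygon
      have hN : ∀ {y : σ.Gamma K} {z l' v'} {f : AnyArrow σ}, z.level = 2 →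
          Steps K σ ⟨m, a, b⟩ z y → Turn σ (z.snd - 2 * n) 0 z.fst l' v' f → l' ≠ 0 →
          ccwDist T.j T.k + 1 ≤ f.total.left.1.len →
          Far K σ ⟨m, a, b⟩ f.total.right (y * f.elt K) := by
        intro y z l' v' f hz hy hf hl' hlen
        refine ih _ ?_ hy hz hf hl' rfl
        simp only [AnyArrow.total, OuterTriangle.jk, Edge.len] at hd
        omega
      have far₀ : Far K σ ⟨m, a, b⟩ T.ik y₀ := by
        refine Or.inr ⟨_, two_ne_zero, ?_, hy₀⟩
        simp [OuterTriangle.ik, edgeAt, h.cast_i, h.cast_k]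
      exact Far.mul_fanPath hx hN hp (Or.inl rfl)
        (Far.mul_eps hg (Far.mul_fanPath hx hN hw (Or.inr (by push_cast; omega)) far₀))
    | @punctR T r s _ h hv' =>
      have h1 := h.rs.lt
      have hb : b ≤ u + n := by
        rcases hpx with ⟨hm, hp⟩ | ⟨hm, hab, hp⟩ | ⟨hm, -⟩ <;> simp only at hm
        · exact HasChord.not_cross_spoke hp h.snd.add (by simp only; omega)
        · simp only at hab; omega
        · omega
      obtain ⟨y₀, hy₀⟩ := hpx.exists_steps K (isPosition_one.2 ⟨rfl, h.snd⟩)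
        ⟨hx, hxz.2.1, hb⟩
      obtain ⟨q, hq⟩ := PunctPath.exist h.not_isDigonAt h.snd h.fst.add h.rs.lt_add.le
        (a := T.snd) (b := T.fst) (h.right_eq (f := Arrow.punctO T) rfl)
        ((h.left_eq (f := Arrow.punctO T) rfl).trans (by simp))
      rw [hy.eq (hy₀.trans (.single (.turn (.punctS h rfl rfl)))), mul_assoc,
        ← AnyArrow.compl_punctO, h.compl_punctO hq]
      refine Or.inr ⟨_, one_ne_zero, ?_, hy₀.trans hq.steps⟩
      refine (h.left_eq (f := Arrow.punctO T) rfl).trans ?_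
      simp [edgeAt]
    | @digonIn D _ s _ h hv' =>
      have h1 := h.ks.lt
      have h2 := h.ks.lt_add
      have hD := h.shift 1
      rw [one_mul] at hD
      have hout : Turn σ (k + n) 1 (k + 2 * n) 2 (u + 2 * n) (.digonOut D .plain) :=
        .digonOut hD (by ring) (by ring)
      have hin : Turn σ k 0 u 1 (k + n) (.digonIn D .plain) := .digonIn h rfl
      have hedge : (AnyArrow.digonIn D .plain).total.right.1 =
          σ.edgeAt ⟨1, k + n, k + 2 * n⟩ := by
        simp [AnyArrow.total, Digon.spoke, edgeAt, h.cast_k, D.tag_eq]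
      rcases hpx with ⟨hm, hp⟩ | ⟨hm, hab, hp⟩ | ⟨hm, -⟩ <;> simp only at hm
      · subst hm
        have hb := HasChord.not_cross_spoke hp h.isDigonAt.hasSpoke.add (by simp only; omega)
        obtain ⟨y₀, hy₀⟩ := hy.isPosition_left.exists_steps K (isPosition_zero.2 h.sk)
          ⟨le_rfl, hxz.2.1, hb⟩
        rw [hy.eq (hy₀.trans (.single (.turn (.digonBase h rfl rfl)))), mul_assoc,
          ← AnyArrow.compl_digonOut]
        exact Or.inr ⟨_, one_ne_zero, hedge, hy₀.trans (hout.steps_compl rfl)⟩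
      · subst hm
        simp only at hab hp
        have ha : a ≤ k := by
          by_contra hlt
          have := eq_of_cast_eq (h.isDigonAt.cast_eq hp) (by omega) (by omega)
          omega
        obtain ⟨y₀, hy₀⟩ := hy.isPosition_left.exists_steps K
          (isPosition_one.2 ⟨rfl, h.isDigonAt.hasSpoke⟩) ⟨le_rfl, ha, by simp only; omega⟩
        rw [hy.eq (hy₀.trans (hin.steps_compl_flip rfl)), AnyArrow.compl_digonIn, mul_assoc]
        exact Or.inr ⟨_, one_ne_zero, hedge, hy₀.trans (.single (.loop h rfl rfl rfl))⟩
      · omega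
    | @digonBase D k' _ _ _ h hv hv' =>
      subst hv
      have h1 := h.ks.lt
      have h2 := h.ks.lt_add
      have hD := h.shift 1
      rw [one_mul] at hD
      have hb : b ≤ k' + n + n := by
        rcases hpx with ⟨hm, hp⟩ | ⟨hm, hab, hp⟩ | ⟨hm, -⟩ <;> simp only at hm
        · exact HasChord.not_cross_spoke hp h.isDigonAt.hasSpoke.add.add (by simp only; omega)
        · simp only at hab; omega
        · omega
      have hout : Turn σ (k' + n) 1 (k' + n + n) 2 (k + 2 * n) (.digonOut D .plain) :=
        .digonOut hD (by ring) (by ring)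
      have hin : Turn σ (k' + n) 0 (k + n) 1 (k' + n + n) (.digonIn D .plain) := .digonIn hD rfl
      obtain ⟨y₀, hy₀⟩ := hpx.exists_steps K
        (isPosition_one.2 ⟨rfl, h.isDigonAt.hasSpoke.add⟩) ⟨hx, hxz.2.1, hb⟩
      rw [hy.eq (hy₀.trans (.single (.turn hout))), mul_assoc, ← AnyArrow.compl_digonIn]
      refine Or.inr ⟨_, two_ne_zero, ?_, hy₀.trans (hin.steps_compl_flip rfl)⟩
      simp [AnyArrow.total, Digon.sideFrom, edgeAt, h.cast_k, h.cast_s]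

/-- Multiplication by an arrow, on the other side of the puncture. -/
theorem Far.mul {x : Position} (hx : x.level ≤ 1) {f : AnyArrow σ} {y : σ.Gamma K}
    (hy : Far K σ x f.total.left y) : Far K σ x f.total.right (y * f.elt K) :=
  Far.mul_elt hx (N := 0) (fun hz hy hf hl' _ => hy.far_of_crosses hx hz hf hl')
    (fun _ => Nat.zero_le _) hy

end Closure

/-! ### The action of products of rotations -/

section Action

open Polynomial

variable {K : Type*} [Field K] {n : ℕ} [NeZero n] [Fact (2 ≤ n)] {σ : TaggedTriangulation n}
  {x y z : Position} {g : σ.Gamma K} {a b : σ.Vertex}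

open Classical in
theorem gammaRep_pathElt (p : Quiver.Path a b) :
    gammaRep K σ (pathElt K p) = Matrix.single a b ((weights K σ).path p) := by
  rw [pathElt, gammaRep_mk, Weights.rep_ofPath]

open Classical in
theorem gammaRep_idem (a : σ.Vertex) :
    gammaRep K σ (idem K a) = Matrix.single a a (edgeWeight K σ a.1) := gammaRep_pathElt _

open Classical in
theorem gammaRep_elt (f : AnyArrow σ) :
    gammaRep K σ (f.elt K) = Matrix.single f.total.left f.total.right (f.weight K) := by
  rw [AnyArrow.elt, gammaRep_pathElt, Weights.path_toPath]
  exact congrArg (fun f => Matrix.single _ _ (AnyArrow.weight K f)) f.any_total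

/-- The flag of the monomial by which the rotations between two positions act. -/
def levelFlag (x y : Position) : Bool := decide (x.level = y.level ∧ x.level ≠ 1)

open Classical in
theorem IsEps.gammaRep_eq {k : ℤ} (hg : IsEps K σ k g) :
    gammaRep K σ g = Matrix.single (σ.sideTo (k : ZMod n)) (σ.sideFrom (k : ZMod n))
      (biMonomial K 2 true) := by
  rcases hg with ⟨h, rfl⟩ | ⟨f, h, rfl⟩
  · exact gammaRep_elt _
  · rw [AnyArrow.compl, gammaRep_mk, h.rep_complement K,
      Subtype.ext (h.edgeAt_right.trans (edgeAt_sideTo k).symm),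
      Subtype.ext (h.edgeAt_left.trans (edgeAt_sideFrom k).symm)]
    have h1 := h.deg_eq
    have h2 := h.deg_le
    congr 2
    omega

open Classical in
theorem Step.gammaRep_eq (hg : Step K σ x y g) (ha : a.1 = σ.edgeAt x) (hb : b.1 = σ.edgeAt y) :
    gammaRep K σ g =
      Matrix.single a b (biMonomial K (y.deg - x.deg).toNat (levelFlag x y)) := by
  have key : ∀ f : AnyArrow σ, f.total.left.1 = σ.edgeAt x → f.total.right.1 = σ.edgeAt y →
      gammaRep K σ (f.elt K) = Matrix.single a b (f.weight K) := by
    intro f hl hr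
    obtain rfl : f.total.left = a := Subtype.ext (hl.trans ha.symm)
    obtain rfl : f.total.right = b := Subtype.ext (hr.trans hb.symm)
    exact gammaRep_elt f
  unfold levelFlag Position.deg
  cases hg with
  | turn h =>
    rw [key _ h.edgeAt_left h.edgeAt_right, h.weight_eq]
    have h1 := h.deg_eq
    have h2 := h.ne_one
    congr 2
    · simp only; omega
    · congr 1
      apply propext
      simp only
      omega
  | turnSnd h hu hu' =>
    rw [key _ (h.edgeAt_left.trans (by simp [edgeAt, hu]))
      (h.edgeAt_right.trans (by simp [edgeAt, hu'])), h.weight_eq]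
    have h1 := h.deg_eq
    congr 2
    simp only
    omega
  | turnFlip h hw =>
    rw [key _ (h.edgeAt_left.trans (by simp [edgeAt, hw]))
      (h.edgeAt_right.trans (by simp [edgeAt, hw])), h.weight_eq]
    have h1 := h.deg_eq
    congr 2
    simp only
    omega
  | @eps k u v g h hu hv =>
    rw [h.gammaRep_eq]
    obtain rfl : σ.sideTo (k : ZMod n) = a := by
      refine Subtype.ext ?_
      rw [ha]
      subst hu
      simp [sideTo, edgeAt]
    obtain rfl : σ.sideFrom (k : ZMod n) = b := by
      refine Subtype.ext ?_
      rw [hb]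
      subst hv
      simp [sideFrom, edgeAt]
    congr 2
    simp only
    omega
  | @epsFlip k u v w g h hu hv hw =>
    rw [h.gammaRep_eq]
    obtain rfl : σ.sideTo (k : ZMod n) = a := by
      refine Subtype.ext ?_
      rw [ha, hu, edgeAt_sideTo]
    obtain rfl : σ.sideFrom (k : ZMod n) = b := by
      refine Subtype.ext ?_
      rw [hb, hv, hw]
      simp [sideFrom, edgeAt]
    congr 2
    simp only
    omega
  | @punctO T r s u v h hu hv =>
    rw [key _ (h.left_eq (f := Arrow.punctO T) rfl) (h.right_eq (f := Arrow.punctO T) rfl)]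
    have h2 := ccwDist_intCast h.rs.lt.le h.rs.lt_add
    rw [h.cast_r, h.cast_s] at h2
    simp only [AnyArrow.weight, AnyArrow.deg]
    congr 2
    omega
  | @loop D k s u v w h hu hv hw =>
    have hd := D.tag_eq
    obtain rfl : D.spoke .plain = a := by
      refine Subtype.ext ?_
      rw [ha]
      simp [edgeAt, Digon.spoke, h.cast_k, hd]
    obtain rfl : D.spoke .plain = b := by
      refine Subtype.ext ?_
      rw [hb, hv]
      simp [edgeAt, Digon.spoke, h.cast_k, hd]
    have h1 := ccwDist_intCast h.ks.lt.le h.ks.lt_add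
    have h2 := ccwDist_intCast h.sk.lt.le h.sk.lt_add
    simp only [Int.cast_add, Int.cast_natCast, CharP.cast_eq_zero, add_zero] at h2
    rw [h.cast_k, h.cast_s] at h1 h2
    rw [gammaRep_mul, gammaRep_mul, gammaRep_elt, gammaRep_elt, gammaRep_elt]
    simp only [AnyArrow.total, Matrix.single_mul_single_same, AnyArrow.weight, biMonomial_mul,
      AnyArrow.deg]
    congr 2
    omega

open Classical in
/-- The action of a product of rotations. -/
theorem Steps.gammaRep_eq (hg : Steps K σ x y g) (ha : a.1 = σ.edgeAt x) (hb : b.1 = σ.edgeAt y) :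
    gammaRep K σ g =
      Matrix.single a b (biMonomial K (y.deg - x.deg).toNat (levelFlag x y)) := by
  induction hg generalizing a with
  | @refl x c hx hc =>
    obtain rfl : c = a := Subtype.ext (hc.trans ha.symm)
    obtain rfl : c = b := Subtype.ext (hc.trans hb.symm)
    rw [gammaRep_idem, hc, edgeWeight_edgeAt hx]
    simp [levelFlag]
  | @head x y z g h hg hh ih =>
    obtain ⟨c, hc⟩ := hg.isPosition_right.exists_vertex
    rw [gammaRep_mul, hg.gammaRep_eq ha hc, ih hc hb, Matrix.single_mul_single_same,
      biMonomial_mul]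
    have h1 := hg.le.1
    have h2 := hh.le.1
    have h3 := hg.deg_lt
    have h4 := hh.deg_le
    unfold levelFlag
    rw [← Bool.decide_and]
    congr 2
    · omega
    · congr 1
      apply propext
      omega

end Action

/-! ### Spanning sets -/

section Span

variable {K : Type*} [Field K] {n : ℕ} [NeZero n] [Fact (2 ≤ n)] {σ : TaggedTriangulation n}
  {x z : Position} {a b c : σ.Vertex}

variable (K σ) in
/-- The products of rotations from a position to the positions of level `0` of an edge. -/
def near (x : Position) (b : σ.Vertex) : Set (σ.Gamma K) :=
  {y | ∃ z, z.level = 0 ∧ b.1 = σ.edgeAt z ∧ Steps K σ x z y}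

variable (K σ) in
/-- The products of rotations from a position to the other positions of an edge. -/
def far (x : Position) (b : σ.Vertex) : Set (σ.Gamma K) :=
  {y | ∃ z, z.level ≠ 0 ∧ b.1 = σ.edgeAt z ∧ Steps K σ x z y}

variable (K σ) in
/-- For the notched arc of a digon, the products of rotations to the positions of level `0` of the
side of the digon from which there is an arrow to this arc, followed by this arrow. -/
def nearNotched (x : Position) (b : σ.Vertex) : Set (σ.Gamma K) :=
  {y | ∃ D : σ.Digon, b = D.spoke .notched ∧ ∃ w ∈ near K σ x D.sideFrom,
    y = w * AnyArrow.elt K (.digonIn D .notched)}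

variable (K σ) in
/-- Elements generating the space of all linear combinations of paths ending at an edge. -/
def keys (x : Position) (b : σ.Vertex) : Set (σ.Gamma K) :=
  near K σ x b ∪ far K σ x b ∪ nearNotched K σ x b

theorem Far.mem_span {y : σ.Gamma K} (h : Far K σ x b y) :
    y ∈ Submodule.span K (keys K σ x b) := by
  rcases h with rfl | h
  · exact zero_mem _
  · exact Submodule.subset_span (Or.inl (Or.inr h))

theorem eq_digonOut_of_left {D : σ.Digon} {f : AnyArrow σ}
    (h : f.total.left = D.spoke .notched) : f = .digonOut D .notched := by
  have h1 := congrArg Subtype.val h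
  have hd := D.tag_eq
  cases f with
  | digonOut D' t =>
    obtain rfl := D'.eq D
    cases t with
    | plain => simp [AnyArrow.total, Digon.spoke] at h1
    | notched => rfl
  | punctS T => simp [AnyArrow.total, Digon.spoke, PuncturedTriangle.snd, T.tag_eq, hd] at h1
  | punctO T => simp [AnyArrow.total, Digon.spoke, PuncturedTriangle.fst, T.tag_eq, hd] at h1
  | _ =>
    simp [AnyArrow.total, Digon.spoke, OuterTriangle.ij, OuterTriangle.jk, OuterTriangle.ik,
      PuncturedTriangle.base, Digon.sideTo, Digon.sideFrom, sideTo] at h1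

theorem mul_elt_mem_span_of_mem_near {f : AnyArrow σ} {y : σ.Gamma K}
    (hy : y ∈ near K σ x f.total.left) :
    y * f.elt K ∈ Submodule.span K (keys K σ x f.total.right) := by
  obtain ⟨z, hz, hb, hy⟩ := hy
  rcases hy.isPosition_right.step_or K hb with ⟨w, hw, hw'⟩ | ⟨hz2, -⟩ | ⟨D, rfl⟩
  · refine Submodule.subset_span (Or.inl ?_)
    by_cases hl : w.level = 0
    · exact Or.inl ⟨w, hl, hw', hy.trans (.single hw)⟩
    · exact Or.inr ⟨w, hl, hw', hy.trans (.single hw)⟩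
  · omega
  · exact Submodule.subset_span (Or.inr ⟨D, rfl, y, ⟨z, hz, hb, hy⟩, rfl⟩)

theorem mul_elt_mem_span_of_mem_keys (hx : x.level ≤ 1) {f : AnyArrow σ} {y : σ.Gamma K}
    (hy : y ∈ keys K σ x f.total.left) :
    y * f.elt K ∈ Submodule.span K (keys K σ x f.total.right) := by
  rcases hy with (hy | hy) | ⟨D, hD, w, hw, rfl⟩
  · exact mul_elt_mem_span_of_mem_near hy
  · exact (Far.mul hx (Or.inr hy)).mem_span
  · obtain rfl := eq_digonOut_of_left hD
    have e : w * AnyArrow.elt K (.digonIn D .notched) * AnyArrow.elt K (.digonOut D .notched) =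
        w * AnyArrow.compl K (.digonBase D) -
          w * AnyArrow.elt K (.digonIn D .plain) * AnyArrow.elt K (.digonOut D .plain) := by
      rw [AnyArrow.compl_digonBase, mul_add, mul_assoc, mul_assoc]
      abel
    rw [e]
    obtain ⟨z, hz, hb, hw⟩ := hw
    obtain ⟨l, k, v⟩ := z
    obtain rfl : l = 0 := hz
    simp only [Digon.sideFrom, edgeAt, Edge.chord.injEq] at hb
    obtain ⟨s, h⟩ := D.exists_lifts hb.1.symm
    have h1 := isPosition_zero.1 hw.isPosition_right
    have := h.ks.lt
    have := h.ks.lt_add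
    have := h1.lt
    have := h1.lt_add
    obtain rfl : s = v := eq_of_cast_eq (h.cast_s.trans hb.2) (by omega) (by omega)
    have hbase : Turn σ s 0 (k + n) 2 (k + 2 * n) (.digonBase D) := .digonBase h rfl rfl
    refine sub_mem (Submodule.subset_span (Or.inl (Or.inl ⟨_, rfl, ?_,
      hw.trans (hbase.steps_compl rfl)⟩))) ?_
    · simp [AnyArrow.total, Digon.sideTo, edgeAt, h.cast_k, h.cast_s]
    · have hin : Far K σ x (D.spoke .plain) (w * AnyArrow.elt K (.digonIn D .plain)) := by
        refine Or.inr ⟨_, one_ne_zero, ?_, hw.trans (.single (.turn (.digonIn h rfl)))⟩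
        simp [Digon.spoke, edgeAt, h.cast_k, D.tag_eq]
      exact (Far.mul hx (f := .digonOut D .plain) hin).mem_span

theorem mul_elt_mem_span_keys (hx : x.level ≤ 1) {f : AnyArrow σ} {y : σ.Gamma K}
    (hy : y ∈ Submodule.span K (keys K σ x f.total.left)) :
    y * f.elt K ∈ Submodule.span K (keys K σ x f.total.right) := by
  have : Submodule.span K (keys K σ x f.total.left) ≤
      (Submodule.span K (keys K σ x f.total.right)).comap (LinearMap.mulRight K (f.elt K)) :=
    Submodule.span_le.2 fun y hy => mul_elt_mem_span_of_mem_keys hx hy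
  exact this hy

theorem pathElt_mem_span_keys (hp : σ.IsPosition x) (hx : x.level ≤ 1) (ha : a.1 = σ.edgeAt x)
    (p : Quiver.Path a b) : pathElt K p ∈ Submodule.span K (keys K σ x b) := by
  induction p with
  | nil =>
    refine Submodule.subset_span (Or.inl ?_)
    by_cases hl : x.level = 0
    · exact Or.inl ⟨x, hl, ha, .refl hp ha⟩
    · exact Or.inr ⟨x, hl, ha, .refl hp ha⟩
  | cons p f ih =>
    rw [show p.cons f = p.comp f.toPath from rfl, pathElt_comp, pathElt_toPath]
    have := mul_elt_mem_span_keys hx (f := Arrow.any f) (y := pathElt K p)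
    rw [Arrow.total_any] at this
    exact this ih

theorem Digon.Lifts.digonOut_mul_far {D : σ.Digon} {k s : ℤ} (h : D.Lifts k s) {y : σ.Gamma K}
    (hy : y ∈ far K σ ⟨0, s, k + n⟩ b) : AnyArrow.elt K (.digonOut D .notched) * y = 0 := by
  obtain ⟨z, hz, -, hy⟩ := hy
  have hD := h.shift 1
  rw [one_mul] at hD
  have hle := hy.le
  have hpz := hy.isPosition_right
  have bz := hpz.bounds
  have h1 := h.ks.lt
  have h2 := h.ks.lt_add
  obtain ⟨l, u, v⟩ := z
  simp only [Position.le_def] at hle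
  simp only at hz bz
  rcases hpz with ⟨hl, hp⟩ | ⟨hl, huv, hp⟩ | ⟨hl, hp⟩ <;> simp only at hl hp <;> subst hl
  · exact absurd rfl hz
  · simp only at huv
    have hu : k + n ≤ u := by
      by_contra hlt
      have := eq_of_cast_eq (h.isDigonAt.cast_eq hp) (by omega) (by omega)
      omega
    have hout : Turn σ (k + n) 1 (k + 2 * n) 2 (s + 2 * n) (.digonOut D .plain) :=
      .digonOut hD (by ring) (by ring)
    obtain ⟨y₁, hy₁⟩ := IsPosition.exists_steps K hout.isPosition_left
      hy.isPosition_right ⟨le_rfl, hu, by simp only; omega⟩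
    rw [hy.eq ((hout.steps_compl rfl).trans hy₁), AnyArrow.compl_digonOut, ← mul_assoc,
      ← mul_assoc, D.digonOut_mul_digonBase K, zero_mul, zero_mul]
  · have hv : k + 2 * n ≤ v := by
      by_contra hlt
      have := hp.not_cross_spoke h.isDigonAt.hasSpoke (by omega)
      omega
    have hbase : Turn σ s 0 (k + n) 2 (k + 2 * n) (.digonBase D) := .digonBase h rfl rfl
    obtain ⟨y₁, hy₁⟩ := IsPosition.exists_steps K hbase.isPosition_right
      hy.isPosition_right ⟨le_rfl, hle.2.1, hv⟩
    rw [hy.eq (.head (.turn hbase) hy₁), ← mul_assoc, D.digonOut_mul_digonBase K, zero_mul]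

variable (K) in
/-- Elements generating the space of all linear combinations of paths from the notched arc of a digon
to an edge. -/
def Digon.keysNotched (D : σ.Digon) (x : Position) (b : σ.Vertex) : Set (σ.Gamma K) :=
  {y | b = D.spoke .notched ∧ y = idem K b} ∪
    (fun y => AnyArrow.elt K (.digonOut D .notched) * y) '' (near K σ x b ∪ nearNotched K σ x b)

theorem Digon.Lifts.digonOut_mul_mem_span {D : σ.Digon} {k s : ℤ} (h : D.Lifts k s)
    {y : σ.Gamma K} (hy : y ∈ Submodule.span K (keys K σ ⟨0, s, k + n⟩ b)) :
    AnyArrow.elt K (.digonOut D .notched) * y ∈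
      Submodule.span K (D.keysNotched K ⟨0, s, k + n⟩ b) := by
  have : Submodule.span K (keys K σ ⟨0, s, k + n⟩ b) ≤
      (Submodule.span K (D.keysNotched K ⟨0, s, k + n⟩ b)).comap
        (LinearMap.mulLeft K (AnyArrow.elt K (.digonOut D .notched))) := by
    rw [Submodule.span_le]
    rintro y ((hy | hy) | hy)
    · exact Submodule.subset_span (Or.inr ⟨y, Or.inl hy, rfl⟩)
    · rw [SetLike.mem_coe, Submodule.mem_comap, LinearMap.mulLeft_apply, h.digonOut_mul_far hy]
      exact zero_mem _
    · exact Submodule.subset_span (Or.inr ⟨y, Or.inr hy, rfl⟩)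
  exact this hy

theorem Digon.Lifts.pathElt_mem_span {D : σ.Digon} {k s : ℤ} (h : D.Lifts k s)
    (p : Quiver.Path (D.spoke .notched) b) :
    pathElt K p ∈ Submodule.span K (D.keysNotched K ⟨0, s, k + n⟩ b) := by
  -- a nontrivial path begins with the only arrow starting at the notched arc
  suffices hp : (b = D.spoke .notched ∧ pathElt K p = idem K b) ∨
      ∃ y ∈ Submodule.span K (keys K σ ⟨0, s, k + n⟩ b),
        pathElt K p = AnyArrow.elt K (.digonOut D .notched) * y by
    rcases hp with hp | ⟨y, hy, he⟩
    · exact Submodule.subset_span (Or.inl hp)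
    · rw [he]
      exact h.digonOut_mul_mem_span hy
  induction p with
  | nil => exact Or.inl ⟨rfl, rfl⟩
  | @cons b c p f ih =>
    rw [show p.cons f = p.comp f.toPath from rfl, pathElt_comp, pathElt_toPath]
    right
    rcases ih with ⟨hb, he⟩ | ⟨y, hy, he⟩
    · have hf := eq_digonOut_of_left (f := Arrow.any f) (D := D) (by rw [Arrow.total_any]; exact hb)
      have hc : c = D.sideTo := by
        have := congrArg (fun f => f.total.right) hf
        rwa [Arrow.total_any] at this
      subst hc
      refine ⟨idem K D.sideTo, Submodule.subset_span (Or.inl (Or.inl ⟨_, rfl, ?_,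
        .refl (isPosition_zero.2 h.sk) ?_⟩)), ?_⟩
      · simp [Digon.sideTo, edgeAt, h.cast_k, h.cast_s]
      · simp [Digon.sideTo, edgeAt, h.cast_k, h.cast_s]
      · rw [he, hf, hb]
        exact (idem_mul_elt (AnyArrow.digonOut D .notched)).trans
          (elt_mul_idem (AnyArrow.digonOut D .notched)).symm
    · have := mul_elt_mem_span_keys (K := K) (x := ⟨0, s, k + n⟩) (Nat.zero_le _)
        (f := Arrow.any f) (y := y)
      rw [Arrow.total_any] at this
      exact ⟨_, this hy, by rw [he, mul_assoc]⟩

end Span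

/-! ### Faithfulness of the representation -/

section Faithful

open Polynomial

/-- A linear map is injective on the span of a set if it maps different elements of this set to
different members of a linearly independent family. -/
theorem eq_zero_of_mem_span {K M N ι : Type*} [Field K] [AddCommGroup M] [Module K M]
    [AddCommGroup N] [Module K N] {v : ι → N} (hv : LinearIndependent K v) (f : M →ₗ[K] N)
    {S : Set M} {P : ι → M → Prop} (hS : ∀ s ∈ S, ∃ i, f s = v i ∧ P i s)
    (hP : ∀ i s s', P i s → P i s' → s = s') {y : M} (hy : y ∈ Submodule.span K S)
    (h0 : f y = 0) : y = 0 := by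
  choose φ hφ hφP using hS
  have hinj : Function.Injective fun s : S => φ s s.2 := by
    intro s s' h
    have h1 := hφP s s.2
    rw [show φ s s.2 = φ s' s'.2 from h] at h1
    exact Subtype.ext (hP _ _ _ h1 (hφP s' s'.2))
  have hli : LinearIndependent K (f ∘ (Subtype.val : S → M)) := by
    have : f ∘ (Subtype.val : S → M) = v ∘ fun s : S => φ s s.2 := funext fun s => hφ s s.2
    rw [this]
    exact hv.comp _ hinj
  have := Submodule.range_ker_disjoint hli
  rw [Subtype.range_coe] at this
  exact Submodule.disjoint_def.1 this y hy h0

variable (K : Type*) [Field K]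

theorem linearIndependent_snd : LinearIndependent K fun d : ℕ => ((0, X ^ d) : K[X] × K[X]) := by
  have h := (basisMonomials K).linearIndependent.map' (LinearMap.inr K K[X] K[X])
    (LinearMap.ker_eq_bot.2 LinearMap.inr_injective)
  have e : (fun d : ℕ => ((0, X ^ d) : K[X] × K[X])) =
      LinearMap.inr K K[X] K[X] ∘ basisMonomials K := by
    funext d
    simp [X_pow_eq_monomial]
  rw [e]
  exact h

theorem linearIndependent_biMonomial :
    LinearIndependent K fun p : ℕ × Bool => biMonomial K p.1 p.2 := by
  have h := (((basisMonomials K).prod (basisMonomials K)).linearIndependent).comp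
    (fun p : ℕ × Bool => if p.2 then Sum.inr p.1 else Sum.inl p.1)
    (by rintro ⟨d, _ | _⟩ ⟨e, _ | _⟩ h <;> simp_all)
  let e := (LinearMap.fst K K[X] K[X] - LinearMap.snd K K[X] K[X]).prod (LinearMap.snd K K[X] K[X])
  have he : e ∘ (fun p : ℕ × Bool => biMonomial K p.1 p.2) =
      (basisMonomials K).prod (basisMonomials K) ∘
        fun p : ℕ × Bool => if p.2 then Sum.inr p.1 else Sum.inl p.1 := by
    funext ⟨d, c⟩
    cases c <;> simp [e, biMonomial, X_pow_eq_monomial]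
  refine LinearIndependent.of_comp e ?_
  rw [he]
  exact h

variable {K} {n : ℕ} [NeZero n] [Fact (2 ≤ n)] {σ : TaggedTriangulation n} {x z : Position}
  {a b : σ.Vertex} {y y' : σ.Gamma K}

theorem IsPosition.level_eq_of_edgeAt_eq {z' : Position} (hz : σ.IsPosition z)
    (hz' : σ.IsPosition z') (hl : z.level = 0 ↔ z'.level = 0)
    (h : σ.edgeAt z = σ.edgeAt z') : z.level = z'.level := by
  obtain ⟨l, u, v⟩ := z
  obtain ⟨l', u', v'⟩ := z'
  have h1 : l ≤ 2 := hz.bounds.1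
  have h2 : l' ≤ 2 := hz'.bounds.1
  simp only at hl ⊢
  interval_cases l <;> interval_cases l' <;> simp_all [edgeAt]

/-- A product of rotations from a given position is determined by its degree and by the edge where
it ends, together with the information whether it crosses the puncture. -/
theorem Steps.eq_of_deg_eq {z' : Position} (hy : Steps K σ x z y) (hy' : Steps K σ x z' y')
    (hl : z.level = 0 ↔ z'.level = 0) (h : σ.edgeAt z = σ.edgeAt z')
    (hd : (z.deg - x.deg).toNat = (z'.deg - x.deg).toNat) : y = y' := by
  have hz := hy.isPosition_right
  have hz' := hy'.isPosition_right
  have hll := hz.level_eq_of_edgeAt_eq hz' hl h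
  obtain ⟨m, h1, h2⟩ := hz.exists_shift hz' hll h
  have h3 := hy.deg_le
  have h4 := hy'.deg_le
  have hn := two_le_cast (n := n)
  have hm : m = 0 := by
    unfold Position.deg at h3 h4 hd
    have : 2 * (m * n) = 0 := by omega
    have : m * n = 0 := by omega
    rcases mul_eq_zero.1 this with h | h
    · exact h
    · omega
  obtain rfl : z = z' := by
    obtain ⟨l, u, v⟩ := z
    obtain ⟨l', u', v'⟩ := z'
    simp_all
  exact hy.eq hy'

variable (K) in
/-- The `(a, b)` entry of the matrix of an element of `Γ_σ`. -/
def gammaEntry (a b : σ.Vertex) : σ.Gamma K →ₗ[K] K[X] × K[X] :=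
  (Matrix.entryLinearMap K (K[X] × K[X]) a b).comp (gammaRep K σ)

theorem gammaEntry_apply : gammaEntry K a b y = gammaRep K σ y a b := rfl

theorem eq_zero_of_mem_span_keys (hx : x.level ≤ 1) (ha : a.1 = σ.edgeAt x)
    (hy : y ∈ Submodule.span K (keys K σ x b)) (h0 : gammaRep K σ y a b = 0) : y = 0 := by
  classical
  by_cases hb : ∃ D : σ.Digon, b = D.spoke .notched
  · obtain ⟨D, rfl⟩ := hb
    refine eq_zero_of_mem_span (linearIndependent_snd K)
      (gammaEntry K a (D.spoke .notched)) (P := fun d s => ∃ z w, z.level = 0 ∧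
        D.sideFrom.1 = σ.edgeAt z ∧ Steps K σ x z w ∧
        s = w * AnyArrow.elt K (.digonIn D .notched) ∧
        (z.deg - x.deg).toNat + (AnyArrow.digonIn D .notched).deg = d) ?_ ?_ hy h0
    · rintro s ((⟨z, -, hz, -⟩ | ⟨z, -, hz, -⟩) | ⟨D', hD', w, ⟨z, hl, hz, hw⟩, rfl⟩)
      · exact absurd hz.symm (edgeAt_ne_notched D)
      · exact absurd hz.symm (edgeAt_ne_notched D)
      · obtain rfl := D'.eq D
        refine ⟨_, ?_, z, w, hl, hz, hw, rfl, rfl⟩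
        have hxl : x.level = 0 := by have := hw.le.1; omega
        rw [gammaEntry_apply, gammaRep_mul, hw.gammaRep_eq ha hz, gammaRep_elt]
        simp only [AnyArrow.total]
        rw [Matrix.single_mul_single_same, Matrix.single_apply_same]
        simp [biMonomial, levelFlag, hl, hxl, AnyArrow.weight, pow_add]
    · rintro d _ _ ⟨z, w, hl, hz, hw, rfl, hd⟩ ⟨z', w', hl', hz', hw', rfl, hd'⟩
      rw [hw.eq_of_deg_eq hw' (by simp [hl, hl']) (hz.symm.trans hz') (by omega)]
  · refine eq_zero_of_mem_span (linearIndependent_biMonomial K)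
      (gammaEntry K a b) (P := fun p s => ∃ z, (z.level = 0 ↔ p.2 = true) ∧
        b.1 = σ.edgeAt z ∧ Steps K σ x z s ∧ (z.deg - x.deg).toNat = p.1) ?_ ?_ hy h0
    · rintro s ((⟨z, hl, hz, hs⟩ | ⟨z, hl, hz, hs⟩) | ⟨D, hD, -⟩)
      · refine ⟨((z.deg - x.deg).toNat, true), ?_, z, by simp [hl], hz, hs, rfl⟩
        have hxl : x.level = 0 := by have := hs.le.1; omega
        rw [gammaEntry_apply, hs.gammaRep_eq ha hz, Matrix.single_apply_same]
        simp [levelFlag, hl, hxl]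
      · refine ⟨((z.deg - x.deg).toNat, false), ?_, z, by simp [hl], hz, hs, rfl⟩
        rw [gammaEntry_apply, hs.gammaRep_eq ha hz, Matrix.single_apply_same]
        have : levelFlag x z = false := by
          simp only [levelFlag, decide_eq_false_iff_not]
          omega
        rw [this]
      · exact absurd ⟨D, hD⟩ hb
    · rintro ⟨d, c⟩ s s' ⟨z, hl, hz, hs, hd⟩ ⟨z', hl', hz', hs', hd'⟩
      exact hs.eq_of_deg_eq hs' (hl.trans hl'.symm) (hz.symm.trans hz') (hd.trans hd'.symm)

theorem Digon.Lifts.eq_zero_of_mem_span {D : σ.Digon} {k s : ℤ} (h : D.Lifts k s)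
    (hy : y ∈ Submodule.span K (D.keysNotched K ⟨0, s, k + n⟩ b))
    (h0 : gammaRep K σ y (D.spoke .notched) b = 0) : y = 0 := by
  classical
  have hto : D.sideTo.1 = σ.edgeAt ⟨0, s, k + n⟩ := by
    simp [Digon.sideTo, edgeAt, h.cast_k, h.cast_s]
  have hdist : 0 < (AnyArrow.digonOut D .notched).deg := by
    have := ccwDist_pos D.ne
    simp only [AnyArrow.deg]
    omega
  by_cases hb : b = D.spoke .notched
  · subst hb
    refine PuncturedPolygon.TaggedTriangulation.eq_zero_of_mem_span (linearIndependent_snd K)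
      (gammaEntry K (D.spoke .notched) (D.spoke .notched))
      (P := fun d t => d = 0 ∧ t = idem K (D.spoke .notched) ∨
        ∃ z w, z.level = 0 ∧ D.sideFrom.1 = σ.edgeAt z ∧ Steps K σ ⟨0, s, k + n⟩ z w ∧
        t = AnyArrow.elt K (.digonOut D .notched) *
          (w * AnyArrow.elt K (.digonIn D .notched)) ∧
        (AnyArrow.digonOut D .notched).deg + (z.deg - (s + (k + n))).toNat +
          (AnyArrow.digonIn D .notched).deg = d) ?_ ?_ hy h0
    · rintro t (⟨-, rfl⟩ | ⟨t, ⟨z, -, hz, -⟩ | ⟨D', hD', w, ⟨z, hl, hz, hw⟩, rfl⟩, rfl⟩)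
      · refine ⟨0, ?_, Or.inl ⟨rfl, rfl⟩⟩
        rw [gammaEntry_apply, gammaRep_idem, Matrix.single_apply_same]
        simp [edgeWeight, Digon.spoke, D.tag_eq]
      · exact absurd hz.symm (edgeAt_ne_notched D)
      · obtain rfl := D'.eq D
        refine ⟨_, ?_, Or.inr ⟨z, w, hl, hz, hw, rfl, rfl⟩⟩
        rw [gammaEntry_apply]
        dsimp only
        rw [gammaRep_mul, gammaRep_mul, hw.gammaRep_eq hto hz, gammaRep_elt,
          gammaRep_elt]
        simp only [AnyArrow.total]
        rw [Matrix.single_mul_single_same, Matrix.single_mul_single_same, Matrix.single_apply_same]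
        simp [biMonomial, levelFlag, hl, AnyArrow.weight, pow_add, Position.deg, mul_assoc]
    · rintro d t t' (⟨hd, rfl⟩ | ⟨z, w, hl, hz, hw, rfl, hd⟩)
        (⟨hd', rfl⟩ | ⟨z', w', hl', hz', hw', rfl, hd'⟩)
      · rfl
      · omega
      · omega
      · rw [hw.eq_of_deg_eq hw' (by simp [hl, hl']) (hz.symm.trans hz')
          (by change (z.deg - (s + (k + n))).toNat = (z'.deg - (s + (k + n))).toNat; omega)]
  · refine PuncturedPolygon.TaggedTriangulation.eq_zero_of_mem_span (linearIndependent_snd K)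
      (gammaEntry K (D.spoke .notched) b) (P := fun d t => ∃ z w, z.level = 0 ∧
        b.1 = σ.edgeAt z ∧ Steps K σ ⟨0, s, k + n⟩ z w ∧
        t = AnyArrow.elt K (.digonOut D .notched) * w ∧
        (AnyArrow.digonOut D .notched).deg + (z.deg - (s + (k + n))).toNat = d) ?_ ?_ hy h0
    · rintro t (⟨hb', -⟩ | ⟨t, ⟨z, hl, hz, hw⟩ | ⟨D', hD', -⟩, rfl⟩)
      · exact absurd hb' hb
      · refine ⟨_, ?_, z, t, hl, hz, hw, rfl, rfl⟩
        rw [gammaEntry_apply]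
        dsimp only
        rw [gammaRep_mul, hw.gammaRep_eq hto hz, gammaRep_elt]
        simp only [AnyArrow.total]
        rw [Matrix.single_mul_single_same, Matrix.single_apply_same]
        simp [biMonomial, levelFlag, hl, AnyArrow.weight, pow_add, Position.deg]
      · exact absurd (D'.eq D ▸ hD') hb
    · rintro d _ _ ⟨z, w, hl, hz, hw, rfl, hd⟩ ⟨z', w', hl', hz', hw', rfl, hd'⟩
      rw [hw.eq_of_deg_eq hw' (by simp [hl, hl']) (hz.symm.trans hz')
          (by change (z.deg - (s + (k + n))).toNat = (z'.deg - (s + (k + n))).toNat; omega)]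

/-- Every edge has a position before the puncture, except for the notched arc of a digon. -/
theorem exists_position (a : σ.Vertex) :
    (∃ x, σ.IsPosition x ∧ x.level ≤ 1 ∧ a.1 = σ.edgeAt x) ∨
      ∃ (D : σ.Digon) (k s : ℤ), D.Lifts k s ∧ a = D.spoke .notched := by
  obtain ⟨⟨r, s⟩ | ⟨r, t⟩, ha⟩ := a
  · obtain ⟨i, hi⟩ := ZMod.intCast_surjective r
    obtain ⟨j, hj, h⟩ := exists_hasChord ha hi
    exact Or.inl ⟨⟨0, i, j⟩, isPosition_zero.2 h, Nat.zero_le _, by simp [edgeAt, hi, hj]⟩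
  · obtain ⟨k, rfl⟩ := ZMod.intCast_surjective r
    have hk : σ.HasSpoke t k := ha
    by_cases ht : t = σ.tag
    · subst ht
      exact Or.inl ⟨⟨1, k, k + n⟩, isPosition_one.2 ⟨rfl, hk⟩, le_rfl, by simp [edgeAt]⟩
    · right
      have hd : σ.IsDigonAt k := by
        by_contra hd
        exact ht (hk.tag_eq_tag hd)
      have hp := hd.tag_eq_plain
      obtain rfl : t = .notched := by
        cases t
        · exact absurd hp.symm ht
        · rfl
      obtain ⟨s, h1, h2⟩ := hd.exists_sides
      obtain ⟨D, hD⟩ := h1.exists_digon hd h2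
      exact ⟨D, k, s, hD, Subtype.ext (by simp [Digon.spoke, hD.cast_k])⟩

theorem idem_mul_mul_idem_mem_span (a b : σ.Vertex) (y : σ.Gamma K) :
    idem K a * y * idem K b ∈
      Submodule.span K (Set.range (pathElt K : Quiver.Path a b → σ.Gamma K)) := by
  obtain ⟨y, rfl⟩ := jacobianMk_surjective y
  induction y using PathAlgebra.induction_on with
  | h0 => simp
  | hadd y y' h h' => rw [map_add, mul_add, add_mul]; exact add_mem h h'
  | hpath c a' b' p =>
    rw [map_smul, mul_smul_comm, smul_mul_assoc]
    refine Submodule.smul_mem _ _ ?_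
    change idem K a * pathElt K p * idem K b ∈ _
    by_cases h : a = a'
    · subst h
      rw [idem_mul_pathElt]
      by_cases h' : b' = b
      · subst h'
        rw [pathElt_mul_idem]
        exact Submodule.subset_span ⟨p, rfl⟩
      · rw [idem, pathElt_mul_of_ne _ _ h']
        exact zero_mem _
    · rw [idem, pathElt_mul_of_ne _ _ h, zero_mul]
      exact zero_mem _

theorem sum_idem : ∑ a : σ.Vertex, idem K a = 1 := by
  rw [← map_one (jacobianMk (potential K σ) σ.frozen), PathAlgebra.one_def, map_sum]
  rfl

theorem eq_sum_idem_mul_mul_idem (y : σ.Gamma K) :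
    y = ∑ a : σ.Vertex, ∑ b : σ.Vertex, idem K a * y * idem K b := by
  calc y = (∑ a : σ.Vertex, idem K a) * y * ∑ b : σ.Vertex, idem K b := by
        rw [sum_idem, one_mul, mul_one]
    _ = _ := by
      rw [Finset.sum_mul, Finset.sum_mul_sum]

variable (K σ) in
/-- The frozen Jacobian algebra acts faithfully. -/
theorem gammaRep_injective : Function.Injective (gammaRep K σ) := by
  classical
  rw [injective_iff_map_eq_zero]
  intro y hy
  rw [eq_sum_idem_mul_mul_idem y]
  refine Finset.sum_eq_zero fun a _ => Finset.sum_eq_zero fun b _ => ?_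
  have h0 : gammaRep K σ (idem K a * y * idem K b) a b = 0 := by
    rw [gammaRep_mul, gammaRep_mul, hy, mul_zero, zero_mul, Matrix.zero_apply]
  have hs := idem_mul_mul_idem_mem_span a b y
  rcases exists_position a with ⟨x, hx, hl, ha⟩ | ⟨D, k, s, h, rfl⟩
  · refine eq_zero_of_mem_span_keys hl ha (Submodule.span_le.2 ?_ hs) h0
    rintro _ ⟨p, rfl⟩
    exact pathElt_mem_span_keys hx hl ha p
  · refine h.eq_zero_of_mem_span (Submodule.span_le.2 ?_ hs) h0
    rintro _ ⟨p, rfl⟩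
    exact h.pathElt_mem_span p

end Faithful

/-! ### The algebra `R'` -/

section RPrime

open Polynomial

variable (K : Type*) [Field K] (m : ℕ)

/-- The map from `K[X, Y]` to `K[t] × K[t]` sending `X` to `(t ^ m, t ^ m)` and `Y` to
`(t ^ m, 0)`. -/
def evalPair : K[X][X] →ₐ[K] K[X] × K[X] :=
  ((expand K m).comp ((aeval (X : K[X]) : K[X][X] →ₐ[K[X]] K[X]).restrictScalars K)).prod
    ((expand K m).comp ((aeval (0 : K[X]) : K[X][X] →ₐ[K[X]] K[X]).restrictScalars K))

theorem evalPair_apply (P : K[X][X]) :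
    evalPair K m P = (expand K m (P.eval X), expand K m (P.eval 0)) := by
  simp [evalPair, coe_aeval_eq_eval]

theorem evalPair_C (p : K[X]) : evalPair K m (C p) = (expand K m p, expand K m p) := by
  simp [evalPair_apply]

variable {K m}

theorem mem_span_of_evalPair_eq_zero (hm : 0 < m) {P : K[X][X]} (h : evalPair K m P = 0) :
    P ∈ Ideal.span {(X : K[X][X]) * C X - X ^ 2} := by
  rw [evalPair_apply, Prod.mk_eq_zero] at h
  have hX : P.eval X = 0 := expand_injective hm (h.1.trans (map_zero _).symm)
  have h0 : P.eval 0 = 0 := expand_injective hm (h.2.trans (map_zero _).symm)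
  obtain ⟨S, rfl⟩ := dvd_iff_isRoot.2 h0
  rw [eval_mul, C_0, sub_zero, eval_X] at hX
  obtain ⟨T, rfl⟩ := dvd_iff_isRoot.2 ((mul_eq_zero.1 hX).resolve_left X_ne_zero)
  refine Ideal.mem_span_singleton.2 ⟨-T, ?_⟩
  rw [C_0]
  ring

variable (K m) in
/-- The map from `R'` to `K[t] × K[t]` sending `X` to `(t ^ m, t ^ m)` and `Y` to `(t ^ m, 0)`. -/
def rPrimeMap : RPrime K →ₐ[K] K[X] × K[X] :=
  Ideal.Quotient.liftₐ _ (evalPair K m) fun P hP => by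
    obtain ⟨Q, rfl⟩ := Ideal.mem_span_singleton.1 hP
    rw [map_mul, evalPair_apply]
    simp [sq, ← Prod.zero_eq_mk]

theorem rPrimeMap_mk (P : K[X][X]) : rPrimeMap K m (Ideal.Quotient.mk _ P) = evalPair K m P := rfl

theorem rPrimeMap_injective (hm : 0 < m) : Function.Injective (rPrimeMap K m) := by
  rw [injective_iff_map_eq_zero]
  intro r hr
  obtain ⟨P, rfl⟩ := Ideal.Quotient.mk_surjective r
  exact Ideal.Quotient.eq_zero_iff_mem.2 (mem_span_of_evalPair_eq_zero hm hr)

theorem biMonomial_true_mem_range (k : ℕ) : biMonomial K (m * k) true ∈ (rPrimeMap K m).range :=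
  ⟨Ideal.Quotient.mk _ (C (X ^ k)), by
    change evalPair K m _ = _
    rw [evalPair_C]
    simp [biMonomial, pow_mul]⟩

theorem biMonomial_false_mem_range (k : ℕ) :
    biMonomial K (m * (k + 1)) false ∈ (rPrimeMap K m).range :=
  ⟨Ideal.Quotient.mk _ (C (X ^ k) * X), by
    change evalPair K m _ = _
    rw [map_mul, evalPair_C, evalPair_apply]
    simp [biMonomial, pow_mul, pow_succ]⟩

/-- The range of `rPrimeMap` is generated by the images of `X` and `Y`. -/
theorem range_rPrimeMap_le {S : Subalgebra K (K[X] × K[X])} (hX : biMonomial K m true ∈ S)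
    (hY : biMonomial K m false ∈ S) : (rPrimeMap K m).range ≤ S := by
  have hC : ∀ p : K[X], evalPair K m (C p) ∈ S := by
    intro p
    induction p using Polynomial.induction_on with
    | C c =>
      rw [evalPair_C, expand_C]
      exact S.algebraMap_mem c
    | add p q hp hq => rw [C_add, map_add]; exact add_mem hp hq
    | monomial k c h =>
      rw [pow_succ, ← mul_assoc, C_mul, map_mul]
      refine mul_mem h ?_
      rw [evalPair_C, expand_X]
      exact hX
  rintro _ ⟨r, rfl⟩
  obtain ⟨P, rfl⟩ := Ideal.Quotient.mk_surjective r
  change evalPair K m P ∈ S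
  induction P using Polynomial.induction_on with
  | C p => exact hC p
  | add P Q hP hQ => rw [map_add]; exact add_mem hP hQ
  | monomial k c h =>
    rw [pow_succ, ← mul_assoc, map_mul]
    refine mul_mem h ?_
    rw [evalPair_apply, eval_X, eval_X, expand_X, map_zero]
    exact hY

end RPrime

/-! ### Central elements -/

section Centre

open Polynomial

variable {K : Type*} [Field K] {n : ℕ} [NeZero n] [Fact (2 ≤ n)] {σ : TaggedTriangulation n}
  {a b : σ.Vertex} {y z g : σ.Gamma K} {p q : K[X] × K[X]}

theorem gammaRep_one :
    letI := Classical.decEq σ.Vertex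
    gammaRep K σ 1 = Matrix.diagonal fun a => edgeWeight K σ a.1 := by
  classical
  ext1 a b
  rw [← sum_idem, map_sum, Matrix.sum_apply, Matrix.diagonal_apply, Finset.sum_eq_single a]
  · rw [gammaRep_idem, Matrix.single_apply]
    simp
  · intro c _ hc
    rw [gammaRep_idem, Matrix.single_apply_of_row_ne hc]
  · simp

theorem edgeWeight_mul_gammaRep (y : σ.Gamma K) (a b : σ.Vertex) :
    edgeWeight K σ a.1 * gammaRep K σ y a b = gammaRep K σ y a b := by
  classical
  have h := congrFun₂ (gammaRep_mul 1 y) a b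
  rw [one_mul, gammaRep_one, Matrix.diagonal_mul] at h
  exact h.symm

theorem smul_gammaRep_one_apply_of_ne (h : a ≠ b) : (p • gammaRep K σ 1) a b = 0 := by
  classical
  rw [Matrix.smul_apply, gammaRep_one, Matrix.diagonal_apply_ne _ h, smul_zero]

theorem smul_gammaRep_one_apply_self : (p • gammaRep K σ 1) a a = edgeWeight K σ a.1 * p := by
  classical
  rw [Matrix.smul_apply, gammaRep_one, Matrix.diagonal_apply_eq, smul_eq_mul, mul_comm]

theorem gammaRep_mul_of_eq_smul (h : gammaRep K σ y = p • gammaRep K σ 1) (z : σ.Gamma K) :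
    gammaRep K σ (y * z) = p • gammaRep K σ z := by
  rw [gammaRep_mul, h, Matrix.smul_mul, ← gammaRep_mul, one_mul]

/-- As the representation is faithful, the elements acting by scalars are central. -/
theorem mem_center_of_gammaRep_eq_smul (h : gammaRep K σ y = p • gammaRep K σ 1) :
    y ∈ Subalgebra.center K (σ.Gamma K) := by
  rw [Subalgebra.mem_center_iff]
  intro z
  apply gammaRep_injective K σ
  rw [gammaRep_mul_of_eq_smul h, gammaRep_mul, h, Matrix.mul_smul, ← gammaRep_mul, mul_one]

open Classical in
theorem exists_gammaRep_eq_smul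
    (h : ∀ a : σ.Vertex, ∃ g, gammaRep K σ g = Matrix.single a a (edgeWeight K σ a.1 * p)) :
    ∃ y, gammaRep K σ y = p • gammaRep K σ 1 := by
  choose g hg using h
  refine ⟨∑ a, g a, ?_⟩
  rw [← sum_idem, map_sum, map_sum, Finset.smul_sum]
  refine Finset.sum_congr rfl fun a _ => ?_
  rw [hg, gammaRep_idem, Matrix.smul_single, smul_eq_mul, mul_comm]

theorem IsPosition.shift {x : Position} (hx : σ.IsPosition x) (m : ℤ) :
    σ.IsPosition ⟨x.level, x.fst + m * n, x.snd + m * n⟩ := by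
  obtain ⟨l, u, v⟩ := x
  rcases hx with ⟨rfl, h⟩ | ⟨rfl, h1, h⟩ | ⟨rfl, h⟩
  · exact isPosition_zero.2 (h.shift m)
  · exact isPosition_one.2 ⟨by simp only at h1 ⊢; omega, h.shift m⟩
  · refine isPosition_two.2 ?_
    have := h.shift m
    simp only at this ⊢
    convert this using 1
    ring

theorem edgeAt_shift (x : Position) (m : ℤ) :
    σ.edgeAt ⟨x.level, x.fst + m * n, x.snd + m * n⟩ = σ.edgeAt x := by
  unfold edgeAt
  simp only [intCast_add_mul]

open Classical in
/-- Half a turn of an edge that has a position before the puncture. -/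
theorem IsPosition.exists_halfTurn {x : Position} (hx : σ.IsPosition x) (ha : a.1 = σ.edgeAt x) :
    ∃ g, gammaRep K σ g =
      Matrix.single a a (edgeWeight K σ a.1 * biMonomial K (2 * n) true) := by
  have hx' := hx.shift 1
  obtain ⟨g, hg⟩ := IsPosition.exists_steps K hx hx' ⟨le_rfl, by simp, by simp⟩
  refine ⟨g, ?_⟩
  rw [hg.gammaRep_eq ha (ha.trans (edgeAt_shift x 1).symm), ha, edgeWeight_edgeAt hx,
    biMonomial_mul]
  congr 2
  · simp only [Position.deg]
    omega
  · simp [levelFlag]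

open Classical in
theorem Digon.Lifts.exists_halfTurn {D : σ.Digon} {k s : ℤ} (h : D.Lifts k s) :
    ∃ g, gammaRep K σ g = Matrix.single (D.spoke .notched) (D.spoke .notched)
      (edgeWeight K σ (D.spoke .notched).1 * biMonomial K (2 * n) true) := by
  have hto : D.sideTo.1 = σ.edgeAt ⟨0, s, k + n⟩ := by
    simp [Digon.sideTo, edgeAt, h.cast_k, h.cast_s]
  have hfrom : D.sideFrom.1 = σ.edgeAt ⟨0, k + n, s + n⟩ := by
    simp [Digon.sideFrom, edgeAt, h.cast_k, h.cast_s]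
  have h1 := ccwDist_intCast h.ks.lt.le h.ks.lt_add
  have h2 := ccwDist_intCast h.sk.lt.le h.sk.lt_add
  simp only [Int.cast_add, Int.cast_natCast, CharP.cast_eq_zero, add_zero] at h2
  rw [h.cast_k, h.cast_s] at h1 h2
  obtain ⟨g, hg⟩ := IsPosition.exists_steps K (isPosition_zero.2 h.sk)
    (isPosition_zero.2 h.ks.add) ⟨le_rfl, h.sk.lt.le, h.ks.add.lt.le.trans' (by simp)⟩
  refine ⟨AnyArrow.elt K (.digonOut D .notched) * g * AnyArrow.elt K (.digonIn D .notched), ?_⟩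
  rw [gammaRep_mul, gammaRep_mul, hg.gammaRep_eq hto hfrom, gammaRep_elt, gammaRep_elt]
  simp only [AnyArrow.total]
  rw [Matrix.single_mul_single_same, Matrix.single_mul_single_same]
  congr 1
  simp only [AnyArrow.weight, biMonomial, levelFlag, edgeWeight, Digon.spoke, D.tag_eq,
    Position.deg, AnyArrow.deg]
  simp [← pow_add]
  congr 1
  omega

variable (K σ) in
theorem exists_gammaRep_eq_X : ∃ y, gammaRep K σ y = biMonomial K (2 * n) true • gammaRep K σ 1 := by
  refine exists_gammaRep_eq_smul fun a => ?_
  rcases exists_position a with ⟨x, hx, -, ha⟩ | ⟨D, k, s, h, rfl⟩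
  · exact hx.exists_halfTurn ha
  · exact h.exists_halfTurn

variable (K σ) in
theorem exists_gammaRep_eq_Y : ∃ y, gammaRep K σ y = biMonomial K (2 * n) false • gammaRep K σ 1 := by
  classical
  refine exists_gammaRep_eq_smul fun a => ?_
  rcases exists_position a with ⟨⟨l, u, v⟩, hx, hl, ha⟩ | ⟨D, k, s, h, rfl⟩
  · obtain rfl | rfl : l = 0 ∨ l = 1 := by simp only at hl; omega
    · have hc := isPosition_zero.1 hx
      have h1 := hc.lt
      have h2 := hc.lt_add
      have hx' : σ.IsPosition ⟨2, v, u + 2 * n⟩ := isPosition_two'.2 hc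
      obtain ⟨g, hg⟩ := IsPosition.exists_steps K hx hx'
        ⟨Nat.zero_le _, h1.le, by simp only; omega⟩
      refine ⟨g, ?_⟩
      rw [hg.gammaRep_eq ha (ha.trans (by simp [edgeAt])), ha, edgeWeight_edgeAt hx,
        biMonomial_mul]
      congr 2
      simp only [Position.deg]
      omega
    · obtain ⟨g, hg⟩ := hx.exists_halfTurn (K := K) ha
      refine ⟨g, ?_⟩
      rw [hg, ha, edgeWeight_edgeAt hx, biMonomial_mul, biMonomial_mul]
      simp
  · refine ⟨0, ?_⟩
    have h0 : edgeWeight K σ (D.spoke .notched).1 * biMonomial K (2 * n) false = 0 := by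
      simp [edgeWeight, Digon.spoke, D.tag_eq, biMonomial]
    rw [map_zero, h0, Matrix.single_zero]

/-- The side of the polygon at which the action of central elements is read off. -/
def baseSide (σ : TaggedTriangulation n) : σ.Vertex := σ.sideFrom ((0 : ℤ) : ZMod n)

theorem baseSide_eq : σ.baseSide.1 = σ.edgeAt ⟨0, 0, 0 + 1⟩ := edgeAt_sideFrom 0

theorem edgeWeight_baseSide : edgeWeight K σ σ.baseSide.1 = 1 := by
  simp [edgeWeight, baseSide, sideFrom, biMonomial, Prod.one_eq_mk]

open Classical in
theorem mul_eq_mul_of_mem_center (hz : z ∈ Subalgebra.center K (σ.Gamma K))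
    (hg : gammaRep K σ g = Matrix.single a b q) :
    gammaRep K σ z a a * q = q * gammaRep K σ z b b := by
  have h := congrArg (gammaRep K σ) (Subalgebra.mem_center_iff.1 hz g)
  rw [gammaRep_mul, gammaRep_mul, hg] at h
  have h' := congrFun₂ h a b
  rw [Matrix.single_mul_apply_same, Matrix.mul_single_apply_same] at h'
  exact h'.symm

theorem gammaRep_apply_of_ne (hz : z ∈ Subalgebra.center K (σ.Gamma K)) (hab : a ≠ b) :
    gammaRep K σ z a b = 0 := by
  classical
  have h := congrArg (gammaRep K σ) (Subalgebra.mem_center_iff.1 hz (idem K a))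
  rw [gammaRep_mul, gammaRep_mul, gammaRep_idem] at h
  have h' := congrFun₂ h a b
  rw [Matrix.single_mul_apply_same, Matrix.mul_single_apply_of_ne _ _ _ _ _ hab.symm,
    edgeWeight_mul_gammaRep] at h'
  exact h'

theorem exists_shift_le (i j : ℤ) : ∃ m : ℤ, i ≤ j + m * n := by
  have hn := two_le_cast (n := n)
  exact ⟨|i - j|, by nlinarith [le_abs_self (i - j), abs_nonneg (i - j)]⟩

open Classical in
/-- A rotation from the base side to another edge. -/
theorem IsPosition.exists_from_baseSide {x : Position} (hx : σ.IsPosition x)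
    (ha : a.1 = σ.edgeAt x) :
    ∃ g d, gammaRep K σ g =
      Matrix.single σ.baseSide a (biMonomial K d (decide (x.level = 0))) := by
  obtain ⟨m, hm⟩ := exists_shift_le (n := n) 1 (min x.fst x.snd)
  have h0 : σ.IsPosition ⟨0, 0, 0 + 1⟩ := isPosition_sideFrom 0
  obtain ⟨g, hg⟩ := IsPosition.exists_steps K h0 (hx.shift m)
    ⟨Nat.zero_le _, by simp only; omega, by simp only; omega⟩
  have h := hg.gammaRep_eq baseSide_eq (ha.trans (edgeAt_shift x m).symm)
  have e : levelFlag ⟨0, 0, 0 + 1⟩ ⟨x.level, x.fst + m * n, x.snd + m * n⟩ =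
      decide (x.level = 0) := by simp [levelFlag, eq_comm]
  rw [e] at h
  exact ⟨g, _, h⟩

theorem gammaRep_eq_of_mem_center (hz : z ∈ Subalgebra.center K (σ.Gamma K)) :
    gammaRep K σ z = gammaRep K σ z σ.baseSide σ.baseSide • gammaRep K σ 1 := by
  classical
  have hX : ∀ d : ℕ, (X ^ d : K[X]) ≠ 0 := fun d => pow_ne_zero _ X_ne_zero
  have key : ∀ (a : σ.Vertex) (x : Position), σ.IsPosition x → x.level ≤ 1 → a.1 = σ.edgeAt x →
      gammaRep K σ z a a = edgeWeight K σ a.1 * gammaRep K σ z σ.baseSide σ.baseSide := by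
    intro a x hx hl ha
    obtain ⟨g, d, hg⟩ := hx.exists_from_baseSide (K := K) ha
    have h := mul_eq_mul_of_mem_center hz hg
    have h1 := congrArg Prod.fst h
    rw [Prod.fst_mul, Prod.fst_mul, mul_comm] at h1
    have h1 := mul_left_cancel₀ (hX d) h1
    rw [← edgeWeight_mul_gammaRep z a a, ha, edgeWeight_edgeAt hx]
    refine Prod.ext ?_ ?_
    · simp [biMonomial, h1]
    · by_cases hl0 : x.level = 0
      · have h2 := congrArg Prod.snd h
        rw [Prod.snd_mul, Prod.snd_mul, mul_comm] at h2
        simp only [biMonomial, hl0, decide_true, if_true] at h2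
        have h2 := mul_left_cancel₀ (hX d) h2
        simp [biMonomial, h2]
      · have : x.level = 1 := by omega
        simp [biMonomial, this]
  ext1 a b
  by_cases hab : a = b
  · subst hab
    rw [smul_gammaRep_one_apply_self]
    rcases exists_position a with ⟨x, hx, hl, ha⟩ | ⟨D, k, s, h, rfl⟩
    · exact key a x hx hl ha
    · have hto : D.sideTo.1 = σ.edgeAt ⟨0, s, k + n⟩ := by
        simp [Digon.sideTo, edgeAt, h.cast_k, h.cast_s]
      have h1 := key _ _ (isPosition_zero.2 h.sk) (Nat.zero_le _) hto
      have h2 := mul_eq_mul_of_mem_center hz (gammaRep_elt (K := K) (.digonOut D .notched))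
      have h2 := congrArg Prod.snd h2
      simp only [AnyArrow.total] at h2
      rw [Prod.snd_mul, Prod.snd_mul, mul_comm, h1] at h2
      simp only [AnyArrow.weight] at h2
      have h2 := mul_left_cancel₀ (hX _) h2
      rw [← edgeWeight_mul_gammaRep]
      refine Prod.ext ?_ ?_
      · simp [edgeWeight, Digon.spoke, D.tag_eq]
      · rw [Prod.snd_mul, Prod.snd_mul, h2]
        simp [edgeWeight, Digon.sideTo, biMonomial]
  · rw [gammaRep_apply_of_ne hz hab, smul_gammaRep_one_apply_of_ne hab]

/-- The rotations of a side are the half turns and those which exchange its endpoints. -/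
theorem Steps.gammaEntry_baseSide_mem_range {x : Position} (hy : Steps K σ ⟨0, 0, 0 + 1⟩ x y)
    (hx : σ.baseSide.1 = σ.edgeAt x) :
    gammaEntry K σ.baseSide σ.baseSide y ∈ (rPrimeMap K (2 * n)).range := by
  classical
  have hn := two_le_cast (n := n)
  have h0 : σ.IsPosition ⟨0, 0, 0 + 1⟩ := isPosition_sideFrom 0
  have hp := hy.isPosition_right
  have hle := hy.le
  have hs : σ.baseSide.1.IsSide := rfl
  obtain ⟨l, u, v⟩ := x
  rw [gammaEntry_apply, hy.gammaRep_eq baseSide_eq hx, Matrix.single_apply_same]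
  simp only [Position.deg, Position.le_def] at hle ⊢
  rcases hp.eq_of_isSide (hx ▸ hs) with ⟨rfl, rfl⟩ | ⟨rfl, rfl⟩
  · obtain ⟨m, h1, -⟩ := h0.exists_shift hp rfl (baseSide_eq.symm.trans hx)
    simp only [zero_add] at h1
    subst h1
    have hm : 0 ≤ m := by
      by_contra hneg
      nlinarith
    obtain ⟨m, rfl⟩ := Int.eq_ofNat_of_zero_le hm
    rw [show (m * n + (m * n + 1) - (0 + (0 + 1)) : ℤ).toNat = 2 * n * m by
      rw [show (m * n + (m * n + 1) - (0 + (0 + 1)) : ℤ) = (2 * n * m : ℕ) by push_cast; ring,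
        Int.toNat_natCast]]
    exact biMonomial_true_mem_range m
  · have h2 : σ.IsPosition ⟨2, 0 + 1, 0 + 2 * n⟩ := isPosition_two'.2 (isPosition_zero.1 h0)
    obtain ⟨m, h1, -⟩ := h2.exists_shift hp rfl
      (Eq.trans (by simp [edgeAt]) (baseSide_eq.symm.trans hx))
    simp only at h1
    subst h1
    have hm : 0 ≤ m := by
      by_contra hneg
      nlinarith
    obtain ⟨m, rfl⟩ := Int.eq_ofNat_of_zero_le hm
    rw [show (0 + 1 + m * n + (0 + 1 + m * n - 1 + 2 * n) - (0 + (0 + 1)) : ℤ).toNat =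
        2 * n * (m + 1) by
      rw [show (0 + 1 + m * n + (0 + 1 + m * n - 1 + 2 * n) - (0 + (0 + 1)) : ℤ) =
        (2 * n * (m + 1) : ℕ) by push_cast; ring, Int.toNat_natCast]]
    exact biMonomial_false_mem_range m

theorem gammaRep_baseSide_mem_range (y : σ.Gamma K) :
    gammaRep K σ y σ.baseSide σ.baseSide ∈ (rPrimeMap K (2 * n)).range := by
  classical
  have h0 : σ.IsPosition ⟨0, 0, 0 + 1⟩ := isPosition_sideFrom 0
  have e : gammaRep K σ y σ.baseSide σ.baseSide =
      gammaEntry K σ.baseSide σ.baseSide (idem K σ.baseSide * y * idem K σ.baseSide) := by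
    rw [gammaEntry_apply, gammaRep_mul, gammaRep_mul, gammaRep_idem,
      Matrix.mul_single_apply_same, Matrix.single_mul_apply_same, edgeWeight_baseSide, one_mul,
      mul_one]
  have hs := idem_mul_mul_idem_mem_span σ.baseSide σ.baseSide y
  have hle : Submodule.span K (Set.range (pathElt K : Quiver.Path σ.baseSide σ.baseSide →
      σ.Gamma K)) ≤ Submodule.span K (keys K σ ⟨0, 0, 0 + 1⟩ σ.baseSide) := by
    rw [Submodule.span_le]
    rintro _ ⟨p, rfl⟩
    exact pathElt_mem_span_keys h0 (Nat.zero_le _) baseSide_eq p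
  have hle' : Submodule.span K (keys K σ ⟨0, 0, 0 + 1⟩ σ.baseSide) ≤
      (Subalgebra.toSubmodule (rPrimeMap K (2 * n)).range).comap
        (gammaEntry K σ.baseSide σ.baseSide) := by
    rw [Submodule.span_le]
    rintro y ((⟨z, -, hz, hy⟩ | ⟨z, -, hz, hy⟩) | ⟨D, hD, -⟩)
    · exact hy.gammaEntry_baseSide_mem_range hz
    · exact hy.gammaEntry_baseSide_mem_range hz
    · have := congrArg Subtype.val hD
      simp [baseSide, sideFrom, Digon.spoke] at this
  rw [e]
  exact hle' (hle hs)

variable (K σ) in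
/-- The scalar by which a central element acts. -/
def centreMap : Subalgebra.center K (σ.Gamma K) →ₐ[K] K[X] × K[X] where
  toFun z := gammaRep K σ z.1 σ.baseSide σ.baseSide
  map_one' := by
    classical
    change gammaRep K σ 1 _ _ = _
    rw [gammaRep_one, Matrix.diagonal_apply_eq, edgeWeight_baseSide]
  map_mul' z z' := by
    change gammaRep K σ (z.1 * z'.1) _ _ = _
    rw [gammaRep_mul_of_eq_smul (gammaRep_eq_of_mem_center z.2), Matrix.smul_apply, smul_eq_mul]
  map_zero' := by
    change gammaRep K σ 0 _ _ = _
    rw [map_zero, Matrix.zero_apply]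
  map_add' z z' := by
    change gammaRep K σ (z.1 + z'.1) _ _ = _
    rw [map_add, Matrix.add_apply]
  commutes' c := by
    classical
    change gammaRep K σ (algebraMap K (σ.Gamma K) c) _ _ = _
    rw [Algebra.algebraMap_eq_smul_one, map_smul, gammaRep_one, Matrix.smul_apply,
      Matrix.diagonal_apply_eq, edgeWeight_baseSide, Algebra.algebraMap_eq_smul_one]

theorem gammaRep_eq_centreMap (z : Subalgebra.center K (σ.Gamma K)) :
    gammaRep K σ z.1 = centreMap K σ z • gammaRep K σ 1 :=
  gammaRep_eq_of_mem_center z.2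

theorem centreMap_injective : Function.Injective (centreMap K σ) := by
  intro z z' h
  refine Subtype.ext (gammaRep_injective K σ ?_)
  rw [gammaRep_eq_centreMap, gammaRep_eq_centreMap, h]

theorem mem_range_centreMap (h : gammaRep K σ y = p • gammaRep K σ 1) :
    p ∈ (centreMap K σ).range := by
  classical
  refine ⟨⟨y, mem_center_of_gammaRep_eq_smul h⟩, ?_⟩
  change gammaRep K σ y _ _ = _
  rw [h, smul_gammaRep_one_apply_self, edgeWeight_baseSide, one_mul]

theorem range_centreMap : (centreMap K σ).range = (rPrimeMap K (2 * n)).range := by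
  refine le_antisymm ?_ (range_rPrimeMap_le ?_ ?_)
  · rintro _ ⟨z, rfl⟩
    exact gammaRep_baseSide_mem_range z.1
  · exact mem_range_centreMap (exists_gammaRep_eq_X K σ).choose_spec
  · exact mem_range_centreMap (exists_gammaRep_eq_Y K σ).choose_spec

theorem two_mul_pos : 0 < 2 * n := Nat.mul_pos two_pos (NeZero.pos n)

variable (K σ) in
/-- The isomorphism from `R'` to the centre of `Γ_σ`. -/
def centreEquiv : RPrime K ≃ₐ[K] Subalgebra.center K (σ.Gamma K) :=
  (AlgEquiv.ofInjective (rPrimeMap K (2 * n)) (rPrimeMap_injective two_mul_pos)).trans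
    ((Subalgebra.equivOfEq _ _ range_centreMap.symm).trans
      (AlgEquiv.ofInjective (centreMap K σ) centreMap_injective).symm)

theorem centreMap_centreEquiv (r : RPrime K) :
    centreMap K σ (centreEquiv K σ r) = rPrimeMap K (2 * n) r := by
  have h := congrArg Subtype.val ((AlgEquiv.ofInjective (centreMap K σ)
    centreMap_injective).apply_symm_apply (Subalgebra.equivOfEq _ _ range_centreMap.symm
      (AlgEquiv.ofInjective (rPrimeMap K (2 * n)) (rPrimeMap_injective two_mul_pos) r)))
  exact h

variable (K σ) in
/-- The structure of `K[X]`-algebra on `Γ_σ`. -/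
def polynomialMap : K[X] →+* σ.Gamma K :=
  ((Subalgebra.center K (σ.Gamma K)).val : _ →+* σ.Gamma K).comp
    ((centreEquiv K σ : RPrime K →+* Subalgebra.center K (σ.Gamma K)).comp
      ((Ideal.Quotient.mk _).comp C))

theorem polynomialMap_comm (P : K[X]) (y : σ.Gamma K) :
    polynomialMap K σ P * y = y * polynomialMap K σ P :=
  (Subalgebra.mem_center_iff.1 (centreEquiv K σ (Ideal.Quotient.mk _ (C P))).2 y).symm

theorem gammaRep_polynomialMap_mul (P : K[X]) (y : σ.Gamma K) :
    gammaRep K σ (polynomialMap K σ P * y) = expand K (2 * n) P • gammaRep K σ y := by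
  have h := gammaRep_mul_of_eq_smul
    (gammaRep_eq_centreMap (centreEquiv K σ (Ideal.Quotient.mk _ (C P)))) y
  rw [centreMap_centreEquiv, rPrimeMap_mk, evalPair_C] at h
  refine h.trans ?_
  ext1 a b
  rw [Matrix.smul_apply, Matrix.smul_apply]
  refine Prod.ext ?_ ?_ <;> simp

variable (K σ) in
theorem exists_isOrder :
    ∃ (_ : Algebra K[X] (σ.Gamma K)) (φ : RPrime K ≃ₐ[K] Subalgebra.center K (σ.Gamma K)),
      (∀ P : K[X], algebraMap K[X] (σ.Gamma K) P = (φ (Ideal.Quotient.mk _ (C P))).val) ∧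
      IsOrder K[X] (σ.Gamma K) ∧ Module.Free K[X] (σ.Gamma K) := by
  let : Algebra K[X] (σ.Gamma K) := (polynomialMap K σ).toAlgebra' polynomialMap_comm
  have hsmul : ∀ (P : K[X]) (y : σ.Gamma K), (gammaRep K σ).toAddMonoidHom (P • y) =
      (expand K (2 * n) : K[X] →+* K[X]) P • (gammaRep K σ).toAddMonoidHom y :=
    gammaRep_polynomialMap_mul
  have hfin : Module.Finite K[X] (σ.Gamma K) :=
    finite_of_injective (finite_expand K two_mul_pos) _ (gammaRep_injective K σ) hsmul
  have htf : Module.IsTorsionFree K[X] (σ.Gamma K) :=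
    isTorsionFree_of_injective (expand_injective two_mul_pos) _ (gammaRep_injective K σ) hsmul
  exact ⟨this, centreEquiv K σ, fun P => rfl, ⟨hfin, socle_eq_bot (Polynomial.not_isField K)⟩,
    inferInstance⟩

end Centre

end TaggedTriangulation

end PuncturedPolygon

end

/-- The frozen Jacobian algebra `Γ_σ` is a `K[X]`-order, free over `K[X]`, with centre `R'`. -/
theorem mainTheorem5 (K : Type*) [Field K] (n : ℕ) [NeZero n] (hn : 2 ≤ n)
    (σ : PuncturedPolygon.TaggedTriangulation n) :
    ∃ (_ : Algebra (Polynomial K) (σ.Gamma K))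
      (φ : PuncturedPolygon.RPrime K ≃ₐ[K] Subalgebra.center K (σ.Gamma K)),
      (∀ P : Polynomial K,
        algebraMap (Polynomial K) (σ.Gamma K) P =
          (φ (Ideal.Quotient.mk _ (Polynomial.C P))).val) ∧
      PuncturedPolygon.IsOrder (Polynomial K) (σ.Gamma K) ∧
      Module.Free (Polynomial K) (σ.Gamma K) := by
  have : Fact (2 ≤ n) := ⟨hn⟩
  exact PuncturedPolygon.TaggedTriangulation.exists_isOrder K σ
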